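/- Let $dA$ be area measure on $\mathbb C$, $\mathbb T$ the unit circle with normalized arc length $\frac{d\theta}{2\pi}$, and $\mathbb D$ the open unit disc. For $\beta>0$ let $F^2_\beta$ be the Hilbert space of entire functions that are square integrable with respect to $d\mu_\beta(z)=\frac{\beta}{\pi}e^{-\beta|z|^2}dA(z)$, and for $\alpha>-1$ let $A^2_\alpha$ be the Hilbert space of analytic functions on $\mathbb D$ that are square integrable with respect to $dA_\alpha(z)=\frac{\alpha+1}{\pi}(1-|z|^2)^\alpha dA(z)$, with the inner products of $L^2(\mu_\beta)$ and $L^2(dA_\alpha)$. Put $$W^\beta_z u(\zeta)=u(\zeta-z)e^{\beta\bar z\zeta-\beta|z|^2/2}\quad(z,\zeta\in\mathbb C),\qquad U^\alpha_z u(\zeta)=u\Big(\frac{\zeta-z}{1-\bar z\zeta}\Big)\Big[\frac{1-|z|^2}{(1-\bar z\zeta)^2}\Big]^{(2+\alpha)/2}\quad(z,\zeta\in\mathbb D),$$ with the principal branch of the power, $u_\theta(\zeta)=u(e^{i\theta}\zeta)$, and $d\lambda(z)=\frac{dA(z)}{\pi(1-|z|^2)^2}$ on $\mathbb D$. For $\phi,\psi\in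 F^2_\beta$ and $f\in L^\infty(\mathbb T\times\mathbb C)$, the localization operator $\mathbb L_f^{\phi,\psi,\beta}$ is the bounded operator on $F^2_\beta$ with $$\langle \mathbb L_f^{\phi,\psi,\beta}g,h\rangle=\frac\beta\pi\int_0^{2\pi}\frac{d\theta}{2\pi}\int_{\mathbb C} f(e^{i\theta},z)\langle g,W^\beta_z\phi_\theta\rangle\langle W^\beta_z\psi_\theta,h\rangle\,dA(z),\qquad g,h\in F^2_\beta,$$ and for $\phi,\psi\in A^2_\alpha$ and $f\in L^\infty(\mathbb T\times\mathbb D)$, the localization operator $\mathbf L_f^{\phi,\psi,\alpha}$ is the bounded operator on $A^2_\alpha$ with $$\langle \mathbf L_f^{\phi,\psi,\alpha}g,h\rangle=(\alpha+1)\int_0^{2\pi}\frac{d\theta}{2\pi}\int_{\mathbb D} f(e^{i\theta},z)\langle g,U^\alpha_z\phi_\theta\rangle\langle U^\alpha_z\psi_\theta,h\rangle\,d\lambda(z),\qquad g,h\in A^2_\alpha.$$ **Corollary 4.4.** Let $\beta>0$, $\phi,\psi\in F^2_\beta$, $f\in L^\infty(\mathbb T\times\mathbb C)$ and $\sigma\ge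 0$. For $r>0$ put $\phi_r(z)=\phi(rz)$, $\psi_r(z)=\psi(rz)$ and $f_{r,\sigma}(e^{i\theta},z)=(1-|z|^2)^\sigma f(e^{i\theta},rz)$ for $z\in\mathbb D$. Then the operators $\mathbb L_f^{\phi,\psi,\beta}$ and $\mathbf L_{f_{r,\sigma}}^{\phi_r,\psi_r,\beta r^2}$ ($r>0$) are well defined: the integrals above converge absolutely, and there is exactly one bounded operator with the given sesquilinear form. Moreover $$\big\|\mathbb L_f^{\phi,\psi,\beta}\big\|_{F^2_\beta\to F^2_\beta}\le\limsup_{r\to\infty}\big\|\mathbf L_{f_{r,\sigma}}^{\phi_r,\psi_r,\beta r^2}\big\|_{A^2_{\beta r^2}\to A^2_{\beta r^2}}.$$ -/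

import Mathlib

open MeasureTheory Filter Set Metric
open scoped ComplexConjugate ENNReal

noncomputable section

namespace FockBergman

/-! ### Spaces of square integrable holomorphic functions -/

/-- The functions that are holomorphic on `Ω` and square integrable with respect to `μ`. A function
on `Ω` is represented by its extension by `0` to the whole plane. -/
def holL2 (Ω : Set ℂ) (μ : Measure ℂ) : Submodule ℂ (ℂ → ℂ) where
  carrier := {g | DifferentiableOn ℂ g Ω ∧ (∀ z ∉ Ω, g z = 0) ∧ MemLp g 2 μ}
  zero_mem' := ⟨differentiableOn_const 0, fun _ _ => rfl, MemLp.zero⟩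
  add_mem' := fun hg hh => ⟨hg.1.add hh.1,
    fun z hz => by simp [hg.2.1 z hz, hh.2.1 z hz], hg.2.2.add hh.2.2⟩
  smul_mem' := fun c _ hg => ⟨hg.1.const_smul c,
    fun z hz => by simp [hg.2.1 z hz], hg.2.2.const_smul c⟩

/-- The sesquilinear integral `⟨g, h⟩ = ∫ g(ζ) * conj (h(ζ)) dμ(ζ)`, linear in `g`. -/
def pairing (μ : Measure ℂ) (g h : ℂ → ℂ) : ℂ := ∫ ζ, g ζ * conj (h ζ) ∂μ

lemma integrable_mul_conj {μ : Measure ℂ} {g h : ℂ → ℂ} (hg : MemLp g 2 μ) (hh : MemLp h 2 μ) :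
    Integrable (fun ζ => g ζ * conj (h ζ)) μ :=
  hg.integrable_mul (q := 2) hh.star

/-- The inner product of `L²(μ)` on `holL2 Ω μ`. Mathlib's inner products are linear in the second
variable, so `inner ℂ g h` is `∫ h * conj g dμ`. -/
@[reducible] def holL2Core (Ω : Set ℂ) (μ : Measure ℂ) (hdef : ∀ g ∈ holL2 Ω μ, g =ᵐ[μ] 0 → g = 0) :
    InnerProductSpace.Core ℂ (holL2 Ω μ) where
  inner g h := pairing μ h g
  conj_inner_symm g h := by
    simp only [pairing]
    rw [← integral_conj]
    congr 1
    ext ζ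
    simp [mul_comm]
  re_inner_nonneg g := by
    have : pairing μ g g = ((∫ ζ, ‖(g : ℂ → ℂ) ζ‖ ^ 2 ∂μ : ℝ) : ℂ) := by
      rw [pairing, ← integral_complex_ofReal]
      congr 1
      ext ζ
      rw [Complex.mul_conj, Complex.normSq_eq_norm_sq]
    rw [this]
    simpa using integral_nonneg fun ζ => sq_nonneg ‖(g : ℂ → ℂ) ζ‖
  add_left g h k := by
    simp only [pairing]
    rw [← integral_add (integrable_mul_conj k.2.2.2 g.2.2.2)
      (integrable_mul_conj k.2.2.2 h.2.2.2)]
    congr 1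
    ext ζ
    simp [mul_add]
  smul_left g h c := by
    simp only [pairing]
    rw [← integral_const_mul]
    congr 1
    ext ζ
    simp only [Submodule.coe_smul, Pi.smul_apply, smul_eq_mul, map_mul]
    ring
  definite g hg := by
    have h1 : pairing μ g g = ((∫ ζ, ‖(g : ℂ → ℂ) ζ‖ ^ 2 ∂μ : ℝ) : ℂ) := by
      rw [pairing, ← integral_complex_ofReal]
      congr 1
      ext ζ
      rw [Complex.mul_conj, Complex.normSq_eq_norm_sq]
    have h2 : ∫ ζ, ‖(g : ℂ → ℂ) ζ‖ ^ 2 ∂μ = 0 := by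
      have h3 := h1.symm.trans hg
      exact_mod_cast h3
    rw [integral_eq_zero_iff_of_nonneg (fun ζ => sq_nonneg _)
      ((memLp_two_iff_integrable_sq_norm g.2.2.2.1).1 g.2.2.2)] at h2
    refine Subtype.ext (hdef _ g.2 ?_)
    filter_upwards [h2] with ζ hζ
    simpa using hζ

/-! ### The Fock space -/

/-- The Gaussian measure `(β / π) exp (-β |z|²) dA(z)` on `ℂ`. -/
def fockMeasure (β : ℝ) : Measure ℂ :=
  volume.withDensity fun z => ENNReal.ofReal (β / Real.pi * Real.exp (-β * ‖z‖ ^ 2))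

lemma fock_definite {β : ℝ} (hβ : 0 < β) :
    ∀ g ∈ holL2 univ (fockMeasure β), g =ᵐ[fockMeasure β] 0 → g = 0 := by
  intro g hg h0
  have hac : (volume : Measure ℂ) ≪ fockMeasure β := by
    refine withDensity_absolutelyContinuous' (Measurable.aemeasurable (by fun_prop)) ?_
    refine Eventually.of_forall fun z => ?_
    have : 0 < β / Real.pi * Real.exp (-β * ‖z‖ ^ 2) := by positivity
    simpa using this
  exact Measure.eq_of_ae_eq (hac.ae_eq h0)
    (continuousOn_univ.1 hg.1.continuousOn) continuous_const

/-- The Fock space `F²_β`: the entire functions that are square integrable for the Gaussian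
measure. -/
def FockSpace (β : ℝ) (_hβ : 0 < β) : Type := holL2 univ (fockMeasure β)

instance (β : ℝ) (hβ : 0 < β) : CoeFun (FockSpace β hβ) fun _ => ℂ → ℂ := ⟨Subtype.val⟩

instance (β : ℝ) (hβ : 0 < β) : NormedAddCommGroup (FockSpace β hβ) :=
  (holL2Core univ (fockMeasure β) (fock_definite hβ)).toNormedAddCommGroup

instance (β : ℝ) (hβ : 0 < β) : InnerProductSpace ℂ (FockSpace β hβ) :=
  InnerProductSpace.ofCore (holL2Core univ (fockMeasure β) (fock_definite hβ)).toCore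

instance (β : ℝ) (hβ : 0 < β) : Inner ℂ (FockSpace β hβ) := InnerProductSpace.toInner

/-! ### The weighted Bergman space -/

/-- The measure `((α + 1) / π) (1 - |z|²) ^ α dA(z)` on the open unit disc. -/
def bergmanMeasure (α : ℝ) : Measure ℂ :=
  (volume.restrict (ball 0 1)).withDensity fun z =>
    ENNReal.ofReal ((α + 1) / Real.pi * (1 - ‖z‖ ^ 2) ^ α)

lemma one_sub_sq_pos {z : ℂ} (hz : z ∈ ball (0 : ℂ) 1) : 0 < 1 - ‖z‖ ^ 2 := by
  have h1 : ‖z‖ < 1 := by simpa using hz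
  nlinarith [norm_nonneg z]

lemma bergman_definite {α : ℝ} (hα : -1 < α) :
    ∀ g ∈ holL2 (ball 0 1) (bergmanMeasure α), g =ᵐ[bergmanMeasure α] 0 → g = 0 := by
  intro g hg h0
  have hac : volume.restrict (ball (0 : ℂ) 1) ≪ bergmanMeasure α := by
    refine withDensity_absolutelyContinuous' (Measurable.aemeasurable (by fun_prop)) ?_
    filter_upwards [ae_restrict_mem measurableSet_ball] with z hz
    have h1 : 0 < α + 1 := by linarith
    have h2 := one_sub_sq_pos hz
    have : 0 < (α + 1) / Real.pi * (1 - ‖z‖ ^ 2) ^ α := by positivity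
    simpa using this
  have h := Measure.eqOn_open_of_ae_eq (hac.ae_eq h0) isOpen_ball hg.1.continuousOn
    continuousOn_const
  ext z
  by_cases hz : z ∈ ball (0 : ℂ) 1
  · exact h hz
  · exact hg.2.1 z hz

/-- The weighted Bergman space `A²_α`: the holomorphic functions on the open unit disc (extended
by `0`) that are square integrable for `bergmanMeasure α`. -/
def BergmanSpace (α : ℝ) (_hα : -1 < α) : Type := holL2 (ball 0 1) (bergmanMeasure α)

instance (α : ℝ) (hα : -1 < α) : CoeFun (BergmanSpace α hα) fun _ => ℂ → ℂ := ⟨Subtype.val⟩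

instance (α : ℝ) (hα : -1 < α) : NormedAddCommGroup (BergmanSpace α hα) :=
  (holL2Core (ball 0 1) (bergmanMeasure α) (bergman_definite hα)).toNormedAddCommGroup

instance (α : ℝ) (hα : -1 < α) : InnerProductSpace ℂ (BergmanSpace α hα) :=
  InnerProductSpace.ofCore (holL2Core (ball 0 1) (bergmanMeasure α) (bergman_definite hα)).toCore

instance (α : ℝ) (hα : -1 < α) : Inner ℂ (BergmanSpace α hα) := InnerProductSpace.toInner

/-! ### The circle -/

instance : MeasurableSpace Circle := borel Circle

instance : BorelSpace Circle := ⟨rfl⟩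

/-- The normalized arc length `dθ / (2π)` on the unit circle: the image under `θ ↦ exp (iθ)` of
`dθ / (2π)` on `(0, 2π]`. -/
def circleMeasure : Measure Circle :=
  (ENNReal.ofReal (2 * Real.pi)⁻¹ • volume.restrict (Ioc 0 (2 * Real.pi))).map Circle.exp

/-- The rotate `φ_θ(ζ) = φ(exp (iθ) ζ)` of a function, with `t = exp (iθ)`. -/
def rotate (t : Circle) (φ : ℂ → ℂ) : ℂ → ℂ := fun ζ => φ (t * ζ)

/-! ### Localization operators on the Fock space -/

/-- The Weyl operator `W_z φ(ζ) = φ(ζ - z) exp (β conj(z) ζ - β |z|² / 2)`. -/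
def weyl (β : ℝ) (z : ℂ) (φ : ℂ → ℂ) : ℂ → ℂ := fun ζ =>
  φ (ζ - z) * Complex.exp (β * conj z * ζ - β * (‖z‖ : ℂ) ^ 2 / 2)

/-- The integrand `f(t, z) ⟨g, W_z φ_t⟩ ⟨W_z ψ_t, h⟩`. -/
def fockIntegrand {β : ℝ} {hβ : 0 < β} (φ ψ : FockSpace β hβ) (f : Circle × ℂ → ℂ)
    (g h : FockSpace β hβ) (t : Circle) (z : ℂ) : ℂ :=
  f (t, z) * pairing (fockMeasure β) g (weyl β z (rotate t φ)) *
    pairing (fockMeasure β) (weyl β z (rotate t ψ)) h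

/-- `T` is the localization operator on `F²_β` with windows `φ`, `ψ` and symbol `f`: its
sesquilinear form `⟨T g, h⟩` is given by the absolutely convergent integral
`(β / π) ∫ dθ/(2π) ∫ f(exp (iθ), z) ⟨g, W_z φ_θ⟩ ⟨W_z ψ_θ, h⟩ dA(z)`. -/
def IsFockLocalization {β : ℝ} {hβ : 0 < β} (φ ψ : FockSpace β hβ) (f : Circle × ℂ → ℂ)
    (T : FockSpace β hβ →L[ℂ] FockSpace β hβ) : Prop :=
  ∀ g h : FockSpace β hβ,
    Integrable (fun p : Circle × ℂ => fockIntegrand φ ψ f g h p.1 p.2)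
      (circleMeasure.prod volume) ∧
    inner ℂ h (T g) =
      (β / Real.pi : ℂ) * ∫ t, ∫ z, fockIntegrand φ ψ f g h t z ∂volume ∂circleMeasure

open Classical in
/-- The localization operator on `F²_β` with windows `φ`, `ψ` and symbol `f`. -/
def fockLocalization {β : ℝ} {hβ : 0 < β} (φ ψ : FockSpace β hβ) (f : Circle × ℂ → ℂ) :
    FockSpace β hβ →L[ℂ] FockSpace β hβ :=
  if h : ∃ T, IsFockLocalization φ ψ f T then h.choose else 0

/-! ### Localization operators on the weighted Bergman space -/

/-- The Möbius invariant area measure `dA(z) / (π (1 - |z|²)²)` on the open unit disc. -/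
def mobiusMeasure : Measure ℂ :=
  (volume.restrict (ball 0 1)).withDensity fun z =>
    ENNReal.ofReal (Real.pi * (1 - ‖z‖ ^ 2) ^ 2)⁻¹

/-- The operator
`U_z φ(ζ) = φ((ζ - z) / (1 - conj(z) ζ)) ((1 - |z|²) / (1 - conj(z) ζ)²) ^ ((2 + α) / 2)`, for `z`
and `ζ` in the open unit disc. The base of the power is not a negative real number there, and the
power is its principal branch, which is holomorphic in `ζ` and positive at `ζ = z`. -/
def mobiusShift (α : ℝ) (z : ℂ) (φ : ℂ → ℂ) : ℂ → ℂ := fun ζ =>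
  φ ((ζ - z) / (1 - conj z * ζ)) *
    ((1 - (‖z‖ : ℂ) ^ 2) / (1 - conj z * ζ) ^ 2) ^ ((2 + α : ℂ) / 2)

/-- The integrand `f(t, z) ⟨g, U_z φ_t⟩ ⟨U_z ψ_t, h⟩`. -/
def bergmanIntegrand {α : ℝ} {hα : -1 < α} (φ ψ : BergmanSpace α hα) (f : Circle × ℂ → ℂ)
    (g h : BergmanSpace α hα) (t : Circle) (z : ℂ) : ℂ :=
  f (t, z) * pairing (bergmanMeasure α) g (mobiusShift α z (rotate t φ)) *
    pairing (bergmanMeasure α) (mobiusShift α z (rotate t ψ)) h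

/-- `T` is the localization operator on `A²_α` with windows `φ`, `ψ` and symbol `f` (only the
values of `f` on the product of the circle and the open disc matter): its sesquilinear form
`⟨T g, h⟩` is given by the absolutely convergent integral
`(α + 1) ∫ dθ/(2π) ∫ f(exp (iθ), z) ⟨g, U_z φ_θ⟩ ⟨U_z ψ_θ, h⟩ dλ(z)`, where `λ` is the Möbius
invariant area measure. -/
def IsBergmanLocalization {α : ℝ} {hα : -1 < α} (φ ψ : BergmanSpace α hα) (f : Circle × ℂ → ℂ)
    (T : BergmanSpace α hα →L[ℂ] BergmanSpace α hα) : Prop :=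
  ∀ g h : BergmanSpace α hα,
    Integrable (fun p : Circle × ℂ => bergmanIntegrand φ ψ f g h p.1 p.2)
      (circleMeasure.prod mobiusMeasure) ∧
    inner ℂ h (T g) =
      (α + 1 : ℂ) * ∫ t, ∫ z, bergmanIntegrand φ ψ f g h t z ∂mobiusMeasure ∂circleMeasure

open Classical in
/-- The localization operator on `A²_α` with windows `φ`, `ψ` and symbol `f`. -/
def bergmanLocalization {α : ℝ} {hα : -1 < α} (φ ψ : BergmanSpace α hα) (f : Circle × ℂ → ℂ) :
    BergmanSpace α hα →L[ℂ] BergmanSpace α hα :=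
  if h : ∃ T, IsBergmanLocalization φ ψ f T then h.choose else 0

/-! ### Rescaling -/

lemma neg_one_lt_mul_sq {β : ℝ} (hβ : 0 < β) (r : ℝ) : -1 < β * r ^ 2 := by
  have : 0 ≤ β * r ^ 2 := by positivity
  linarith

lemma isFiniteMeasure_bergmanMeasure {α : ℝ} (hα : 0 ≤ α) :
    IsFiniteMeasure (bergmanMeasure α) := by
  refine isFiniteMeasure_withDensity_ofReal (Measure.integrableOn_of_bounded
    (M := (α + 1) / Real.pi) measure_ball_lt_top.ne
    (Measurable.aestronglyMeasurable (by fun_prop)) ?_).2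
  filter_upwards [ae_restrict_mem measurableSet_ball] with z hz
  have h1 := one_sub_sq_pos hz
  have h2 : (1 - ‖z‖ ^ 2) ^ α ≤ 1 := Real.rpow_le_one h1.le (by nlinarith [norm_nonneg z]) hα
  have h3 : 0 ≤ (α + 1) / Real.pi := by positivity
  rw [Real.norm_of_nonneg (by positivity)]
  nlinarith

lemma dilate_mem {β : ℝ} {hβ : 0 < β} (r : ℝ) (φ : FockSpace β hβ) :
    (ball 0 1).indicator (fun z : ℂ => φ (r * z)) ∈
      holL2 (ball 0 1) (bergmanMeasure (β * r ^ 2)) := by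
  have hφ : Differentiable ℂ (φ : ℂ → ℂ) := differentiableOn_univ.1 φ.2.1
  have hd : Differentiable ℂ (fun z : ℂ => φ (r * z)) := hφ.comp (by fun_prop)
  refine ⟨hd.differentiableOn.congr fun z hz => indicator_of_mem hz _,
    fun z hz => indicator_of_notMem hz _, ?_⟩
  have := isFiniteMeasure_bergmanMeasure (α := β * r ^ 2) (by positivity)
  obtain ⟨C, hC⟩ := (isCompact_closedBall (0 : ℂ) 1).exists_bound_of_continuousOn
    hd.continuous.continuousOn
  refine MemLp.of_bound ((hd.continuous.measurable.indicator
    measurableSet_ball).aestronglyMeasurable) C (Eventually.of_forall fun z => ?_)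
  by_cases hz : z ∈ ball (0 : ℂ) 1
  · rw [indicator_of_mem hz]
    exact hC z (ball_subset_closedBall hz)
  · rw [indicator_of_notMem hz, norm_zero]
    exact (norm_nonneg _).trans (hC 0 (by simp))

/-- The dilate `φ_r(z) = φ(r z)`, restricted to the open unit disc, as an element of the Bergman
space with weight parameter `β r²`. -/
def dilate {β : ℝ} {hβ : 0 < β} (r : ℝ) (φ : FockSpace β hβ) :
    BergmanSpace (β * r ^ 2) (neg_one_lt_mul_sq hβ r) :=
  ⟨(ball 0 1).indicator (fun z : ℂ => φ (r * z)), dilate_mem r φ⟩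

/-- The rescaled symbol `f_{r,σ}(t, z) = (1 - |z|²) ^ σ f(t, r z)`, for `|z| < 1`. -/
def dilateSymbol (r σ : ℝ) (f : Circle × ℂ → ℂ) : Circle × ℂ → ℂ := fun p =>
  (((1 - ‖p.2‖ ^ 2) ^ σ : ℝ) : ℂ) * f (p.1, r * p.2)

end FockBergman

end

noncomputable section

namespace FockBergman

/-! ### The circle -/

/-! Put `ξ = r z` and `α = β r²`. As `r → ∞` the discs exhaust the plane, and since `(1 - |ξ|²/r²) ^
(β r²) → exp (-β |ξ|²)`, the Bergman measures tend to the Gaussian measure, the Möbius shifts tend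
pointwise to the Weyl operators, and `(α + 1) dλ` tends to `(β/π) dA`. For fixed `g`, `h` in the
Fock space one gets `‖g_r‖ → ‖g‖` and convergence of the sesquilinear forms of the Bergman operators
at `(g_r, h_r)` to the Fock form at `(g, h)` (`tendsto_inner_localization`). The norm inequality is
then lower semicontinuity of the norm under convergence of forms: if the Bergman norms are
eventually at most `a`, then `|⟨T g, h⟩| ≤ a ‖g‖ ‖h‖`.

The limits are taken under the integral by Pratt's lemma (`tendsto_integral_of_dominated_tendsto`).
A product is dominated by the sum of the squares of its factors, and the integrals of these squares
are known exactly and converge. This is done twice: for the transforms `⟨g_r, U_z φ_r⟩`, where the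
exact value is the isometry of `U_z`, and for the forms, where it is the orthogonality relation `∫∫
|⟨g, U_z φ_θ⟩|² = ‖φ‖² ‖g‖² / (α + 1)`.

The orthogonality relations also give existence of the operators, by Cauchy-Schwarz and Riesz
representation (`existsUnique_operator`). They are proved for both spaces at once in
`IsRadial.lintegral_pairing_normSq`, with Fourier series on the circle instead of Schur's lemma. The
family of shifted windows is equivariant under rotations, so `∫ |⟨g, u_p⟩|²` does not change when
`g` is rotated; averaging over rotations removes the cross terms between Taylor coefficients. What
remains depends only on the numbers `∫ |b_k(p)|²`, where `b_k(p)` are the coefficients of `u_p`, and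
these are read off from `∫ |u_p(w)|² = C K(w, w)`, a change of variables. Rotating the windows by
`θ` is what makes this equivariance available. -/

lemma circleMeasure_eq_map [Fact (0 < 2 * Real.pi)] :
    circleMeasure = ENNReal.ofReal (2 * Real.pi)⁻¹ •
      (volume : Measure (AddCircle (2 * Real.pi))).map AddCircle.toCircle := by
  have h := AddCircle.measurePreserving_mk (2 * Real.pi) 0
  have hm : Measurable (AddCircle.toCircle : AddCircle (2 * Real.pi) → Circle) :=
    AddCircle.continuous_toCircle.measurable
  rw [← h.map_eq, Measure.map_map hm h.measurable, zero_add, ← Measure.map_smul]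
  rw [circleMeasure, Measure.map_smul, Measure.map_smul]
  congr 2
  ext θ
  have : 2 * Real.pi ≠ 0 := Fact.out (p := 0 < 2 * Real.pi) |>.ne'
  simp [AddCircle.toCircle_apply_mk, this]

instance : IsProbabilityMeasure circleMeasure := by
  refine ⟨?_⟩
  rw [circleMeasure, Measure.map_apply Circle.exp.continuous.measurable MeasurableSet.univ]
  simp only [preimage_univ, Measure.smul_apply, MeasurableSet.univ, Measure.restrict_apply,
    univ_inter, Real.volume_Ioc, sub_zero, smul_eq_mul]
  rw [← ENNReal.ofReal_mul (by positivity), inv_mul_cancel₀ (by positivity), ENNReal.ofReal_one]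

/-- On the additive circle multiplication by `c` becomes a translation, and Haar measure there is
translation invariant. -/
lemma measurePreserving_circle_mul (c : Circle) :
    MeasurePreserving (fun s => c * s) circleMeasure circleMeasure := by
  have : Fact (0 < 2 * Real.pi) := ⟨by positivity⟩
  refine ⟨measurable_const_mul c, ?_⟩
  have hm : Measurable (AddCircle.toCircle : AddCircle (2 * Real.pi) → Circle) :=
    AddCircle.continuous_toCircle.measurable
  obtain ⟨x, hx⟩ := (AddCircle.homeomorphCircle (T := 2 * Real.pi) (by positivity)).surjective c
  have hx' : AddCircle.toCircle x = c := by
    rw [← AddCircle.homeomorphCircle_apply (by positivity), hx]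
  rw [circleMeasure_eq_map, Measure.map_smul, Measure.map_map (measurable_const_mul c) hm]
  congr 1
  conv_rhs => rw [← (measurePreserving_add_left volume x).map_eq,
    Measure.map_map hm (measurable_const_add x)]
  congr 1
  ext y
  simp [AddCircle.toCircle_add, hx']

@[fun_prop]
lemma measurable_circle_coe : Measurable fun s : Circle => (s : ℂ) :=
  Continuous.measurable (by fun_prop)

lemma measurableEmbedding_circle_mul (c : Circle) : MeasurableEmbedding (fun s => c * s) :=
  (Homeomorph.mulLeft c).measurableEmbedding

lemma integral_circle_zpow (n : ℤ) :
    ∫ s : Circle, (s : ℂ) ^ n ∂circleMeasure = if n = 0 then 1 else 0 := by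
  split_ifs with hn
  · simp [hn]
  · obtain ⟨c, hc⟩ : ∃ c : Circle, (c : ℂ) ^ n ≠ 1 := by
      -- This point satisfies `c ^ n = -1`; rotating by it multiplies the integral by `-1` and also
      -- leaves it unchanged.
      refine ⟨Circle.exp (Real.pi / n), ?_⟩
      have hn' : (n : ℂ) ≠ 0 := by exact_mod_cast hn
      rw [Circle.coe_exp, ← Complex.exp_int_mul]
      have : (n : ℂ) * (((Real.pi / n : ℝ) : ℂ) * Complex.I) = Real.pi * Complex.I := by
        push_cast
        field_simp
      rw [this, Complex.exp_pi_mul_I]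
      norm_num
    have h := (measurePreserving_circle_mul c).integral_comp (measurableEmbedding_circle_mul c)
      (fun s : Circle => (s : ℂ) ^ n)
    simp only [Circle.coe_mul, mul_zpow] at h
    rw [integral_const_mul] at h
    have h2 : ((c : ℂ) ^ n - 1) * ∫ s : Circle, (s : ℂ) ^ n ∂circleMeasure = 0 := by
      rw [sub_mul, h]; ring
    exact (mul_eq_zero.1 h2).resolve_left (sub_ne_zero.2 hc)

lemma integral_circle_pow_mul_conj (j k : ℕ) :
    ∫ s : Circle, (s : ℂ) ^ j * conj ((s : ℂ) ^ k) ∂circleMeasure = if j = k then 1 else 0 := by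
  have h := integral_circle_zpow ((j : ℤ) - k)
  simp only [sub_eq_zero, Nat.cast_inj] at h
  rw [← h]
  congr 1
  ext s
  have hs : (s : ℂ) ≠ 0 := Circle.coe_ne_zero s
  rw [zpow_sub₀ hs, map_pow, ← Circle.coe_inv_eq_conj, Circle.coe_inv]
  simp [div_eq_mul_inv]

lemma integrable_circle_of_continuous {g : Circle → ℂ} (hg : Continuous g) :
    Integrable g circleMeasure :=
  hg.integrable_of_hasCompactSupport (HasCompactSupport.of_compactSpace g)

lemma continuous_tsum_circle {a : ℕ → ℂ} (ha : Summable fun k => ‖a k‖) :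
    Continuous fun s : Circle => ∑' k, a k * (s : ℂ) ^ k := by
  refine continuous_tsum (fun k => by fun_prop) ha fun k s => ?_
  simp [Circle.norm_coe]

/-- Termwise integration of a power series on the circle against a continuous function. -/
lemma hasSum_integral_circle {a : ℕ → ℂ} (ha : Summable fun k => ‖a k‖) {g : Circle → ℂ}
    (hg : Continuous g) :
    HasSum (fun k => a k * ∫ s : Circle, (s : ℂ) ^ k * g s ∂circleMeasure)
      (∫ s : Circle, (∑' k, a k * (s : ℂ) ^ k) * g s ∂circleMeasure) := by
  obtain ⟨C, hC⟩ := isCompact_univ.exists_bound_of_continuousOn hg.continuousOn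
  have h := hasSum_integral_of_summable_integral_norm (μ := circleMeasure)
    (F := fun k (s : Circle) => a k * (s : ℂ) ^ k * g s)
    (fun k => integrable_circle_of_continuous (by fun_prop)) ?_
  · convert! h using 1
    · ext k
      rw [← integral_const_mul]
      simp only [mul_assoc]
    · congr 1
      ext s
      exact tsum_mul_right.symm
  · refine Summable.of_nonneg_of_le (fun k => by positivity) (fun k => ?_) (ha.mul_right C)
    calc _ ≤ ∫ s : Circle, ‖a k‖ * C ∂circleMeasure := by
          refine integral_mono_of_nonneg (Eventually.of_forall fun s => by positivity)
            (integrable_const _) (Eventually.of_forall fun s => ?_)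
          simp only [norm_mul, norm_pow, Circle.norm_coe, one_pow, mul_one]
          exact mul_le_mul_of_nonneg_left (hC s (mem_univ s)) (norm_nonneg _)
      _ = _ := by simp

/-- Parseval's identity on the circle. -/
lemma integral_circle_normSq {a : ℕ → ℂ} (ha : Summable fun k => ‖a k‖) :
    HasSum (fun k => ‖a k‖ ^ 2)
      (∫ s : Circle, ‖∑' k, a k * (s : ℂ) ^ k‖ ^ 2 ∂circleMeasure) := by
  have hc := continuous_tsum_circle ha
  have h := hasSum_integral_circle ha (g := fun s => conj (∑' k, a k * (s : ℂ) ^ k))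
    (Complex.continuous_conj.comp hc)
  -- Termwise integration is used a second time, now against one character, so that the inner
  -- integral picks out a single coefficient.
  have h1 : ∀ k, ∫ s : Circle, (s : ℂ) ^ k * conj (∑' k, a k * (s : ℂ) ^ k) ∂circleMeasure =
      conj (a k) := by
    intro k
    have h2 := hasSum_integral_circle ha (g := fun s => conj ((s : ℂ) ^ k))
      (Complex.continuous_conj.comp (by fun_prop))
    simp only [integral_circle_pow_mul_conj] at h2
    have h3 : ∫ s : Circle, (∑' k, a k * (s : ℂ) ^ k) * conj ((s : ℂ) ^ k) ∂circleMeasure =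
        a k := by
      refine h2.unique ?_
      convert! hasSum_ite_eq k (a k) using 2 with j
      split_ifs with hjk
      · simp [hjk]
      · simp
    rw [← h3, ← integral_conj]
    congr 1
    ext s
    simp [mul_comm]
  simp only [h1] at h
  have h4 : ∀ z : ℂ, z * conj z = ((‖z‖ ^ 2 : ℝ) : ℂ) := fun z => by
    rw [Complex.mul_conj, Complex.normSq_eq_norm_sq]
  simp only [h4, integral_complex_ofReal] at h
  exact_mod_cast h

/-- Parseval in `ℝ≥0∞`, so that it combines with Tonelli without any prior integrability. -/
lemma lintegral_circle_normSq {a : ℕ → ℂ} (ha : Summable fun k => ‖a k‖) {g : Circle → ℂ}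
    (hg : ∀ s : Circle, HasSum (fun k => a k * (s : ℂ) ^ k) (g s)) :
    ∫⁻ s, ‖g s‖ₑ ^ 2 ∂circleMeasure = ∑' k, ‖a k‖ₑ ^ 2 := by
  have hg' : g = fun s : Circle => ∑' k, a k * (s : ℂ) ^ k := by
    ext s
    exact (hg s).tsum_eq.symm
  have hc : Continuous g := hg' ▸ continuous_tsum_circle ha
  have h := integral_circle_normSq ha
  simp only [← (funext_iff.1 hg' _)] at h
  have h1 : ∀ z : ℂ, ‖z‖ₑ ^ 2 = ENNReal.ofReal (‖z‖ ^ 2) := fun z => by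
    rw [ENNReal.ofReal_pow (norm_nonneg _), ofReal_norm]
  simp only [h1]
  rw [← ofReal_integral_eq_lintegral_ofReal, ← ENNReal.ofReal_tsum_of_nonneg
    (fun k => by positivity) h.summable, h.tsum_eq]
  · have := integrable_circle_of_continuous (g := fun s => ((‖g s‖ ^ 2 : ℝ) : ℂ)) (by fun_prop)
    simpa [← Complex.ofReal_pow] using this.re
  · exact Eventually.of_forall fun s => by positivity

/-! ### Rotation invariant spaces of holomorphic functions -/

/-- The measure `μ` is rotation invariant and carried by the plane or the open unit disc `Ω`, its
moments `∫ |z| ^ (2k) dμ` are the positive numbers `m k`, and the series of the reproducing kernel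
converges on `Ω`. -/
structure IsRadial (Ω : Set ℂ) (μ : Measure ℂ) (m : ℕ → ℝ) : Prop where
  domain : Ω = univ ∨ Ω = ball 0 1
  ae_mem : ∀ᵐ z ∂μ, z ∈ Ω
  rot : ∀ s : Circle, MeasurePreserving (fun z : ℂ => (s : ℂ) * z) μ μ
  moment_pos : ∀ k, 0 < m k
  moment : ∀ k, ∫⁻ z, ‖z ^ k‖ₑ ^ 2 ∂μ = ENNReal.ofReal (m k)
  kernel_summable : ∀ z ∈ Ω, Summable fun k => ‖z ^ k‖ ^ 2 / m k

/-- The power series with coefficients `a` converges to `g` on `Ω`. -/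
def HasPowerSeries (Ω : Set ℂ) (a : ℕ → ℂ) (g : ℂ → ℂ) : Prop :=
  ∀ z ∈ Ω, HasSum (fun k => a k * z ^ k) (g z)

lemma measurableEmbedding_rot (s : Circle) : MeasurableEmbedding (fun z : ℂ => (s : ℂ) * z) :=
  (Homeomorph.mulLeft₀ (s : ℂ) (Circle.coe_ne_zero s)).measurableEmbedding

lemma enorm_sq_eq_ofReal (z : ℂ) : ‖z‖ₑ ^ 2 = ENNReal.ofReal (‖z‖ ^ 2) := by
  rw [ENNReal.ofReal_pow (norm_nonneg _), ofReal_norm]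

lemma integral_norm_sq_eq_toReal {μ : Measure ℂ} {g : ℂ → ℂ} (hg : AEStronglyMeasurable g μ) :
    ∫ z, ‖g z‖ ^ 2 ∂μ = (∫⁻ z, ‖g z‖ₑ ^ 2 ∂μ).toReal := by
  rw [integral_eq_lintegral_of_nonneg_ae (Eventually.of_forall fun z => by positivity)
    (by fun_prop)]
  simp only [enorm_sq_eq_ofReal]

lemma memLp_two_iff_lintegral {μ : Measure ℂ} {g : ℂ → ℂ} :
    MemLp g 2 μ ↔ AEStronglyMeasurable g μ ∧ ∫⁻ z, ‖g z‖ₑ ^ 2 ∂μ < ∞ := by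
  rw [MemLp, eLpNorm_lt_top_iff_lintegral_rpow_enorm_lt_top (by norm_num) (by norm_num)]
  norm_num

lemma HasPowerSeries.add {Ω : Set ℂ} {a b : ℕ → ℂ} {g h : ℂ → ℂ} (hg : HasPowerSeries Ω a g)
    (hh : HasPowerSeries Ω b h) : HasPowerSeries Ω (a + b) (g + h) := fun z hz => by
  simpa [add_mul] using (hg z hz).add (hh z hz)

lemma HasPowerSeries.const_smul {Ω : Set ℂ} {a : ℕ → ℂ} {g : ℂ → ℂ} (c : ℂ)
    (hg : HasPowerSeries Ω a g) : HasPowerSeries Ω (c • a) (c • g) := fun z hz => by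
  simpa [mul_assoc] using (hg z hz).mul_left c

lemma hasPowerSeries_pow (Ω : Set ℂ) (j : ℕ) :
    HasPowerSeries Ω (Pi.single j 1) fun z => z ^ j := fun z _ => by
  convert hasSum_single (f := fun k => (Pi.single j 1 : ℕ → ℂ) k * z ^ k) j ?_ using 1
  · simp
  · intro k hk
    simp [hk]

lemma HasPowerSeries.summable {Ω : Set ℂ} {a : ℕ → ℂ} {g : ℂ → ℂ} (hg : HasPowerSeries Ω a g)
    {z : ℂ} (hz : z ∈ Ω) : Summable fun k => ‖a k * z ^ k‖ :=
  (hg z hz).summable.norm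

namespace IsRadial

variable {Ω : Set ℂ} {μ : Measure ℂ} {m : ℕ → ℝ}

lemma rot_mem (hμ : IsRadial Ω μ m) (s : Circle) {z : ℂ} (hz : z ∈ Ω) : (s : ℂ) * z ∈ Ω := by
  rcases hμ.domain with rfl | rfl
  · trivial
  · simpa [Circle.norm_coe] using hz

lemma isOpen (hμ : IsRadial Ω μ m) : IsOpen Ω := by
  rcases hμ.domain with rfl | rfl
  · exact isOpen_univ
  · exact isOpen_ball

lemma ball_subset (hμ : IsRadial Ω μ m) : ball 0 1 ⊆ Ω := by
  rcases hμ.domain with rfl | rfl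
  · exact subset_univ _
  · exact Subset.rfl

lemma isFiniteMeasure (hμ : IsRadial Ω μ m) : IsFiniteMeasure μ := by
  refine ⟨?_⟩
  have := hμ.moment 0
  simp only [pow_zero, enorm_one, one_pow, lintegral_const, one_mul] at this
  rw [this]
  exact ENNReal.ofReal_lt_top

lemma exists_hasPowerSeries (hμ : IsRadial Ω μ m) {g : ℂ → ℂ} (hg : DifferentiableOn ℂ g Ω) :
    ∃ a, HasPowerSeries Ω a g := by
  refine ⟨fun k => (k.factorial : ℂ)⁻¹ * iteratedDeriv k g 0, fun z hz => ?_⟩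
  have key : ∃ r : NNReal, ball (0 : ℂ) r ⊆ Ω ∧ z ∈ ball (0 : ℂ) r := by
    rcases hμ.domain with rfl | rfl
    · exact ⟨‖z‖₊ + 1, subset_univ _, by simp⟩
    · exact ⟨1, by simp, by simpa using hz⟩
  obtain ⟨r, hr, hzr⟩ := key
  have := Complex.hasSum_taylorSeries_on_ball (hg.mono hr) hzr
  convert! this using 2 with k
  simp only [sub_zero, smul_eq_mul]
  ring

lemma differentiableOn_of_hasPowerSeries (hμ : IsRadial Ω μ m) {a : ℕ → ℂ} {g : ℂ → ℂ}
    (hg : HasPowerSeries Ω a g) : DifferentiableOn ℂ g Ω := by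
  intro z hz
  -- The terms at `w` dominate the series on the disc of radius `‖w‖`, which contains `z`, so the
  -- M-test applies there.
  obtain ⟨w, hw, hzw⟩ : ∃ w ∈ Ω, ‖z‖ < ‖w‖ := by
    rcases hμ.domain with rfl | rfl
    · refine ⟨((‖z‖ + 1 : ℝ) : ℂ), trivial, ?_⟩
      rw [Complex.norm_real, Real.norm_of_nonneg (by positivity)]
      linarith
    · have hz1 : ‖z‖ < 1 := by simpa using hz
      refine ⟨(((‖z‖ + 1) / 2 : ℝ) : ℂ), ?_, ?_⟩
      · rw [mem_ball_zero_iff, Complex.norm_real, Real.norm_of_nonneg (by positivity)]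
        linarith
      · rw [Complex.norm_real, Real.norm_of_nonneg (by positivity)]
        linarith
  have hball : ball (0 : ℂ) ‖w‖ ⊆ Ω := by
    rcases hμ.domain with rfl | rfl
    · exact subset_univ _
    · exact ball_subset_ball (by simpa using (mem_ball_zero_iff.1 hw).le)
  have hd : DifferentiableOn ℂ (fun z => ∑' k, a k * z ^ k) (ball 0 ‖w‖) := by
    refine Complex.differentiableOn_tsum_of_summable_norm (hg.summable hw)
      (fun k => by fun_prop) isOpen_ball fun k y hy => ?_
    rw [norm_mul, norm_mul, norm_pow, norm_pow]
    gcongr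
    exact (mem_ball_zero_iff.1 hy).le
  have hd' : DifferentiableOn ℂ g (ball 0 ‖w‖) :=
    hd.congr fun y hy => (hg y (hball hy)).tsum_eq.symm
  exact (hd'.differentiableAt (isOpen_ball.mem_nhds (by simpa using hzw))).differentiableWithinAt

lemma lintegral_normSq_rot (hμ : IsRadial Ω μ m) {a : ℕ → ℂ} {g : ℂ → ℂ}
    (hg : HasPowerSeries Ω a g) {z : ℂ} (hz : z ∈ Ω) :
    ∫⁻ s : Circle, ‖g (s * z)‖ₑ ^ 2 ∂circleMeasure = ∑' k, ‖a k‖ₑ ^ 2 * ‖z ^ k‖ₑ ^ 2 := by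
  rw [lintegral_circle_normSq (hg.summable hz) fun s => ?_]
  · simp [mul_pow]
  · convert! hg _ (hμ.rot_mem s hz) using 2 with k
    ring

/-- The norm of a square integrable holomorphic function in terms of its Taylor coefficients. -/
lemma lintegral_normSq (hμ : IsRadial Ω μ m) {a : ℕ → ℂ} {g : ℂ → ℂ}
    (hg : HasPowerSeries Ω a g) (hgm : Measurable g) :
    ∫⁻ z, ‖g z‖ₑ ^ 2 ∂μ = ∑' k, ‖a k‖ₑ ^ 2 * ENNReal.ofReal (m k) := by
  have := hμ.isFiniteMeasure
  have h1 : ∀ s : Circle, ∫⁻ z, ‖g (s * z)‖ₑ ^ 2 ∂μ = ∫⁻ z, ‖g z‖ₑ ^ 2 ∂μ := fun s =>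
    (hμ.rot s).lintegral_comp (hgm.enorm.pow_const 2)
  have hm : Measurable fun p : Circle × ℂ => ‖g (p.1 * p.2)‖ₑ ^ 2 :=
    (hgm.comp (by fun_prop)).enorm.pow_const 2
  -- Rotation invariance of `μ` lets the integral be averaged over the circle; after Tonelli,
  -- Parseval is applied on each circle.
  calc ∫⁻ z, ‖g z‖ₑ ^ 2 ∂μ = ∫⁻ s : Circle, ∫⁻ z, ‖g (s * z)‖ₑ ^ 2 ∂μ ∂circleMeasure := by
        simp [h1]
    _ = ∫⁻ z, ∫⁻ s : Circle, ‖g (s * z)‖ₑ ^ 2 ∂circleMeasure ∂μ :=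
        lintegral_lintegral_swap hm.aemeasurable
    _ = ∫⁻ z, ∑' k, ‖a k‖ₑ ^ 2 * ‖z ^ k‖ₑ ^ 2 ∂μ := by
        refine lintegral_congr_ae ?_
        filter_upwards [hμ.ae_mem] with z hz
        exact hμ.lintegral_normSq_rot hg hz
    _ = ∑' k, ∫⁻ z, ‖a k‖ₑ ^ 2 * ‖z ^ k‖ₑ ^ 2 ∂μ :=
        lintegral_tsum fun k => by fun_prop
    _ = _ := by
        congr 1
        ext k
        rw [lintegral_const_mul _ (by fun_prop), hμ.moment]

lemma hasSum_integral_normSq (hμ : IsRadial Ω μ m) {a : ℕ → ℂ} {g : ℂ → ℂ}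
    (hg : HasPowerSeries Ω a g) (hgm : Measurable g) (hg2 : MemLp g 2 μ) :
    HasSum (fun k => ‖a k‖ ^ 2 * m k) (∫ z, ‖g z‖ ^ 2 ∂μ) := by
  have h := hμ.lintegral_normSq hg hgm
  have h1 : ∀ k, ‖a k‖ₑ ^ 2 * ENNReal.ofReal (m k) = ENNReal.ofReal (‖a k‖ ^ 2 * m k) := fun k => by
    rw [enorm_sq_eq_ofReal, ENNReal.ofReal_mul (by positivity)]
  simp only [h1] at h
  have hfin := (memLp_two_iff_lintegral.1 hg2).2
  rw [integral_norm_sq_eq_toReal hgm.aestronglyMeasurable, h]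
  rw [h] at hfin
  have := ENNReal.hasSum_toReal hfin.ne
  rw [ENNReal.tsum_toReal_eq fun k => ENNReal.ofReal_ne_top]
  refine this.congr_fun ?_
  intro k
  rw [ENNReal.toReal_ofReal (mul_nonneg (by positivity) (hμ.moment_pos k).le)]

/-- The inner product of two square integrable holomorphic functions in terms of their Taylor
coefficients. -/
lemma hasSum_pairing (hμ : IsRadial Ω μ m) {a b : ℕ → ℂ} {g h : ℂ → ℂ}
    (hg : HasPowerSeries Ω a g) (hgm : Measurable g) (hg2 : MemLp g 2 μ)
    (hh : HasPowerSeries Ω b h) (hhm : Measurable h) (hh2 : MemLp h 2 μ) :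
    HasSum (fun k => a k * conj (b k) * m k) (pairing μ g h) := by
  -- Polarization: the norm formula for `g + c h` with `c = 1, -1, I, -I` gives the formula for the
  -- pairing.
  have key : ∀ c : ℂ, HasSum (fun k => ((‖a k + c * b k‖ ^ 2 * m k : ℝ) : ℂ))
      (∫ z, ((‖g z + c * h z‖ ^ 2 : ℝ) : ℂ) ∂μ) := fun c => by
    rw [integral_complex_ofReal]
    exact Complex.hasSum_ofReal.2 (hμ.hasSum_integral_normSq (hg.add (hh.const_smul c))
      (hgm.add (hhm.const_smul c)) (hg2.add (hh2.const_smul c)))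
  have hint : ∀ c : ℂ, Integrable (fun z => ((‖g z + c * h z‖ ^ 2 : ℝ) : ℂ)) μ := fun c =>
    Integrable.ofReal ((memLp_two_iff_integrable_sq_norm
      (hgm.add (hhm.const_smul c)).aestronglyMeasurable).1 (hg2.add (hh2.const_smul c)))
  have polar : ∀ x y : ℂ, x * conj y = (1 / 4) * (((‖x + 1 * y‖ ^ 2 : ℝ) : ℂ) -
      ((‖x + (-1) * y‖ ^ 2 : ℝ) : ℂ) + Complex.I * ((‖x + Complex.I * y‖ ^ 2 : ℝ) : ℂ) -
      Complex.I * ((‖x + (-Complex.I) * y‖ ^ 2 : ℝ) : ℂ)) := fun x y => by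
    simp only [← Complex.normSq_eq_norm_sq, ← Complex.mul_conj, map_add, map_mul, map_neg,
      map_one, Complex.conj_I]
    ring_nf
    simp only [Complex.I_sq]
    ring_nf
    try simp only [Complex.I_sq]
    try ring
  have hsum := ((((key 1).sub (key (-1))).add ((key Complex.I).mul_left Complex.I)).sub
    ((key (-Complex.I)).mul_left Complex.I)).mul_left (1 / 4)
  have hp : pairing μ g h = (1 / 4) * ((∫ z, ((‖g z + 1 * h z‖ ^ 2 : ℝ) : ℂ) ∂μ) -
      (∫ z, ((‖g z + (-1) * h z‖ ^ 2 : ℝ) : ℂ) ∂μ) +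
      Complex.I * (∫ z, ((‖g z + Complex.I * h z‖ ^ 2 : ℝ) : ℂ) ∂μ) -
      Complex.I * ∫ z, ((‖g z + (-Complex.I) * h z‖ ^ 2 : ℝ) : ℂ) ∂μ) := by
    rw [← integral_const_mul, ← integral_const_mul, ← integral_sub (hint _) (hint _),
      ← integral_add (by exact (hint _).sub (hint _)) ((hint _).const_mul _),
      ← integral_sub (by exact ((hint _).sub (hint _)).add ((hint _).const_mul _))
        ((hint _).const_mul _), ← integral_const_mul]
    exact integral_congr_ae (Eventually.of_forall fun z => polar _ _)
  rw [hp]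
  refine hsum.congr_fun fun k => ?_
  rw [polar (a k) (b k)]
  push_cast
  ring

lemma measurable_of_mem (hμ : IsRadial Ω μ m) {g : ℂ → ℂ} (hg : DifferentiableOn ℂ g Ω)
    (h0 : ∀ z ∉ Ω, g z = 0) : Measurable g := by
  have h1 : Ω.indicator g = g := indicator_eq_self.2 fun z hz => by
    by_contra h
    exact hz (h0 z h)
  rw [← h1]
  classical
  have := hg.continuousOn.measurable_piecewise (g := fun _ => (0 : ℂ)) continuousOn_const
    hμ.isOpen.measurableSet
  simpa [piecewise_eq_indicator] using! this

end IsRadial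

/-! ### Uniqueness of power series coefficients on `(0, 1)` -/

lemma coeff_eq_zero_of_hasSum_zero {d : ℕ → ℝ}
    (h : ∀ x : ℝ, 0 < x → x < 1 → HasSum (fun k => d k * x ^ k) 0) (n : ℕ) : d n = 0 := by
  induction n using Nat.strong_induction_on with
  | _ n ih =>
  -- The terms below `n` vanish by induction. Dividing the rest by `x ^ n` and letting `x → 0` from
  -- the right isolates `d n`; nothing is assumed at `x = 0` itself.
  have h1 : ∀ x : ℝ, 0 < x → x < 1 → HasSum (fun k => d (k + n) * x ^ k) 0 := by
    intro x hx0 hx1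
    have h2 := (hasSum_nat_add_iff' n).2 (h x hx0 hx1)
    rw [Finset.sum_eq_zero fun i hi => by rw [ih i (Finset.mem_range.1 hi), zero_mul],
      sub_zero] at h2
    have h3 := h2.mul_left (x ^ n)⁻¹
    rw [mul_zero] at h3
    refine h3.congr_fun fun k => ?_
    rw [pow_add]
    field_simp
  have hs : Summable fun k => ‖d (k + n) * (1 / 2 : ℝ) ^ k‖ :=
    (h1 (1 / 2) (by norm_num) (by norm_num)).summable.norm
  have hc : ContinuousOn (fun x : ℝ => ∑' k, d (k + n) * x ^ k) (Icc 0 (1 / 2)) := by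
    refine continuousOn_tsum (fun k => by fun_prop) hs fun k x hx => ?_
    rw [norm_mul, norm_mul, norm_pow, norm_pow, Real.norm_of_nonneg hx.1,
      Real.norm_of_nonneg (by norm_num : (0 : ℝ) ≤ 1 / 2)]
    exact mul_le_mul_of_nonneg_left (pow_le_pow_left₀ hx.1 hx.2 k) (norm_nonneg _)
  have h0 : Tendsto (fun x : ℝ => ∑' k, d (k + n) * x ^ k) (nhdsWithin 0 (Ioc 0 (1 / 2)))
      (nhds (∑' k, d (k + n) * (0 : ℝ) ^ k)) :=
    (hc 0 (by norm_num)).mono_left (nhdsWithin_mono _ Ioc_subset_Icc_self)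
  have h4 : ∑' k, d (k + n) * (0 : ℝ) ^ k = d n := by
    rw [tsum_eq_single 0 fun k hk => by simp [hk]]
    simp
  rw [h4] at h0
  have h5 : Tendsto (fun x : ℝ => ∑' k, d (k + n) * x ^ k) (nhdsWithin 0 (Ioc 0 (1 / 2)))
      (nhds 0) := by
    refine tendsto_const_nhds.congr' ?_
    filter_upwards [self_mem_nhdsWithin] with x hx
    exact (h1 x hx.1 (by linarith [hx.2])).tsum_eq.symm
  have : (nhdsWithin (0 : ℝ) (Ioc 0 (1 / 2))).NeBot := by
    rw [← mem_closure_iff_nhdsWithin_neBot, closure_Ioc (by norm_num)]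
    norm_num
  exact tendsto_nhds_unique h0 h5

/-- Uniqueness of the coefficients of a power series with nonnegative terms. -/
lemma ennreal_coeff_unique {x y : ℕ → ℝ≥0∞}
    (h : ∀ t : ℝ, 0 < t → t < 1 →
      ∑' k, x k * ENNReal.ofReal (t ^ k) = ∑' k, y k * ENNReal.ofReal (t ^ k))
    (hy : ∀ t : ℝ, 0 < t → t < 1 → ∑' k, y k * ENNReal.ofReal (t ^ k) ≠ ∞) : x = y := by
  have key : ∀ {x : ℕ → ℝ≥0∞} (t : ℝ), 0 < t → ∑' k, x k * ENNReal.ofReal (t ^ k) ≠ ∞ →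
      HasSum (fun k => (x k).toReal * t ^ k) (∑' k, x k * ENNReal.ofReal (t ^ k)).toReal := by
    intro x t ht hx
    have h1 := ENNReal.hasSum_toReal hx
    rw [ENNReal.tsum_toReal_eq fun k => ENNReal.ne_top_of_tsum_ne_top hx k]
    refine h1.congr_fun fun k => ?_
    rw [ENNReal.toReal_mul, ENNReal.toReal_ofReal (by positivity)]
  -- Finiteness of the coefficients is needed because `toReal` does not distinguish `∞` from `0`.
  have fin : ∀ {x : ℕ → ℝ≥0∞}, ∑' k, x k * ENNReal.ofReal ((1 / 2) ^ k) ≠ ∞ → ∀ k, x k ≠ ∞ := by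
    intro x hx k hk
    refine ENNReal.ne_top_of_tsum_ne_top hx k ?_
    rw [hk, ENNReal.top_mul]
    simp
  have hy2 := hy (1 / 2) (by norm_num) (by norm_num)
  have hx2 := hy2
  rw [← h (1 / 2) (by norm_num) (by norm_num)] at hx2
  ext k
  have h0 := coeff_eq_zero_of_hasSum_zero (d := fun k => (x k).toReal - (y k).toReal) ?_ k
  · exact (ENNReal.toReal_eq_toReal_iff' (fin hx2 k) (fin hy2 k)).1 (sub_eq_zero.1 h0)
  · intro t ht0 ht1
    have h1 := key t ht0 (hy t ht0 ht1)
    have h2 := key t ht0 (x := x) (by rw [h t ht0 ht1]; exact hy t ht0 ht1)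
    rw [h t ht0 ht1] at h2
    have h3 := h2.sub h1
    rw [sub_self] at h3
    exact h3.congr_fun fun k => by ring

lemma measurable_pairing {μ : Measure ℂ} [SFinite μ] {P : Type*} [MeasurableSpace P] {g u : P → ℂ → ℂ}
    (hg : Measurable (Function.uncurry g)) (hu : Measurable (Function.uncurry u)) :
    Measurable fun p => pairing μ (g p) (u p) := by
  have : StronglyMeasurable fun q : P × ℂ => g q.1 q.2 * conj (u q.1 q.2) :=
    (hg.mul (Complex.continuous_conj.measurable.comp hu)).stronglyMeasurable
  exact this.integral_prod_right'.measurable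

/-! ### Orthogonality relations and completeness for radial measures -/

namespace IsRadial

variable {Ω : Set ℂ} {μ : Measure ℂ} {m : ℕ → ℝ}

lemma memLp_pow (hμ : IsRadial Ω μ m) (k : ℕ) : MemLp (fun z : ℂ => z ^ k) 2 μ :=
  memLp_two_iff_lintegral.2 ⟨by fun_prop, by rw [hμ.moment]; exact ENNReal.ofReal_lt_top⟩

/-- As a function of the rotation `s`, the pairing is a power series in `s` with coefficients `a k *
conj (b k) * m k`, so Parseval on the circle applies. -/
lemma lintegral_pairing_rot (hμ : IsRadial Ω μ m) {a b : ℕ → ℂ} {g u : ℂ → ℂ}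
    (hg : HasPowerSeries Ω a g) (hgm : Measurable g) (hg2 : MemLp g 2 μ)
    (hu : HasPowerSeries Ω b u) (hum : Measurable u) (hu2 : MemLp u 2 μ) :
    ∫⁻ s : Circle, ‖pairing μ (fun ζ => g (s * ζ)) u‖ₑ ^ 2 ∂circleMeasure =
      ∑' k, ‖a k‖ₑ ^ 2 * ENNReal.ofReal (m k) ^ 2 * ‖b k‖ₑ ^ 2 := by
  have h1 : ∀ s : Circle, HasSum (fun k => a k * conj (b k) * m k * (s : ℂ) ^ k)
      (pairing μ (fun ζ => g (s * ζ)) u) := fun s => by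
    have hs : HasPowerSeries Ω (fun k => a k * (s : ℂ) ^ k) fun ζ => g (s * ζ) := fun z hz => by
      convert! hg _ (hμ.rot_mem s hz) using 2 with k
      ring
    refine (hμ.hasSum_pairing hs (hgm.comp (by fun_prop))
      (hg2.comp_measurePreserving (hμ.rot s)) hu hum hu2).congr_fun fun k => ?_
    ring
  have hsum : Summable fun k => ‖a k * conj (b k) * m k‖ := by
    simpa using (h1 1).summable.norm
  rw [lintegral_circle_normSq hsum h1]
  congr 1
  ext k
  have : ‖(m k : ℂ)‖ₑ = ENNReal.ofReal (m k) := by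
    rw [← ofReal_norm, Complex.norm_real, Real.norm_of_nonneg (hμ.moment_pos k).le]
  rw [enorm_mul, enorm_mul, this, RCLike.enorm_conj]
  ring

/-- Orthogonality relations for a rotation equivariant family `u` of functions: they hold for all
`g` as soon as they hold for the reproducing kernels, i.e. for the evaluations at points. -/
theorem lintegral_pairing_normSq (hμ : IsRadial Ω μ m) {P : Type*} [MeasurableSpace P]
    {ν : Measure P} [SFinite ν] {u : P → ℂ → ℂ} (hu : Measurable (Function.uncurry u))
    (hd : ∀ p, DifferentiableOn ℂ (u p) Ω) (hu2 : ∀ p, MemLp (u p) 2 μ) {C : ℝ≥0∞} (hC : C ≠ ∞)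
    (hdiag : ∀ w ∈ Ω, ∫⁻ p, ‖u p w‖ₑ ^ 2 ∂ν = C * ∑' k, ENNReal.ofReal (‖w ^ k‖ ^ 2 / m k))
    (hrot : ∀ s : Circle, ∃ τ : P → P, MeasurePreserving τ ν ν ∧
      ∀ p, ∀ ζ ∈ Ω, u (τ p) (s * ζ) = u p ζ)
    {g : ℂ → ℂ} (hg : g ∈ holL2 Ω μ) :
    ∫⁻ p, ‖pairing μ g (u p)‖ₑ ^ 2 ∂ν = C * ∫⁻ z, ‖g z‖ₑ ^ 2 ∂μ := by
  have hfin := hμ.isFiniteMeasure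
  have hum : ∀ p, Measurable (u p) := fun p => hu.comp measurable_prodMk_left
  choose b hb using fun p => hμ.exists_hasPowerSeries (hd p)
  obtain ⟨a, ha⟩ := hμ.exists_hasPowerSeries hg.1
  have hgm := hμ.measurable_of_mem hg.1 hg.2.1
  -- The coefficients were chosen for each `p` separately; pairing with `z ^ k` recovers them in a
  -- way that is measurable in `p`.
  have hbm : ∀ k, Measurable fun p => b p k := by
    intro k
    have h1 : ∀ p, pairing μ (u p) (fun z => z ^ k) = b p k * m k := fun p => by
      refine (hμ.hasSum_pairing (hb p) (hum p) (hu2 p) (hasPowerSeries_pow Ω k) (by fun_prop)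
        (hμ.memLp_pow k)).unique ?_
      have h3 := hasSum_single (f := fun j => b p j * conj ((Pi.single k 1 : ℕ → ℂ) j) * m j) k
        fun j hj => by simp [hj]
      simpa using h3
    have h2 : (fun p => b p k) = fun p => pairing μ (u p) (fun z => z ^ k) / m k := by
      ext p
      rw [h1, mul_div_cancel_right₀]
      exact_mod_cast (hμ.moment_pos k).ne'
    rw [h2]
    exact (measurable_pairing (g := u) (u := fun _ z => z ^ k) hu (by fun_prop)).div_const _
  -- the coefficients of the members of the family, by rotating the point of evaluation
  have hx : (fun k => ∫⁻ p, ‖b p k‖ₑ ^ 2 ∂ν) = fun k => C * ENNReal.ofReal (m k)⁻¹ := by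
    have hk : ∀ w ∈ Ω, ∫⁻ p, ‖u p w‖ₑ ^ 2 ∂ν =
        ∑' k, (∫⁻ p, ‖b p k‖ₑ ^ 2 ∂ν) * ENNReal.ofReal ((‖w‖ ^ 2) ^ k) := by
      intro w hw
      -- The kernel on the diagonal depends only on `‖w‖`, which allows averaging over the circle
      -- through `w`.
      have h1 : ∀ s : Circle, ∫⁻ p, ‖u p (s * w)‖ₑ ^ 2 ∂ν = ∫⁻ p, ‖u p w‖ₑ ^ 2 ∂ν := fun s => by
        rw [hdiag _ (hμ.rot_mem s hw), hdiag _ hw]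
        simp [mul_pow, Circle.norm_coe]
      have hm : Measurable fun q : Circle × P => ‖u q.2 (q.1 * w)‖ₑ ^ 2 :=
        (hu.comp (by fun_prop : Measurable fun q : Circle × P => (q.2, (q.1 : ℂ) * w))).enorm.pow_const 2
      calc _ = ∫⁻ s : Circle, ∫⁻ p, ‖u p (s * w)‖ₑ ^ 2 ∂ν ∂circleMeasure := by simp [h1]
        _ = ∫⁻ p, ∫⁻ s : Circle, ‖u p (s * w)‖ₑ ^ 2 ∂circleMeasure ∂ν :=
          lintegral_lintegral_swap hm.aemeasurable
        _ = ∫⁻ p, ∑' k, ‖b p k‖ₑ ^ 2 * ‖w ^ k‖ₑ ^ 2 ∂ν :=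
          lintegral_congr fun p => hμ.lintegral_normSq_rot (hb p) hw
        _ = ∑' k, ∫⁻ p, ‖b p k‖ₑ ^ 2 * ‖w ^ k‖ₑ ^ 2 ∂ν :=
          lintegral_tsum fun k => ((hbm k).enorm.pow_const 2).aemeasurable.mul_const _
        _ = _ := by
          congr 1
          ext k
          rw [lintegral_mul_const _ ((hbm k).enorm.pow_const 2), enorm_sq_eq_ofReal (w ^ k),
            norm_pow, pow_right_comm]
    have hk' : ∀ w ∈ Ω, ∫⁻ p, ‖u p w‖ₑ ^ 2 ∂ν =
        ∑' k, C * ENNReal.ofReal (m k)⁻¹ * ENNReal.ofReal ((‖w‖ ^ 2) ^ k) := by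
      intro w hw
      rw [hdiag w hw, ← ENNReal.tsum_mul_left]
      congr 1
      ext k
      rw [mul_assoc, ← ENNReal.ofReal_mul (inv_nonneg.2 (hμ.moment_pos k).le), norm_pow,
        pow_right_comm, div_eq_inv_mul]
    have hsqrt : ∀ t : ℝ, 0 < t → t < 1 → ∃ w ∈ Ω, ‖w‖ ^ 2 = t := by
      intro t ht0 ht1
      refine ⟨(Real.sqrt t : ℂ), hμ.ball_subset ?_, ?_⟩
      · rw [mem_ball_zero_iff, Complex.norm_real, Real.norm_of_nonneg (Real.sqrt_nonneg t)]
        rw [Real.sqrt_lt' one_pos]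
        simpa using ht1
      · rw [Complex.norm_real, Real.norm_of_nonneg (Real.sqrt_nonneg t), Real.sq_sqrt ht0.le]
    refine ennreal_coeff_unique (fun t ht0 ht1 => ?_) fun t ht0 ht1 => ?_
    · obtain ⟨w, hw, rfl⟩ := hsqrt t ht0 ht1
      rw [← hk w hw, hk' w hw]
    · obtain ⟨w, hw, rfl⟩ := hsqrt t ht0 ht1
      rw [← hk' w hw, hdiag w hw, ← ENNReal.ofReal_tsum_of_nonneg
        (fun k => div_nonneg (by positivity) (hμ.moment_pos k).le) (hμ.kernel_summable w hw)]
      exact ENNReal.mul_ne_top hC ENNReal.ofReal_ne_top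
  -- invariance under rotations of `g`
  have hgu : Measurable fun p => pairing μ g (u p) :=
    measurable_pairing (g := fun _ : P => g) (hgm.comp measurable_snd) hu
  have hS : ∀ s : Circle, ∫⁻ p, ‖pairing μ (fun ζ => g (s * ζ)) (u p)‖ₑ ^ 2 ∂ν =
      ∫⁻ p, ‖pairing μ g (u p)‖ₑ ^ 2 ∂ν := by
    intro s
    obtain ⟨τ, hτ, hτu⟩ := hrot s
    rw [← hτ.lintegral_comp (hgu.enorm.pow_const 2)]
    refine lintegral_congr fun p => ?_
    congr 2
    rw [pairing, pairing, ← (hμ.rot s).integral_comp (measurableEmbedding_rot s)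
      fun ζ => g ζ * conj (u (τ p) ζ)]
    refine integral_congr_ae ?_
    filter_upwards [hμ.ae_mem] with ζ hζ
    rw [hτu p ζ hζ]
  have hjm : Measurable fun q : Circle × P => ‖pairing μ (fun ζ => g (q.1 * ζ)) (u q.2)‖ₑ ^ 2 :=
    (measurable_pairing (g := fun (q : Circle × P) ζ => g (q.1 * ζ)) (u := fun q => u q.2)
      (hgm.comp (by fun_prop : Measurable fun x : (Circle × P) × ℂ => (x.1.1 : ℂ) * x.2))
      (hu.comp (by fun_prop : Measurable fun x : (Circle × P) × ℂ => (x.1.2, x.2)))).enorm.pow_const 2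
  -- Averaging over rotations of `g` leaves only the diagonal terms `|a k|² (m k)² ∫ |b k|²`; since
  -- `∫ |b k|² = C / m k`, they sum to `C ‖g‖²`.
  calc _ = ∫⁻ s : Circle, ∫⁻ p, ‖pairing μ (fun ζ => g (s * ζ)) (u p)‖ₑ ^ 2 ∂ν ∂circleMeasure := by
        simp [hS]
    _ = ∫⁻ p, ∫⁻ s : Circle, ‖pairing μ (fun ζ => g (s * ζ)) (u p)‖ₑ ^ 2 ∂circleMeasure ∂ν :=
        lintegral_lintegral_swap hjm.aemeasurable
    _ = ∫⁻ p, ∑' k, ‖a k‖ₑ ^ 2 * ENNReal.ofReal (m k) ^ 2 * ‖b p k‖ₑ ^ 2 ∂ν :=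
        lintegral_congr fun p =>
          hμ.lintegral_pairing_rot ha hgm hg.2.2 (hb p) (hum p) (hu2 p)
    _ = ∑' k, ∫⁻ p, ‖a k‖ₑ ^ 2 * ENNReal.ofReal (m k) ^ 2 * ‖b p k‖ₑ ^ 2 ∂ν :=
        lintegral_tsum fun k => ((hbm k).enorm.pow_const 2).aemeasurable.const_mul _
    _ = ∑' k, C * (‖a k‖ₑ ^ 2 * ENNReal.ofReal (m k)) := by
        congr 1
        ext k
        rw [lintegral_const_mul _ ((hbm k).enorm.pow_const 2), congr_fun hx k,
          ENNReal.ofReal_inv_of_pos (hμ.moment_pos k)]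
        have h1 : ENNReal.ofReal (m k) * (ENNReal.ofReal (m k))⁻¹ = 1 :=
          ENNReal.mul_inv_cancel (by simpa using hμ.moment_pos k) ENNReal.ofReal_ne_top
        calc _ = C * (‖a k‖ₑ ^ 2 * ENNReal.ofReal (m k)) *
              (ENNReal.ofReal (m k) * (ENNReal.ofReal (m k))⁻¹) := by ring
          _ = _ := by rw [h1, mul_one]
    _ = _ := by rw [ENNReal.tsum_mul_left, hμ.lintegral_normSq ha hgm]

/-- An inner product space that realizes the square integrable holomorphic functions is
complete. -/
theorem completeSpace (hμ : IsRadial Ω μ m) {E : Type*} [NormedAddCommGroup E]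
    [InnerProductSpace ℂ E] (ι : E →ₗ[ℂ] (ℂ → ℂ)) (hι : ∀ g, g ∈ holL2 Ω μ ↔ ∃ e, ι e = g)
    (hinj : Function.Injective ι) (hnorm : ∀ e, ‖e‖ ^ 2 = ∫ z, ‖ι e z‖ ^ 2 ∂μ) :
    CompleteSpace E := by
  have hsq : ∀ k, 0 < Real.sqrt (m k) := fun k => Real.sqrt_pos.2 (hμ.moment_pos k)
  have hsq2 : ∀ k, (ENNReal.ofReal (Real.sqrt (m k))) ^ 2 = ENNReal.ofReal (m k) := fun k => by
    rw [← ENNReal.ofReal_pow (hsq k).le, Real.sq_sqrt (hμ.moment_pos k).le]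
  have hnd : ∀ (x : ℂ) k, ‖x / (Real.sqrt (m k) : ℂ)‖ ^ 2 * m k = ‖x‖ ^ 2 := fun x k => by
    rw [norm_div, Complex.norm_real, Real.norm_of_nonneg (hsq k).le, div_pow,
      Real.sq_sqrt (hμ.moment_pos k).le, div_mul_cancel₀ _ (hμ.moment_pos k).ne']
  have hl2 : ∀ c : lp (fun _ : ℕ => ℂ) 2, Summable fun k => ‖c k‖ ^ 2 := fun c => by
    simpa using (lp.memℓp c).summable (by norm_num)
  -- The monomials `z ^ k / √(m k)` are orthonormal, so the space is modelled on `ℓ²` through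
  -- coefficients in this basis.
  have hex : ∀ c : lp (fun _ : ℕ => ℂ) 2, ∃ e : E,
      HasPowerSeries Ω (fun k => c k / (Real.sqrt (m k) : ℂ)) (ι e) := by
    intro c
    set G : ℂ → ℂ := Ω.indicator fun z => ∑' k, c k / (Real.sqrt (m k) : ℂ) * z ^ k with hG
    have hp : HasPowerSeries Ω (fun k => c k / (Real.sqrt (m k) : ℂ)) G := by
      intro z hz
      rw [hG, indicator_of_mem hz]
      refine Summable.hasSum (Summable.of_norm (Summable.of_nonneg_of_le
        (fun k => norm_nonneg _) (fun k => ?_) ((hl2 c).add (hμ.kernel_summable z hz))))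
      have h1 : ‖c k / (Real.sqrt (m k) : ℂ) * z ^ k‖ = ‖c k‖ * (‖z ^ k‖ / Real.sqrt (m k)) := by
        rw [norm_mul, norm_div, Complex.norm_real, Real.norm_of_nonneg (hsq k).le]
        ring
      have h2 : ‖z ^ k‖ ^ 2 / m k = (‖z ^ k‖ / Real.sqrt (m k)) ^ 2 := by
        rw [div_pow, Real.sq_sqrt (hμ.moment_pos k).le]
      rw [h1, h2]
      -- The inequality `x y ≤ x² + y²`; both sums of squares converge, the second one by
      -- summability of the kernel.
      nlinarith [sq_nonneg (‖c k‖ - ‖z ^ k‖ / Real.sqrt (m k)), sq_nonneg ‖c k‖,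
        sq_nonneg (‖z ^ k‖ / Real.sqrt (m k))]
    have hd := hμ.differentiableOn_of_hasPowerSeries hp
    have h0 : ∀ z ∉ Ω, G z = 0 := fun z hz => indicator_of_notMem hz _
    have hm := hμ.measurable_of_mem hd h0
    have hmem : G ∈ holL2 Ω μ := by
      refine ⟨hd, h0, memLp_two_iff_lintegral.2 ⟨hm.aestronglyMeasurable, ?_⟩⟩
      rw [hμ.lintegral_normSq hp hm]
      have h1 : ∀ k, ‖c k / (Real.sqrt (m k) : ℂ)‖ₑ ^ 2 * ENNReal.ofReal (m k) =
          ENNReal.ofReal (‖c k‖ ^ 2) := fun k => by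
        rw [enorm_sq_eq_ofReal, ← ENNReal.ofReal_mul (by positivity), hnd]
      simp only [h1]
      rw [← ENNReal.ofReal_tsum_of_nonneg (fun k => by positivity) (hl2 c)]
      exact ENNReal.ofReal_lt_top
    obtain ⟨e, he⟩ := (hι G).1 hmem
    exact ⟨e, he ▸ hp⟩
  -- Linearity of `J` is not needed: a surjective isometry of metric spaces already transports
  -- completeness.
  choose J hJ using hex
  have hmem : ∀ e, ι e ∈ holL2 Ω μ := fun e => (hι _).2 ⟨e, rfl⟩
  have hiso : Isometry J := by
    refine Isometry.of_dist_eq fun c d => ?_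
    rw [dist_eq_norm, dist_eq_norm, ← sq_eq_sq₀ (norm_nonneg _) (norm_nonneg _), hnorm]
    have hp : HasPowerSeries Ω (fun k => (c - d) k / (Real.sqrt (m k) : ℂ)) (ι (J c - J d)) := by
      intro z hz
      rw [map_sub]
      refine ((hJ c z hz).sub (hJ d z hz)).congr_fun fun k => ?_
      simp only [lp.coeFn_sub, Pi.sub_apply]
      ring
    have h1 := hμ.hasSum_integral_normSq hp
      (hμ.measurable_of_mem (hmem _).1 (hmem _).2.1) (hmem _).2.2
    simp only [hnd] at h1
    have h2 := lp.norm_rpow_eq_tsum (p := 2) (by norm_num) (c - d)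
    simp only [ENNReal.toReal_ofNat, Real.rpow_ofNat] at h2
    rw [h2]
    exact h1.unique (hl2 (c - d)).hasSum
  have hsurj : Function.Surjective J := by
    intro e
    obtain ⟨a, ha⟩ := hμ.exists_hasPowerSeries (hmem e).1
    have hs := hμ.hasSum_integral_normSq ha
      (hμ.measurable_of_mem (hmem e).1 (hmem e).2.1) (hmem e).2.2
    have hc : Memℓp (fun k => a k * (Real.sqrt (m k) : ℂ)) 2 := by
      refine memℓp_gen ?_
      refine hs.summable.congr fun k => ?_
      simp only [ENNReal.toReal_ofNat, Real.rpow_ofNat]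
      rw [norm_mul, Complex.norm_real, Real.norm_of_nonneg (hsq k).le, mul_pow,
        Real.sq_sqrt (hμ.moment_pos k).le]
    refine ⟨⟨_, hc⟩, hinj ?_⟩
    ext z
    by_cases hz : z ∈ Ω
    · refine (hJ _ z hz).unique ((ha z hz).congr_fun fun k => ?_)
      have : (Real.sqrt (m k) : ℂ) ≠ 0 := by exact_mod_cast (hsq k).ne'
      simp only
      field_simp
    · rw [(hmem _).2.1 z hz, (hmem _).2.1 z hz]
  exact (IsometryEquiv.mk (Equiv.ofBijective J ⟨hiso.injective, hsurj⟩) hiso).completeSpace_iff.1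
    inferInstance

end IsRadial

/-! ### Operators with an absolutely convergent sesquilinear form -/

/-- Cauchy-Schwarz, in a form without roots that matches the squared bounds from the orthogonality
relations. -/
lemma lintegral_mul_le_of_sq {P : Type*} [MeasurableSpace P] {ν : Measure P} {x y : P → ℝ≥0∞}
    (hx : AEMeasurable x ν) (hy : AEMeasurable y ν) {a b : ℝ≥0∞}
    (ha : ∫⁻ p, x p ^ 2 ∂ν ≤ a ^ 2) (hb : ∫⁻ p, y p ^ 2 ∂ν ≤ b ^ 2) :
    ∫⁻ p, x p * y p ∂ν ≤ a * b := by
  have h := ENNReal.lintegral_mul_le_Lp_mul_Lq ν Real.HolderConjugate.two_two hx hy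
  simp only [Pi.mul_apply, ENNReal.rpow_ofNat] at h
  have hs : ∀ {t a : ℝ≥0∞}, t ≤ a ^ 2 → t ^ (1 / 2 : ℝ) ≤ a := fun {t a} ht => by
    calc t ^ (1 / 2 : ℝ) ≤ (a ^ 2) ^ (1 / 2 : ℝ) := ENNReal.rpow_le_rpow ht (by norm_num)
      _ = a := by rw [← ENNReal.rpow_ofNat, ← ENNReal.rpow_mul]; norm_num
  exact h.trans (mul_le_mul' (hs ha) (hs hb))

/-- There is exactly one bounded operator with the sesquilinear form `c ∫ f A(g) conj (B(h)) dν`,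
when `f` is bounded and `A`, `B` are bounded operators into `L²(ν)`. -/
theorem existsUnique_operator {E : Type*} [NormedAddCommGroup E] [InnerProductSpace ℂ E]
    [CompleteSpace E] {P : Type*} [MeasurableSpace P] {ν : Measure P} (A B : E →ₗ[ℂ] (P → ℂ))
    (hAm : ∀ g, AEStronglyMeasurable (A g) ν) (hBm : ∀ g, AEStronglyMeasurable (B g) ν)
    {a b : ℝ} (hA : ∀ g, ∫⁻ p, ‖A g p‖ₑ ^ 2 ∂ν ≤ (ENNReal.ofReal a * ‖g‖ₑ) ^ 2)
    (hB : ∀ g, ∫⁻ p, ‖B g p‖ₑ ^ 2 ∂ν ≤ (ENNReal.ofReal b * ‖g‖ₑ) ^ 2)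
    {f : P → ℂ} (hf : MemLp f ∞ ν) (I : E → E → P → ℂ)
    (hI : ∀ g h, I g h =ᵐ[ν] fun p => f p * A g p * conj (B h p)) (c : ℂ) :
    ∃! T : E →L[ℂ] E, ∀ g h, Integrable (I g h) ν ∧ inner ℂ h (T g) = c * ∫ p, I g h p ∂ν := by
  have hM : eLpNorm f ∞ ν ≠ ∞ := hf.2.ne
  have hbound : ∀ g h, ∫⁻ p, ‖f p * A g p * conj (B h p)‖ₑ ∂ν ≤
      eLpNorm f ∞ ν * ((ENNReal.ofReal a * ‖g‖ₑ) * (ENNReal.ofReal b * ‖h‖ₑ)) := by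
    intro g h
    calc _ ≤ ∫⁻ p, eLpNorm f ∞ ν * (‖A g p‖ₑ * ‖B h p‖ₑ) ∂ν := by
          refine lintegral_mono_ae ?_
          have := ae_le_eLpNormEssSup (f := f) (μ := ν)
          filter_upwards [this] with p hp
          rw [enorm_mul, enorm_mul, RCLike.enorm_conj, mul_assoc, eLpNorm_exponent_top]
          gcongr
      _ = eLpNorm f ∞ ν * ∫⁻ p, ‖A g p‖ₑ * ‖B h p‖ₑ ∂ν :=
          lintegral_const_mul' _ _ hM
      _ ≤ _ := by
          gcongr
          exact lintegral_mul_le_of_sq (hAm g).enorm (hBm h).enorm (hA g) (hB h)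
  have hfin : ∀ g h : E, eLpNorm f ∞ ν *
      ((ENNReal.ofReal a * ‖g‖ₑ) * (ENNReal.ofReal b * ‖h‖ₑ)) < ∞ := fun g h =>
    ENNReal.mul_lt_top hf.2 (ENNReal.mul_lt_top
      (ENNReal.mul_lt_top ENNReal.ofReal_lt_top enorm_lt_top)
      (ENNReal.mul_lt_top ENNReal.ofReal_lt_top enorm_lt_top))
  have hint0 : ∀ g h, Integrable (fun p => f p * A g p * conj (B h p)) ν := fun g h =>
    ⟨(hf.1.mul (hAm g)).mul (Complex.continuous_conj.comp_aestronglyMeasurable (hBm h)),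
      (hbound g h).trans_lt (hfin g h)⟩
  have hint : ∀ g h, Integrable (I g h) ν := fun g h => (hint0 g h).congr (hI g h).symm
  have hval : ∀ g h, ∫ p, I g h p ∂ν = ∫ p, f p * A g p * conj (B h p) ∂ν := fun g h =>
    integral_congr_ae (hI g h)
  -- The factors `max a 0` and `max b 0` are the real values of `ENNReal.ofReal a` and
  -- `ENNReal.ofReal b`; the signs of `a` and `b` are not prescribed.
  have hnorm : ∀ h g, ‖c * ∫ p, f p * A g p * conj (B h p) ∂ν‖ ≤
      (‖c‖ * (eLpNorm f ∞ ν).toReal * max a 0 * max b 0) * ‖h‖ * ‖g‖ := by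
    intro h g
    have h1 := (enorm_integral_le_lintegral_enorm _).trans (hbound g h)
    have h2 := ENNReal.toReal_mono (hfin g h).ne h1
    simp only [ENNReal.toReal_mul, toReal_enorm, ENNReal.toReal_ofReal'] at h2
    rw [norm_mul]
    calc _ ≤ ‖c‖ * _ := mul_le_mul_of_nonneg_left h2 (norm_nonneg c)
      _ = _ := by ring
  let S : E →ₗ⋆[ℂ] E →ₗ[ℂ] ℂ := LinearMap.mk₂'ₛₗ (starRingEnd ℂ) (RingHom.id ℂ)
    (fun h g => c * ∫ p, f p * A g p * conj (B h p) ∂ν)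
    (fun h1 h2 g => by
      rw [← mul_add, ← integral_add (hint0 g h1) (hint0 g h2)]
      congr 2
      ext p
      simp only [map_add, Pi.add_apply]
      ring)
    (fun r h g => by
      rw [smul_eq_mul, mul_left_comm, ← integral_const_mul (conj r)]
      congr 2
      ext p
      simp only [map_smul, Pi.smul_apply, smul_eq_mul, map_mul]
      ring)
    (fun h g1 g2 => by
      rw [← mul_add, ← integral_add (hint0 g1 h) (hint0 g2 h)]
      congr 2
      ext p
      simp only [map_add, Pi.add_apply]
      ring)
    (fun r h g => by
      rw [RingHom.id_apply, smul_eq_mul, mul_left_comm, ← integral_const_mul r]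
      congr 2
      ext p
      simp only [map_smul, Pi.smul_apply, smul_eq_mul]
      ring)
  let S' : E →L⋆[ℂ] E →L[ℂ] ℂ := S.mkContinuous₂ _ hnorm
  -- Riesz representation puts the operator in the first slot, acting on `h`; the adjoint moves it
  -- to `g` in the second slot.
  refine ⟨(InnerProductSpace.continuousLinearMapOfBilin S').adjoint,
    fun g h => ⟨hint g h, ?_⟩, fun T hT => ?_⟩
  · rw [ContinuousLinearMap.adjoint_inner_right,
      InnerProductSpace.continuousLinearMapOfBilin_apply, hval]
    rfl
  · ext1 g
    refine ext_inner_left ℂ fun h => ?_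
    rw [(hT g h).2, ContinuousLinearMap.adjoint_inner_right,
      InnerProductSpace.continuousLinearMapOfBilin_apply, hval]
    rfl

/-! ### A convergence theorem -/

/-- Pratt's lemma: dominated convergence with a convergent sequence of dominating functions. -/
theorem tendsto_integral_of_dominated_tendsto {X : Type*} [MeasurableSpace X] {ν : Measure X}
    {F : ℕ → X → ℂ} {G : X → ℂ} {B : ℕ → X → ℝ≥0∞} {D : X → ℝ≥0∞}
    (hF : ∀ n, AEStronglyMeasurable (F n) ν) (hB : ∀ n, AEMeasurable (B n) ν)
    (hFB : ∀ n, ∀ᵐ x ∂ν, ‖F n x‖ₑ ≤ B n x)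
    (hFG : ∀ᵐ x ∂ν, Tendsto (fun n => F n x) atTop (nhds (G x)))
    (hBD : ∀ᵐ x ∂ν, Tendsto (fun n => B n x) atTop (nhds (D x)))
    (hint : Tendsto (fun n => ∫⁻ x, B n x ∂ν) atTop (nhds (∫⁻ x, D x ∂ν)))
    (hD : ∫⁻ x, D x ∂ν ≠ ∞) :
    Tendsto (fun n => ∫ x, F n x ∂ν) atTop (nhds (∫ x, G x ∂ν)) := by
  have hG : AEStronglyMeasurable G ν := aestronglyMeasurable_of_tendsto_ae atTop hF hFG
  have hDm : AEMeasurable D ν := aemeasurable_of_tendsto_metrizable_ae atTop hB hBD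
  have hDfin : ∀ᵐ x ∂ν, D x < ∞ := ae_lt_top' hDm hD
  have hGD : ∀ᵐ x ∂ν, ‖G x‖ₑ ≤ D x := by
    filter_upwards [ae_all_iff.2 hFB, hFG, hBD] with x h1 h2 h3
    exact le_of_tendsto_of_tendsto' h2.enorm h3 h1
  have hmin : Tendsto (fun n => ∫⁻ x, min (B n x) (D x) ∂ν) atTop (nhds (∫⁻ x, D x ∂ν)) := by
    refine tendsto_lintegral_of_dominated_convergence' D (fun n => (hB n).min hDm)
      (fun n => Eventually.of_forall fun x => min_le_right _ _) hD ?_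
    filter_upwards [hBD] with x hx
    simpa using hx.min (tendsto_const_nhds (x := D x))
  -- The excess of `B n` over `D` has vanishing integral, because `∫ B n` and `∫ min (B n) D` have
  -- the same finite limit.
  have hexc : Tendsto (fun n => ∫⁻ x, (B n x - min (B n x) (D x)) ∂ν) atTop (nhds 0) := by
    have h1 : ∀ n, ∫⁻ x, (B n x - min (B n x) (D x)) ∂ν =
        ∫⁻ x, B n x ∂ν - ∫⁻ x, min (B n x) (D x) ∂ν := fun n =>
      lintegral_sub' ((hB n).min hDm)
        ((lintegral_mono fun x => min_le_right _ _).trans_lt hD.lt_top).ne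
        (Eventually.of_forall fun x => min_le_left _ _)
    simp only [h1]
    simpa using ENNReal.Tendsto.sub hint hmin (Or.inl hD)
  have hdom : Tendsto (fun n => ∫⁻ x, min ‖F n x - G x‖ₑ (2 * D x) ∂ν) atTop (nhds 0) := by
    have h1 : Tendsto (fun n => ∫⁻ x, min ‖F n x - G x‖ₑ (2 * D x) ∂ν) atTop
        (nhds (∫⁻ _, 0 ∂ν)) := by
      refine tendsto_lintegral_of_dominated_convergence' (fun x => 2 * D x)
        (fun n => ((hF n).sub hG).enorm.min (hDm.const_mul 2))
        (fun n => Eventually.of_forall fun x => min_le_right _ _) ?_ ?_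
      · rw [lintegral_const_mul' _ _ (by simp)]
        exact ENNReal.mul_ne_top (by simp) hD
      · filter_upwards [hFG] with x hx
        have h2 : Tendsto (fun n => ‖F n x - G x‖ₑ) atTop (nhds 0) := by
          simpa using (hx.sub_const (G x)).enorm
        simpa using h2.min (tendsto_const_nhds (x := 2 * D x))
    simpa using h1
  -- Pointwise, `|F n - G|` is at most its truncation at `2 D` plus the excess of `B n` over `D`:
  -- when it exceeds `2 D`, use `|F n - G| ≤ B n + D`.
  have hdiff : Tendsto (fun n => ∫⁻ x, ‖F n x - G x‖ₑ ∂ν) atTop (nhds 0) := by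
    refine tendsto_of_tendsto_of_tendsto_of_le_of_le tendsto_const_nhds
      (by simpa using hdom.add hexc) (fun n => bot_le) fun n => ?_
    have hm : AEMeasurable (fun x => min ‖F n x - G x‖ₑ (2 * D x)) ν :=
      ((hF n).sub hG).enorm.min (hDm.const_mul 2)
    rw [← lintegral_add_left' hm]
    refine lintegral_mono_ae ?_
    filter_upwards [hFB n, hGD, hDfin] with x h1 h2 h3
    rcases le_total ‖F n x - G x‖ₑ (2 * D x) with h4 | h4
    · rw [min_eq_left h4]
      exact le_self_add
    · rw [min_eq_right h4]
      calc ‖F n x - G x‖ₑ ≤ ‖F n x‖ₑ + ‖G x‖ₑ := enorm_sub_le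
        _ ≤ B n x + D x := add_le_add h1 h2
        _ ≤ D x + (B n x - min (B n x) (D x)) + D x := by
          gcongr
          rcases le_total (B n x) (D x) with h5 | h5
          · exact h5.trans le_self_add
          · rw [min_eq_right h5, add_tsub_cancel_of_le h5]
        _ = _ := by ring
  have hGi : Integrable G ν := ⟨hG, (lintegral_mono_ae hGD).trans_lt hD.lt_top⟩
  have hFi : ∀ᶠ n in atTop, Integrable (F n) ν := by
    filter_upwards [hint.eventually_lt_const (hD.lt_top)] with n hn
    exact ⟨hF n, (lintegral_mono_ae (hFB n)).trans_lt hn⟩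
  exact tendsto_integral_of_L1 G hG hFi hdiff

/-! ### Densities -/

lemma measurePreserving_rot_volume (s : Circle) :
    MeasurePreserving (fun z : ℂ => (s : ℂ) * z) volume volume :=
  (rotation s).measurePreserving

lemma measurePreserving_rot_withDensity {ρ : ℂ → ℝ≥0∞} (hρ : Measurable ρ)
    (h : ∀ (s : Circle) z, ρ (s * z) = ρ z) (s : Circle) :
    MeasurePreserving (fun z : ℂ => (s : ℂ) * z) (volume.withDensity ρ)
      (volume.withDensity ρ) := by
  refine ⟨by fun_prop, ?_⟩
  ext A hA
  have hm : Measurable fun z : ℂ => (s : ℂ) * z := by fun_prop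
  rw [Measure.map_apply hm hA, withDensity_apply _ (hm hA), withDensity_apply _ hA,
    ← (measurePreserving_rot_volume s).setLIntegral_comp_preimage hA hρ]
  simp only [h]

/-- The action `(t, z) ↦ (t s⁻¹, s z)` of rotations preserves products of the arc length with
rotation invariant measures. -/
lemma measurePreserving_rot_prod {ν : Measure ℂ} [SFinite ν]
    (hν : ∀ s : Circle, MeasurePreserving (fun z : ℂ => (s : ℂ) * z) ν ν) (s : Circle) :
    MeasurePreserving (fun p : Circle × ℂ => (s⁻¹ * p.1, (s : ℂ) * p.2))
      (circleMeasure.prod ν) (circleMeasure.prod ν) :=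
  (measurePreserving_circle_mul s⁻¹).prod (hν s)

lemma pairing_conj_symm (μ : Measure ℂ) (g h : ℂ → ℂ) : pairing μ g h = conj (pairing μ h g) := by
  rw [pairing, pairing, ← integral_conj]
  congr 1
  ext ζ
  simp [mul_comm]

lemma norm_sq_holL2 {μ : Measure ℂ} {g : ℂ → ℂ} :
    pairing μ g g = ((∫ ζ, ‖g ζ‖ ^ 2 ∂μ : ℝ) : ℂ) := by
  rw [pairing, ← integral_complex_ofReal]
  congr 1
  ext ζ
  rw [Complex.mul_conj, Complex.normSq_eq_norm_sq]

lemma pairing_add_left {μ : Measure ℂ} {g g' h : ℂ → ℂ} (hg : MemLp g 2 μ) (hg' : MemLp g' 2 μ)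
    (hh : MemLp h 2 μ) : pairing μ (g + g') h = pairing μ g h + pairing μ g' h := by
  simp only [pairing]
  rw [← integral_add (integrable_mul_conj hg hh) (integrable_mul_conj hg' hh)]
  congr 1
  ext ζ
  simp [add_mul]

lemma pairing_smul_left {μ : Measure ℂ} (c : ℂ) (g h : ℂ → ℂ) :
    pairing μ (c • g) h = c * pairing μ g h := by
  simp only [pairing]
  rw [← integral_const_mul]
  congr 1
  ext ζ
  simp [mul_assoc]

/-! ### The Fock space -/

/-- The density of the Gaussian measure. -/
def fockDensity (β : ℝ) (z : ℂ) : ℝ := β / Real.pi * Real.exp (-β * ‖z‖ ^ 2)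

lemma fockDensity_pos {β : ℝ} (hβ : 0 < β) (z : ℂ) : 0 < fockDensity β z := by
  unfold fockDensity
  positivity

@[fun_prop]
lemma continuous_fockDensity (β : ℝ) : Continuous (fockDensity β) := by
  unfold fockDensity
  fun_prop

lemma lintegral_fock {β : ℝ} {h : ℂ → ℝ≥0∞} (hh : Measurable h) :
    ∫⁻ z, h z ∂fockMeasure β = ∫⁻ z, ENNReal.ofReal (fockDensity β z) * h z :=
  lintegral_withDensity_eq_lintegral_mul _ (by fun_prop) hh

lemma integral_fock {β : ℝ} (hβ : 0 < β) (h : ℂ → ℂ) :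
    ∫ z, h z ∂fockMeasure β = ∫ z, (fockDensity β z : ℂ) * h z := by
  have := integral_withDensity_eq_integral_toReal_smul (μ := (volume : Measure ℂ))
    (f := fun z => ENNReal.ofReal (fockDensity β z)) (by fun_prop)
    (Eventually.of_forall fun z => ENNReal.ofReal_lt_top) h
  refine Eq.trans this ?_
  congr 1
  ext z
  rw [ENNReal.toReal_ofReal (fockDensity_pos hβ z).le, Complex.real_smul]

lemma fock_moment {β : ℝ} (hβ : 0 < β) (k : ℕ) :
    ∫⁻ z, ‖z ^ k‖ₑ ^ 2 ∂fockMeasure β = ENNReal.ofReal (k.factorial / β ^ k) := by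
  have h0 : ∫ z : ℂ, fockDensity β z * ‖z ^ k‖ ^ 2 = k.factorial / β ^ k := by
    have h1 := Complex.integral_rpow_mul_exp_neg_mul_rpow (p := 2) (q := 2 * k) (by norm_num)
      (by have : (0 : ℝ) ≤ k := by positivity
          linarith) hβ
    have h2 : ∀ z : ℂ, fockDensity β z * ‖z ^ k‖ ^ 2 =
        β / Real.pi * (‖z‖ ^ (2 * k : ℝ) * Real.exp (-β * ‖z‖ ^ (2 : ℝ))) := fun z => by
      have : ‖z‖ ^ (2 * k : ℝ) = ‖z ^ k‖ ^ 2 := by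
        rw [norm_pow, ← pow_mul, mul_comm k 2]
        exact_mod_cast Real.rpow_natCast ‖z‖ (2 * k)
      rw [this, fockDensity, Real.rpow_ofNat]
      ring
    simp only [h2]
    rw [integral_const_mul, h1]
    have h3 : (2 * (k : ℝ) + 2) / 2 = k + 1 := by ring
    have h4 : -(2 * (k : ℝ) + 2) / 2 = -((k + 1 : ℕ) : ℝ) := by push_cast; ring
    rw [h3, h4, Real.Gamma_nat_eq_factorial, Real.rpow_neg hβ.le, Real.rpow_natCast]
    have := Real.pi_pos
    field_simp
    rw [pow_succ']
  have hpos : (0 : ℝ) < k.factorial / β ^ k := by positivity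
  -- The Bochner integral of a non-integrable function is `0` by convention, whereas the value just
  -- computed is positive.
  have hint : Integrable fun z : ℂ => fockDensity β z * ‖z ^ k‖ ^ 2 := by
    by_contra hni
    rw [integral_undef hni] at h0
    exact hpos.ne h0
  rw [lintegral_fock (by fun_prop), ← h0, ofReal_integral_eq_lintegral_ofReal hint
    (Eventually.of_forall fun z => mul_nonneg (fockDensity_pos hβ z).le (by positivity))]
  refine lintegral_congr fun z => ?_
  rw [ENNReal.ofReal_mul (fockDensity_pos hβ z).le, enorm_sq_eq_ofReal]

lemma fock_kernel {β : ℝ} (w : ℂ) :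
    HasSum (fun k : ℕ => ‖w ^ k‖ ^ 2 / (k.factorial / β ^ k)) (Real.exp (β * ‖w‖ ^ 2)) := by
  have := NormedSpace.expSeries_div_hasSum_exp (𝔸 := ℝ) (β * ‖w‖ ^ 2)
  rw [← Real.exp_eq_exp_ℝ] at this
  refine this.congr_fun fun k => ?_
  rw [norm_pow, mul_pow, pow_right_comm, div_div_eq_mul_div, mul_comm]

lemma isRadial_fock {β : ℝ} (hβ : 0 < β) :
    IsRadial univ (fockMeasure β) (fun k => k.factorial / β ^ k) where
  domain := Or.inl rfl
  ae_mem := by simp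
  rot := measurePreserving_rot_withDensity (by fun_prop) fun s z => by simp [Circle.norm_coe]
  moment_pos k := by positivity
  moment := fock_moment hβ
  kernel_summable w _ := (fock_kernel w).summable

/-- Expanding `‖ζ - z‖²` shows that the exponential factor exactly compensates the translation of
the Gaussian. Integrated in `ζ` this is the isometry of `W_z`; integrated in `z` it is the diagonal
identity for the orthogonality relations. -/
lemma weyl_density {β : ℝ} (z ζ : ℂ) (g : ℂ → ℂ) :
    ENNReal.ofReal (fockDensity β ζ) * ‖weyl β z g ζ‖ₑ ^ 2 =
      ENNReal.ofReal (fockDensity β (ζ - z)) * ‖g (ζ - z)‖ₑ ^ 2 := by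
  have h1 : ‖weyl β z g ζ‖ ^ 2 =
      ‖g (ζ - z)‖ ^ 2 * Real.exp (2 * β * (conj z * ζ).re - β * ‖z‖ ^ 2) := by
    rw [weyl, norm_mul, mul_pow, Complex.norm_exp, ← Real.exp_nat_mul]
    congr 2
    have : ((β : ℂ) * conj z * ζ - β * (‖z‖ : ℂ) ^ 2 / 2) =
        ((β : ℝ) : ℂ) * (conj z * ζ) - ((β * ‖z‖ ^ 2 / 2 : ℝ) : ℂ) := by push_cast; ring
    rw [this, Complex.sub_re, Complex.re_ofReal_mul, Complex.ofReal_re]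
    push_cast
    ring
  have h2 : ‖ζ - z‖ ^ 2 = ‖ζ‖ ^ 2 + ‖z‖ ^ 2 - 2 * (conj z * ζ).re := by
    simp only [← Complex.normSq_eq_norm_sq, Complex.normSq_sub]
    rw [mul_comm ζ]
  have h3 : fockDensity β ζ * ‖weyl β z g ζ‖ ^ 2 =
      fockDensity β (ζ - z) * ‖g (ζ - z)‖ ^ 2 := by
    have h4 : Real.exp (-β * ‖ζ - z‖ ^ 2) =
        Real.exp (-β * ‖ζ‖ ^ 2) * Real.exp (2 * β * (conj z * ζ).re - β * ‖z‖ ^ 2) := by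
      rw [← Real.exp_add, h2]
      congr 1
      ring
    rw [h1, fockDensity, fockDensity, h4]
    ring
  have h5 : ∀ (x : ℂ) (y : ℂ), ENNReal.ofReal (fockDensity β x) * ‖y‖ₑ ^ 2 =
      ENNReal.ofReal (fockDensity β x * ‖y‖ ^ 2) := fun x y => by
    rw [ENNReal.ofReal_mul' (by positivity), enorm_sq_eq_ofReal]
  rw [h5, h5, h3]

lemma measurable_weyl {β : ℝ} {φ : ℂ → ℂ} (hφ : Measurable φ) :
    Measurable (Function.uncurry fun p : Circle × ℂ => weyl β p.2 (rotate p.1 φ)) := by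
  have hc : Continuous fun q : (Circle × ℂ) × ℂ => conj q.1.2 :=
    Complex.continuous_conj.comp (by fun_prop)
  exact (hφ.comp (by fun_prop : Measurable fun q : (Circle × ℂ) × ℂ =>
    (q.1.1 : ℂ) * (q.2 - q.1.2))).mul (Continuous.measurable (by fun_prop))

lemma lintegral_rotate {Ω : Set ℂ} {μ : Measure ℂ} {m : ℕ → ℝ} (hμ : IsRadial Ω μ m) (t : Circle)
    {φ : ℂ → ℂ} (hφ : Measurable φ) :
    ∫⁻ ζ, ‖rotate t φ ζ‖ₑ ^ 2 ∂μ = ∫⁻ ζ, ‖φ ζ‖ₑ ^ 2 ∂μ :=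
  (hμ.rot t).lintegral_comp (hφ.enorm.pow_const 2)

lemma lintegral_weyl {β : ℝ} (hβ : 0 < β) (t : Circle) (z : ℂ) {φ : ℂ → ℂ} (hφ : Measurable φ) :
    ∫⁻ ζ, ‖weyl β z (rotate t φ) ζ‖ₑ ^ 2 ∂fockMeasure β = ∫⁻ ζ, ‖φ ζ‖ₑ ^ 2 ∂fockMeasure β := by
  have hr : Measurable (rotate t φ) := hφ.comp (by fun_prop)
  have hw : Measurable (weyl β z (rotate t φ)) :=
    (measurable_weyl (β := β) hφ).comp (measurable_prodMk_left (x := (t, z)))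
  rw [← lintegral_rotate (isRadial_fock hβ) t hφ, lintegral_fock (hw.enorm.pow_const 2),
    lintegral_fock (hr.enorm.pow_const 2)]
  simp only [weyl_density]
  exact lintegral_sub_right_eq_self
    (fun ζ => ENNReal.ofReal (fockDensity β ζ) * ‖rotate t φ ζ‖ₑ ^ 2) z

lemma differentiable_weyl {β : ℝ} (t : Circle) (z : ℂ) {φ : ℂ → ℂ} (hφ : Differentiable ℂ φ) :
    Differentiable ℂ (weyl β z (rotate t φ)) := by
  unfold weyl rotate
  exact (hφ.comp (by fun_prop)).mul (by fun_prop)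

lemma weyl_mem {β : ℝ} (hβ : 0 < β) (t : Circle) (z : ℂ) {φ : ℂ → ℂ}
    (hφ : φ ∈ holL2 univ (fockMeasure β)) :
    weyl β z (rotate t φ) ∈ holL2 univ (fockMeasure β) := by
  have hd := differentiable_weyl (β := β) t z (differentiableOn_univ.1 hφ.1)
  refine ⟨hd.differentiableOn, by simp, memLp_two_iff_lintegral.2
    ⟨hd.continuous.aestronglyMeasurable, ?_⟩⟩
  rw [lintegral_weyl hβ t z (differentiableOn_univ.1 hφ.1).continuous.measurable]
  exact (memLp_two_iff_lintegral.1 hφ.2.2).2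

/-- After multiplication by the Gaussian density at `w`, the substitution `z ↦ w - z` gives `‖φ‖²`.
The inverse of that density is `(π/β) exp (β ‖w‖²)`, that is `π/β` times the kernel on the diagonal.
-/
lemma lintegral_weyl_apply {β : ℝ} (hβ : 0 < β) {φ : ℂ → ℂ} (hφm : Measurable φ) (w : ℂ) :
    ∫⁻ p : Circle × ℂ, ‖weyl β p.2 (rotate p.1 φ) w‖ₑ ^ 2 ∂circleMeasure.prod volume =
      ENNReal.ofReal (Real.pi / β) * (∫⁻ ζ, ‖φ ζ‖ₑ ^ 2 ∂fockMeasure β) *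
        ∑' k : ℕ, ENNReal.ofReal (‖w ^ k‖ ^ 2 / (k.factorial / β ^ k)) := by
  have hρ := fockDensity_pos hβ w
  have hw : Measurable fun p : Circle × ℂ => ‖weyl β p.2 (rotate p.1 φ) w‖ₑ ^ 2 :=
    ((measurable_weyl hφm).comp (measurable_prodMk_right (y := w))).enorm.pow_const 2
  have h1 : ENNReal.ofReal (fockDensity β w) *
      ∫⁻ p : Circle × ℂ, ‖weyl β p.2 (rotate p.1 φ) w‖ₑ ^ 2 ∂circleMeasure.prod volume =
      ∫⁻ ζ, ‖φ ζ‖ₑ ^ 2 ∂fockMeasure β := by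
    rw [← lintegral_const_mul _ hw, lintegral_prod _ (hw.const_mul _).aemeasurable]
    simp only [weyl_density]
    have h2 : ∀ t : Circle, ∫⁻ z, ENNReal.ofReal (fockDensity β (w - z)) *
        ‖rotate t φ (w - z)‖ₑ ^ 2 = ∫⁻ ζ, ‖φ ζ‖ₑ ^ 2 ∂fockMeasure β := fun t => by
      have hr : Measurable (rotate t φ) := hφm.comp (by fun_prop)
      rw [lintegral_sub_left_eq_self
        (fun ζ => ENNReal.ofReal (fockDensity β ζ) * ‖rotate t φ ζ‖ₑ ^ 2) w,
        ← lintegral_rotate (isRadial_fock hβ) t hφm, lintegral_fock (hr.enorm.pow_const 2)]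
    simp [h2]
  have h3 : ENNReal.ofReal (Real.pi / β) * ENNReal.ofReal (Real.exp (β * ‖w‖ ^ 2)) *
      ENNReal.ofReal (fockDensity β w) = 1 := by
    rw [← ENNReal.ofReal_mul (by positivity), ← ENNReal.ofReal_mul (by positivity), fockDensity,
      neg_mul, Real.exp_neg]
    have := Real.pi_pos
    have := Real.exp_pos (β * ‖w‖ ^ 2)
    rw [← ENNReal.ofReal_one]
    congr 1
    field_simp
  rw [← ENNReal.ofReal_tsum_of_nonneg (fun k => by positivity) (fock_kernel w).summable,
    (fock_kernel w).tsum_eq, ← h1]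
  calc _ = 1 * ∫⁻ p : Circle × ℂ, ‖weyl β p.2 (rotate p.1 φ) w‖ₑ ^ 2
        ∂circleMeasure.prod volume := (one_mul _).symm
    _ = _ := by rw [← h3]; ring

/-- Rotating `z` and `ζ` together also rotates the argument of the window; the factor `s⁻¹` in the
circle variable undoes this. This equivariance is what the average over `θ` provides. -/
lemma weyl_rotate {β : ℝ} (s t : Circle) (z ζ : ℂ) (φ : ℂ → ℂ) :
    weyl β (s * z) (rotate (s⁻¹ * t) φ) (s * ζ) = weyl β z (rotate t φ) ζ := by
  have hs : (s : ℂ) ≠ 0 := Circle.coe_ne_zero s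
  have hs1 : conj (s : ℂ) * s = 1 := by
    rw [← Complex.normSq_eq_conj_mul_self, Circle.normSq_coe]
    simp
  have h1 : ((s⁻¹ * t : Circle) : ℂ) * (s * ζ - s * z) = t * (ζ - z) := by
    rw [Circle.coe_mul, Circle.coe_inv]
    field_simp
  have h2 : (β : ℂ) * conj ((s : ℂ) * z) * (s * ζ) - β * (‖(s : ℂ) * z‖ : ℂ) ^ 2 / 2 =
      β * conj z * ζ - β * (‖z‖ : ℂ) ^ 2 / 2 := by
    rw [norm_mul, Circle.norm_coe, one_mul, map_mul]
    linear_combination (β * conj z * ζ) * hs1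
  rw [weyl, weyl, rotate, rotate, h1, h2]

/-- The orthogonality relations for the Weyl operators. -/
theorem lintegral_pairing_weyl {β : ℝ} (hβ : 0 < β) {φ g : ℂ → ℂ}
    (hφ : φ ∈ holL2 univ (fockMeasure β)) (hg : g ∈ holL2 univ (fockMeasure β)) :
    ∫⁻ p : Circle × ℂ, ‖pairing (fockMeasure β) g (weyl β p.2 (rotate p.1 φ))‖ₑ ^ 2
        ∂circleMeasure.prod volume =
      ENNReal.ofReal (Real.pi / β) * (∫⁻ ζ, ‖φ ζ‖ₑ ^ 2 ∂fockMeasure β) *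
        ∫⁻ ζ, ‖g ζ‖ₑ ^ 2 ∂fockMeasure β := by
  have hφm : Measurable φ := (differentiableOn_univ.1 hφ.1).continuous.measurable
  have hC : ENNReal.ofReal (Real.pi / β) * (∫⁻ ζ, ‖φ ζ‖ₑ ^ 2 ∂fockMeasure β) ≠ ∞ :=
    ENNReal.mul_ne_top ENNReal.ofReal_ne_top (memLp_two_iff_lintegral.1 hφ.2.2).2.ne
  have hrot : ∀ s : Circle, ∃ τ : Circle × ℂ → Circle × ℂ,
      MeasurePreserving τ (circleMeasure.prod volume) (circleMeasure.prod volume) ∧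
      ∀ p, ∀ ζ ∈ (univ : Set ℂ),
        weyl β (τ p).2 (rotate (τ p).1 φ) (s * ζ) = weyl β p.2 (rotate p.1 φ) ζ := fun s =>
    ⟨fun p => (s⁻¹ * p.1, (s : ℂ) * p.2),
      measurePreserving_rot_prod measurePreserving_rot_volume s,
      fun p ζ _ => weyl_rotate s p.1 p.2 ζ φ⟩
  refine (isRadial_fock hβ).lintegral_pairing_normSq (ν := circleMeasure.prod volume)
    (u := fun p : Circle × ℂ => weyl β p.2 (rotate p.1 φ)) (measurable_weyl hφm)
    (fun p => (weyl_mem hβ p.1 p.2 hφ).1) (fun p => (weyl_mem hβ p.1 p.2 hφ).2.2) hC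
    (fun w _ => ?_) hrot hg
  have := lintegral_weyl_apply hβ hφm w
  exact this

/-! ### Transforms and localization operators on the Fock space -/

section

variable {β : ℝ} {hβ : 0 < β}

lemma fock_norm_sq (g : FockSpace β hβ) : ‖g‖ ^ 2 = ∫ ζ, ‖g ζ‖ ^ 2 ∂fockMeasure β := by
  have h := inner_self_eq_norm_sq (𝕜 := ℂ) g
  rw [← h]
  exact (congrArg Complex.re norm_sq_holL2).trans (Complex.ofReal_re _)

lemma fock_enorm_sq (g : FockSpace β hβ) : ‖g‖ₑ ^ 2 = ∫⁻ ζ, ‖g ζ‖ₑ ^ 2 ∂fockMeasure β := by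
  have h : ‖g‖ₑ ^ 2 = ENNReal.ofReal (‖g‖ ^ 2) := by
    rw [ENNReal.ofReal_pow (norm_nonneg _), ofReal_norm]
  rw [h, fock_norm_sq, integral_norm_sq_eq_toReal g.2.2.2.1,
    ENNReal.ofReal_toReal (memLp_two_iff_lintegral.1 g.2.2.2).2.ne]

/-- The inclusion of the Fock space into the functions on the plane. -/
def fockCoe : FockSpace β hβ →ₗ[ℂ] (ℂ → ℂ) where
  toFun g := g.1
  map_add' _ _ := rfl
  map_smul' _ _ := rfl

instance : CompleteSpace (FockSpace β hβ) :=
  (isRadial_fock hβ).completeSpace fockCoe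
    (fun _ => ⟨fun h => ⟨⟨_, h⟩, rfl⟩, fun ⟨e, he⟩ => he ▸ e.2⟩)
    (fun _ _ h => Subtype.ext h) fock_norm_sq

/-- The transform `g ↦ ⟨g, W_z φ_t⟩` of the Fock space. -/
def fockTransform (φ : FockSpace β hβ) : FockSpace β hβ →ₗ[ℂ] (Circle × ℂ → ℂ) where
  toFun g p := pairing (fockMeasure β) g (weyl β p.2 (rotate p.1 φ))
  map_add' g h := funext fun p =>
    pairing_add_left (g := g.1) (g' := h.1) g.2.2.2 h.2.2.2 (weyl_mem hβ p.1 p.2 φ.2).2.2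
  map_smul' c _ := funext fun _ => pairing_smul_left c _ _

lemma measurable_fockTransform (φ g : FockSpace β hβ) : Measurable (fockTransform φ g) := by
  have := (isRadial_fock hβ).isFiniteMeasure
  have hm : ∀ g : FockSpace β hβ, Measurable (g : ℂ → ℂ) := fun g =>
    (isRadial_fock hβ).measurable_of_mem g.2.1 g.2.2.1
  exact measurable_pairing (g := fun _ : Circle × ℂ => (g : ℂ → ℂ)) ((hm g).comp measurable_snd)
    (measurable_weyl (hm φ))

lemma lintegral_fockTransform (φ g : FockSpace β hβ) :
    ∫⁻ p, ‖fockTransform φ g p‖ₑ ^ 2 ∂circleMeasure.prod volume =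
      ENNReal.ofReal (Real.pi / β) * ‖φ‖ₑ ^ 2 * ‖g‖ₑ ^ 2 := by
  rw [fock_enorm_sq, fock_enorm_sq]
  exact lintegral_pairing_weyl hβ φ.2 g.2

lemma fockIntegrand_eq (φ ψ : FockSpace β hβ) (f : Circle × ℂ → ℂ) (g h : FockSpace β hβ)
    (p : Circle × ℂ) : fockIntegrand φ ψ f g h p.1 p.2 =
      f p * fockTransform φ g p * conj (fockTransform ψ h p) := by
  rw [fockIntegrand, pairing_conj_symm _ (weyl β p.2 (rotate p.1 ψ))]
  rfl

theorem existsUnique_fockLocalization (φ ψ : FockSpace β hβ) {f : Circle × ℂ → ℂ}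
    (hf : MemLp f ∞ (circleMeasure.prod (volume : Measure ℂ))) :
    ∃! T : FockSpace β hβ →L[ℂ] FockSpace β hβ, IsFockLocalization φ ψ f T := by
  have hb : ∀ φ g : FockSpace β hβ, ∫⁻ p, ‖fockTransform φ g p‖ₑ ^ 2 ∂circleMeasure.prod volume ≤
      (ENNReal.ofReal (Real.sqrt (Real.pi / β) * ‖φ‖) * ‖g‖ₑ) ^ 2 := fun φ g => by
    rw [lintegral_fockTransform, mul_pow, ENNReal.ofReal_mul (Real.sqrt_nonneg _), mul_pow,
      ofReal_norm, ← ENNReal.ofReal_pow (Real.sqrt_nonneg _), Real.sq_sqrt (by positivity)]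
  obtain ⟨T, hT, hu⟩ := existsUnique_operator (fockTransform φ) (fockTransform ψ)
    (fun g => (measurable_fockTransform φ g).aestronglyMeasurable)
    (fun g => (measurable_fockTransform ψ g).aestronglyMeasurable) (hb φ) (hb ψ) hf
    (fun g h p => fockIntegrand φ ψ f g h p.1 p.2)
    (fun g h => Eventually.of_forall fun p => fockIntegrand_eq φ ψ f g h p) (β / Real.pi : ℂ)
  -- Fubini passes between the product integral and the iterated one. It applies to any competitor
  -- `S` as well, since integrability is part of the defining property.
  refine ⟨T, fun g h => ⟨(hT g h).1, ?_⟩, fun S hS => hu S fun g h => ⟨(hS g h).1, ?_⟩⟩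
  · exact (hT g h).2.trans (congrArg _ (integral_prod _ (hT g h).1))
  · exact (hS g h).2.trans (congrArg _ (integral_prod _ (hS g h).1).symm)

end

/-! ### Measures on the unit disc -/

/-- The density of `bergmanMeasure α` with respect to the area measure. -/
def bergmanDensity (α : ℝ) (z : ℂ) : ℝ :=
  if ‖z‖ < 1 then (α + 1) / Real.pi * (1 - ‖z‖ ^ 2) ^ α else 0

/-- The density of `mobiusMeasure` with respect to the area measure. -/
def mobiusDensity (z : ℂ) : ℝ :=
  if ‖z‖ < 1 then (Real.pi * (1 - ‖z‖ ^ 2) ^ 2)⁻¹ else 0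

lemma one_sub_norm_sq_pos {z : ℂ} (hz : ‖z‖ < 1) : 0 < 1 - ‖z‖ ^ 2 :=
  one_sub_sq_pos (mem_ball_zero_iff.2 hz)

lemma measurableSet_norm_lt_one : MeasurableSet {z : ℂ | ‖z‖ < 1} :=
  measurableSet_lt (by fun_prop) (by fun_prop)

@[fun_prop]
lemma measurable_bergmanDensity (α : ℝ) : Measurable (bergmanDensity α) :=
  Measurable.ite measurableSet_norm_lt_one (by fun_prop) (by fun_prop)

@[fun_prop]
lemma measurable_mobiusDensity : Measurable mobiusDensity :=
  Measurable.ite measurableSet_norm_lt_one (by fun_prop) (by fun_prop)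

lemma bergmanDensity_nonneg {α : ℝ} (hα : -1 < α) (z : ℂ) : 0 ≤ bergmanDensity α z := by
  unfold bergmanDensity
  split_ifs with hz
  · have h1 := one_sub_norm_sq_pos hz
    have h2 : 0 < α + 1 := by linarith
    positivity
  · exact le_rfl

lemma mobiusDensity_nonneg (z : ℂ) : 0 ≤ mobiusDensity z := by
  unfold mobiusDensity
  split_ifs with hz
  · have h1 := one_sub_norm_sq_pos hz
    positivity
  · exact le_rfl

lemma bergmanMeasure_eq (α : ℝ) :
    bergmanMeasure α = volume.withDensity fun z => ENNReal.ofReal (bergmanDensity α z) := by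
  rw [bergmanMeasure, ← withDensity_indicator measurableSet_ball]
  congr 1
  ext z
  by_cases hz : ‖z‖ < 1
  · rw [indicator_of_mem (by simpa using hz), bergmanDensity, if_pos hz]
  · rw [indicator_of_notMem (by simpa using hz), bergmanDensity, if_neg hz, ENNReal.ofReal_zero]

lemma mobiusMeasure_eq :
    mobiusMeasure = volume.withDensity fun z => ENNReal.ofReal (mobiusDensity z) := by
  rw [mobiusMeasure, ← withDensity_indicator measurableSet_ball]
  congr 1
  ext z
  by_cases hz : ‖z‖ < 1
  · rw [indicator_of_mem (by simpa using hz), mobiusDensity, if_pos hz]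
  · rw [indicator_of_notMem (by simpa using hz), mobiusDensity, if_neg hz, ENNReal.ofReal_zero]

instance : SFinite mobiusMeasure := by
  rw [mobiusMeasure_eq]
  infer_instance

lemma lintegral_withDensity_ofReal {X : Type*} [MeasurableSpace X] {ν : Measure X} {ρ : X → ℝ}
    (hρ : Measurable ρ) {h : X → ℝ≥0∞} (hh : Measurable h) :
    ∫⁻ z, h z ∂(ν.withDensity fun z => ENNReal.ofReal (ρ z)) =
      ∫⁻ z, ENNReal.ofReal (ρ z) * h z ∂ν :=
  lintegral_withDensity_eq_lintegral_mul _ (by fun_prop) hh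

lemma integral_withDensity_ofReal {X : Type*} [MeasurableSpace X] {ν : Measure X} {ρ : X → ℝ}
    (hρ : Measurable ρ) (h0 : ∀ z, 0 ≤ ρ z)
    (h : X → ℂ) :
    ∫ z, h z ∂(ν.withDensity fun z => ENNReal.ofReal (ρ z)) = ∫ z, (ρ z : ℂ) * h z ∂ν := by
  have := integral_withDensity_eq_integral_toReal_smul (μ := ν)
    (f := fun z => ENNReal.ofReal (ρ z)) (by fun_prop)
    (Eventually.of_forall fun z => ENNReal.ofReal_lt_top) h
  refine Eq.trans this ?_
  congr 1
  ext z
  rw [ENNReal.toReal_ofReal (h0 z), Complex.real_smul]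

lemma ae_mem_bergman (α : ℝ) : ∀ᵐ z ∂bergmanMeasure α, z ∈ ball (0 : ℂ) 1 :=
  (withDensity_absolutelyContinuous _ _).ae_le (ae_restrict_mem measurableSet_ball)

lemma ae_mem_mobius : ∀ᵐ z ∂mobiusMeasure, z ∈ ball (0 : ℂ) 1 :=
  (withDensity_absolutelyContinuous _ _).ae_le (ae_restrict_mem measurableSet_ball)

lemma measurePreserving_rot_bergman (α : ℝ) (s : Circle) :
    MeasurePreserving (fun z : ℂ => (s : ℂ) * z) (bergmanMeasure α) (bergmanMeasure α) := by
  rw [bergmanMeasure_eq]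
  exact measurePreserving_rot_withDensity (by fun_prop)
    (fun s z => by simp [bergmanDensity, Circle.norm_coe]) s

lemma measurePreserving_rot_mobius (s : Circle) :
    MeasurePreserving (fun z : ℂ => (s : ℂ) * z) mobiusMeasure mobiusMeasure := by
  rw [mobiusMeasure_eq]
  exact measurePreserving_rot_withDensity (by fun_prop)
    (fun s z => by simp [mobiusDensity, Circle.norm_coe]) s

/-- The Bergman measure is a multiple of a power of `1 - |z|²` times the invariant measure. -/
lemma lintegral_bergman {α : ℝ} (hα : -1 < α) {h : ℂ → ℝ≥0∞} (hh : Measurable h) :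
    ∫⁻ z, h z ∂bergmanMeasure α = ENNReal.ofReal (α + 1) *
      ∫⁻ z, ENNReal.ofReal ((1 - ‖z‖ ^ 2) ^ (α + 2)) * h z ∂mobiusMeasure := by
  rw [bergmanMeasure_eq, mobiusMeasure_eq, lintegral_withDensity_ofReal (by fun_prop) hh,
    lintegral_withDensity_ofReal (by fun_prop) (by fun_prop),
    ← lintegral_const_mul _ (by fun_prop)]
  refine lintegral_congr fun z => ?_
  by_cases hz : ‖z‖ < 1
  · have h1 := one_sub_norm_sq_pos hz
    have h2 : 0 < α + 1 := by linarith
    have h3 : bergmanDensity α z =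
        (α + 1) * (mobiusDensity z * (1 - ‖z‖ ^ 2) ^ (α + 2)) := by
      rw [bergmanDensity, mobiusDensity, if_pos hz, if_pos hz, Real.rpow_add h1, Real.rpow_ofNat]
      have := Real.pi_pos
      field_simp
    rw [h3, ENNReal.ofReal_mul h2.le, ENNReal.ofReal_mul (mobiusDensity_nonneg z)]
    ring
  · simp [bergmanDensity, mobiusDensity, hz]

/-- The integrand is, up to its normalizing constant, the density of a beta distribution, which has
total mass one. -/
lemma integral_Ioi_beta {α : ℝ} (hα : -1 < α) (k : ℕ) :
    ∫ x in Ioi (0 : ℝ), (if x < 1 then x ^ k * (1 - x) ^ α else 0) =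
      ProbabilityTheory.beta (k + 1) (α + 1) := by
  have hk : (0 : ℝ) < k + 1 := by positivity
  have hα' : 0 < α + 1 := by linarith
  have hb := ProbabilityTheory.beta_pos hk hα'
  have h1 : ∫ x, ProbabilityTheory.betaPDFReal (k + 1) (α + 1) x = 1 := by
    rw [integral_eq_lintegral_of_nonneg_ae
      (Eventually.of_forall fun x => ?_) (by fun_prop)]
    · have := ProbabilityTheory.lintegral_betaPDF_eq_one hk hα'
      simp only [ProbabilityTheory.betaPDF] at this
      rw [this, ENNReal.toReal_one]
    · by_cases hx : 0 < x ∧ x < 1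
      · exact (ProbabilityTheory.betaPDFReal_pos hx.1 hx.2 hk hα').le
      · simp [ProbabilityTheory.betaPDFReal, hx]
  have h2 : ∫ x in Ioi (0 : ℝ), ProbabilityTheory.betaPDFReal (k + 1) (α + 1) x = 1 := by
    rw [setIntegral_eq_integral_of_forall_compl_eq_zero, h1]
    intro x hx
    have : ¬ (0 < x ∧ x < 1) := fun h => hx h.1
    simp [ProbabilityTheory.betaPDFReal, this]
  suffices h3 : ∫ x in Ioi (0 : ℝ), (if x < 1 then x ^ k * (1 - x) ^ α else 0) =
      ProbabilityTheory.beta (k + 1) (α + 1) *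
        ∫ x in Ioi (0 : ℝ), ProbabilityTheory.betaPDFReal (k + 1) (α + 1) x by
    rw [h3, h2, mul_one]
  rw [← integral_const_mul]
  refine setIntegral_congr_fun measurableSet_Ioi fun x hx => ?_
  have hx0 : 0 < x := hx
  simp only [ProbabilityTheory.betaPDFReal, hx0, true_and]
  split_ifs
  · rw [add_sub_cancel_right, add_sub_cancel_right, Real.rpow_natCast]
    field_simp
  · simp

/-- The moments of `bergmanMeasure α`. -/
def bergmanMoment (α : ℝ) (k : ℕ) : ℝ :=
  k.factorial * Real.Gamma (α + 2) / Real.Gamma (α + 2 + k)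

lemma bergmanMoment_pos {α : ℝ} (hα : -1 < α) (k : ℕ) : 0 < bergmanMoment α k := by
  have h1 := Real.Gamma_pos_of_pos (by linarith : 0 < α + 2)
  have h2 := Real.Gamma_pos_of_pos (by
    have : (0 : ℝ) ≤ k := by positivity
    linarith : 0 < α + 2 + k)
  unfold bergmanMoment
  positivity

lemma bergman_moment {α : ℝ} (hα : -1 < α) (k : ℕ) :
    ∫⁻ z, ‖z ^ k‖ₑ ^ 2 ∂bergmanMeasure α = ENNReal.ofReal (bergmanMoment α k) := by
  have hα' : 0 < α + 1 := by linarith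
  have h0 : ∫ z : ℂ, bergmanDensity α z * ‖z ^ k‖ ^ 2 = bergmanMoment α k := by
    have h1 := integral_fun_norm_addHaar (volume : Measure ℂ)
      fun y : ℝ => (if y < 1 then (α + 1) / Real.pi * (1 - y ^ 2) ^ α else 0) * (y ^ k) ^ 2
    -- In polar coordinates the substitution `x = y²` turns the moment into a beta integral.
    have h2 := integral_comp_rpow_Ioi_of_pos
      (g := fun x : ℝ => if x < 1 then x ^ k * (1 - x) ^ α else 0) (p := 2) (by norm_num)
    have h3 : ∫ y in Ioi (0 : ℝ), y ^ (Module.finrank ℝ ℂ - 1) •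
        ((if y < 1 then (α + 1) / Real.pi * (1 - y ^ 2) ^ α else 0) * (y ^ k) ^ 2) =
        (α + 1) / (2 * Real.pi) * ProbabilityTheory.beta (k + 1) (α + 1) := by
      rw [← integral_Ioi_beta hα, ← h2, ← integral_const_mul]
      refine setIntegral_congr_fun measurableSet_Ioi fun y hy => ?_
      have hy0 : 0 < y := hy
      have hy1 : y ^ 2 < 1 ↔ y < 1 := by
        rw [sq_lt_one_iff₀ hy0.le]
      have h4 : y ^ ((2 : ℝ) - 1) = y := by norm_num
      simp only [Complex.finrank_real_complex, smul_eq_mul, Real.rpow_ofNat, h4, hy1]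
      split_ifs
      · have := Real.pi_pos
        field_simp
        ring
      · simp
    simp only [norm_pow, bergmanDensity]
    rw [h1, h3, Measure.real, Complex.volume_ball, ProbabilityTheory.beta, bergmanMoment,
      Complex.finrank_real_complex]
    have h5 : Real.Gamma (α + 2) = (α + 1) * Real.Gamma (α + 1) := by
      rw [← Real.Gamma_add_one hα'.ne']
      ring_nf
    have h6 : (k : ℝ) + 1 + (α + 1) = α + 2 + k := by ring
    rw [h5, h6, Real.Gamma_nat_eq_factorial]
    have := Real.pi_pos
    simp
    field_simp
  have hint : Integrable fun z : ℂ => bergmanDensity α z * ‖z ^ k‖ ^ 2 := by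
    by_contra hni
    rw [integral_undef hni] at h0
    exact (bergmanMoment_pos hα k).ne h0
  rw [bergmanMeasure_eq, lintegral_withDensity_ofReal (by fun_prop) (by fun_prop), ← h0,
    ofReal_integral_eq_lintegral_ofReal hint
    (Eventually.of_forall fun z => mul_nonneg (bergmanDensity_nonneg hα z) (by positivity))]
  refine lintegral_congr fun z => ?_
  rw [ENNReal.ofReal_mul (bergmanDensity_nonneg hα z), enorm_sq_eq_ofReal]

lemma Gamma_add_natCast {x : ℝ} (hx : 0 < x) (k : ℕ) :
    Real.Gamma (x + k) = (ascPochhammer ℝ k).eval x * Real.Gamma x := by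
  induction k with
  | zero => simp
  | succ k ih =>
    have h : x + k ≠ 0 := by positivity
    rw [Nat.cast_succ, ← add_assoc, Real.Gamma_add_one h, ih, ascPochhammer_succ_eval]
    ring

/-- The reciprocal moments are the coefficients of the binomial series of `(1 - x) ^ (-(α + 2))`,
taken at `x = ‖w‖²`. -/
lemma bergman_kernel {α : ℝ} (hα : -1 < α) {w : ℂ} (hw : w ∈ ball (0 : ℂ) 1) :
    HasSum (fun k : ℕ => ‖w ^ k‖ ^ 2 / bergmanMoment α k) ((1 - ‖w‖ ^ 2) ^ (α + 2))⁻¹ := by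
  have h2 : 0 < α + 2 := by linarith
  have hG := Real.Gamma_pos_of_pos h2
  have hw1 : ‖w‖ < 1 := by simpa using hw
  have h := (Real.one_div_one_sub_rpow_hasFPowerSeriesOnBall_zero (α + 2)).hasSum
    (y := ‖w‖ ^ 2) (by
      rw [Metric.mem_eball, edist_zero_right, ← ofReal_norm, ENNReal.ofReal_lt_one]
      simpa using hw1)
  rw [zero_add, one_div] at h
  refine h.congr_fun fun k => ?_
  have h3 : Ring.choose (α + 2 + k - 1) k = (bergmanMoment α k)⁻¹ := by
    rw [← Ring.multichoose_eq]
    have h4 := Ring.factorial_nsmul_multichoose_eq_ascPochhammer (α + 2) k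
    rw [Polynomial.ascPochhammer_smeval_eq_eval, nsmul_eq_mul] at h4
    have hk : (k.factorial : ℝ) ≠ 0 := by positivity
    have hp : (ascPochhammer ℝ k).eval (α + 2) = 0 → False := fun h0 =>
      (Real.Gamma_pos_of_pos (by positivity : 0 < α + 2 + k)).ne'
        (by rw [Gamma_add_natCast h2, h0, zero_mul])
    rw [bergmanMoment, Gamma_add_natCast h2, ← h4, inv_div]
    rw [← h4] at hp
    field_simp
  simp [FormalMultilinearSeries.ofScalars, h3, div_eq_mul_inv, pow_right_comm, mul_comm]

lemma isRadial_bergman {α : ℝ} (hα : -1 < α) :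
    IsRadial (ball 0 1) (bergmanMeasure α) (bergmanMoment α) where
  domain := Or.inr rfl
  ae_mem := ae_mem_bergman α
  rot := measurePreserving_rot_bergman α
  moment_pos := bergmanMoment_pos hα
  moment := bergman_moment hα
  kernel_summable _ hw := (bergman_kernel hα hw).summable

/-! ### Automorphisms of the unit disc -/

/-- The involutive automorphism of the unit disc that exchanges `0` and `w`. -/
def discInvolution (w z : ℂ) : ℂ := (w - z) / (1 - conj w * z)

section

variable {w z : ℂ}

lemma re_one_sub_conj_mul_pos (hw : ‖w‖ < 1) (hz : ‖z‖ < 1) : 0 < (1 - conj w * z).re := by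
  have h1 : (conj w * z).re ≤ ‖w‖ * ‖z‖ := by
    simpa using Complex.re_le_norm (conj w * z)
  have h2 : ‖w‖ * ‖z‖ < 1 := by nlinarith [norm_nonneg w, norm_nonneg z]
  rw [Complex.sub_re, Complex.one_re]
  linarith

lemma one_sub_conj_mul_ne_zero (hw : ‖w‖ < 1) (hz : ‖z‖ < 1) : 1 - conj w * z ≠ 0 := fun h => by
  have := re_one_sub_conj_mul_pos hw hz
  rw [h, Complex.zero_re] at this
  exact lt_irrefl _ this

lemma norm_sq_one_sub_conj_mul (w z : ℂ) :
    ‖1 - conj w * z‖ ^ 2 = ‖w - z‖ ^ 2 + (1 - ‖w‖ ^ 2) * (1 - ‖z‖ ^ 2) := by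
  simp only [← Complex.normSq_eq_norm_sq, Complex.normSq_sub, Complex.normSq_conj, map_one, map_mul, Complex.conj_conj, one_mul]
  ring

lemma one_sub_norm_sq_discInvolution (hw : ‖w‖ < 1) (hz : ‖z‖ < 1) :
    1 - ‖discInvolution w z‖ ^ 2 = (1 - ‖w‖ ^ 2) * (1 - ‖z‖ ^ 2) / ‖1 - conj w * z‖ ^ 2 := by
  have h := norm_sq_one_sub_conj_mul w z
  have h0 : 0 < ‖1 - conj w * z‖ := norm_pos_iff.2 (one_sub_conj_mul_ne_zero hw hz)
  rw [discInvolution, norm_div, div_pow, eq_div_iff (by positivity), sub_mul,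
    div_mul_cancel₀ _ (by positivity), h]
  ring

lemma norm_discInvolution_lt_one (hw : ‖w‖ < 1) (hz : ‖z‖ < 1) : ‖discInvolution w z‖ < 1 := by
  have h := one_sub_norm_sq_discInvolution hw hz
  have h0 : 0 < ‖1 - conj w * z‖ := norm_pos_iff.2 (one_sub_conj_mul_ne_zero hw hz)
  have h1 := one_sub_norm_sq_pos hw
  have h2 := one_sub_norm_sq_pos hz
  have h3 : 0 < (1 - ‖w‖ ^ 2) * (1 - ‖z‖ ^ 2) / ‖1 - conj w * z‖ ^ 2 := by positivity
  rw [← h] at h3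
  exact (sq_lt_one_iff₀ (norm_nonneg _)).1 (by linarith)

lemma discInvolution_discInvolution (hw : ‖w‖ < 1) (hz : ‖z‖ < 1) :
    discInvolution w (discInvolution w z) = z := by
  have h0 := one_sub_conj_mul_ne_zero hw hz
  have h1 := one_sub_conj_mul_ne_zero hw hw
  have h2 : 1 - conj w * ((w - z) / (1 - conj w * z)) =
      (1 - conj w * w) / (1 - conj w * z) := by
    field_simp
    ring
  have h3 : w - (w - z) / (1 - conj w * z) = z * (1 - conj w * w) / (1 - conj w * z) := by
    rw [eq_div_iff h0, sub_mul, div_mul_cancel₀ _ h0]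
    ring
  rw [discInvolution, discInvolution, h2, h3, div_div_div_cancel_right₀ h0,
    mul_div_cancel_right₀ _ h1]

lemma hasDerivAt_discInvolution (hw : ‖w‖ < 1) (hz : ‖z‖ < 1) :
    HasDerivAt (discInvolution w) (-(1 - conj w * w) / (1 - conj w * z) ^ 2) z := by
  have h0 := one_sub_conj_mul_ne_zero hw hz
  have h1 : HasDerivAt (fun z => w - z) (-1) z := (hasDerivAt_id z).const_sub w
  have h2 : HasDerivAt (fun z => 1 - conj w * z) (-(conj w * 1)) z :=
    ((hasDerivAt_id z).const_mul (conj w)).const_sub 1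
  convert! h1.div h2 h0 using 1
  ring

lemma norm_one_sub_conj_mul_self (hw : ‖w‖ < 1) : ‖1 - conj w * w‖ = 1 - ‖w‖ ^ 2 := by
  have : 1 - conj w * w = ((1 - ‖w‖ ^ 2 : ℝ) : ℂ) := by
    rw [← Complex.normSq_eq_conj_mul_self, Complex.normSq_eq_norm_sq]
    push_cast
    rfl
  rw [this, Complex.norm_real, Real.norm_of_nonneg (one_sub_norm_sq_pos hw).le]

/-- The measure `mobiusMeasure` is invariant under the automorphisms of the disc. -/
lemma lintegral_discInvolution (hw : ‖w‖ < 1) {h : ℂ → ℝ≥0∞} (hh : Measurable h) :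
    ∫⁻ z, h (discInvolution w z) ∂mobiusMeasure = ∫⁻ z, h z ∂mobiusMeasure := by
  have hm : Measurable (discInvolution w) := by
    unfold discInvolution
    fun_prop
  -- The density vanishes off the disc, and the change of variables is made on the disc, where the
  -- involution is bijective and differentiable.
  have hball : ∀ g : ℂ → ℝ≥0∞, ∫⁻ z, ENNReal.ofReal (mobiusDensity z) * g z =
      ∫⁻ z in ball 0 1, ENNReal.ofReal (mobiusDensity z) * g z := fun g => by
    refine (setLIntegral_eq_of_support_subset fun z hz => ?_).symm
    rw [mem_ball_zero_iff]
    by_contra hz1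
    exact hz (by simp [mobiusDensity, hz1])
  have himage : discInvolution w '' ball 0 1 = ball 0 1 := by
    ext z
    simp only [mem_image, mem_ball_zero_iff]
    constructor
    · rintro ⟨y, hy, rfl⟩
      exact norm_discInvolution_lt_one hw hy
    · intro hz
      exact ⟨_, norm_discInvolution_lt_one hw hz, discInvolution_discInvolution hw hz⟩
  have hinj : InjOn (discInvolution w) (ball 0 1) := fun x hx y hy hxy => by
    rw [mem_ball_zero_iff] at hx hy
    rw [← discInvolution_discInvolution hw hx, hxy, discInvolution_discInvolution hw hy]
  rw [mobiusMeasure_eq, lintegral_withDensity_ofReal (h := fun z => h (discInvolution w z)) (by fun_prop) (hh.comp hm),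
    lintegral_withDensity_ofReal (by fun_prop) hh, hball, hball h]
  have hj := lintegral_image_eq_lintegral_abs_det_fderiv_mul (volume : Measure ℂ)
    measurableSet_ball (fun z hz => ((hasDerivAt_discInvolution hw
      (mem_ball_zero_iff.1 hz)).hasFDerivAt.restrictScalars ℝ).hasFDerivWithinAt) hinj
    (fun z => ENNReal.ofReal (mobiusDensity z) * h z)
  rw [himage] at hj
  rw [hj]
  refine setLIntegral_congr_fun measurableSet_ball fun z hz => ?_
  rw [mem_ball_zero_iff] at hz
  -- The real Jacobian of a holomorphic map is the squared modulus of its derivative.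
  have hdet : ∀ d : ℂ, ((ContinuousLinearMap.toSpanSingleton ℂ d).restrictScalars ℝ).det =
      ‖d‖ ^ 2 := fun d => by
    simp [ContinuousLinearMap.det, LinearMap.det_restrictScalars, Algebra.norm_complex_eq,
      Complex.normSq_eq_norm_sq]
  have h1 := one_sub_norm_sq_pos hw
  have h2 := one_sub_norm_sq_pos hz
  have h0 : 0 < ‖1 - conj w * z‖ := norm_pos_iff.2 (one_sub_conj_mul_ne_zero hw hz)
  rw [← mul_assoc, ← ENNReal.ofReal_mul (abs_nonneg _)]
  congr 2
  rw [hdet, mobiusDensity, mobiusDensity, if_pos hz,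
    if_pos (norm_discInvolution_lt_one hw hz), one_sub_norm_sq_discInvolution hw hz, norm_div,
    norm_neg, norm_one_sub_conj_mul_self hw, norm_pow, abs_of_nonneg (by positivity)]
  have := Real.pi_pos
  field_simp

lemma norm_discInvolution_comm (w z : ℂ) : ‖discInvolution w z‖ = ‖discInvolution z w‖ := by
  have : 1 - conj w * z = conj (1 - conj z * w) := by
    simp [mul_comm]
  rw [discInvolution, discInvolution, norm_div, norm_div, norm_sub_rev, this,
    RCLike.norm_conj]

end

/-- Circular averages of a function only depend on the modulus. -/
lemma lintegral_circle_mul_congr (h : ℂ → ℝ≥0∞) {a b : ℂ} (hab : ‖a‖ = ‖b‖) :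
    ∫⁻ t : Circle, h (t * a) ∂circleMeasure = ∫⁻ t : Circle, h (t * b) ∂circleMeasure := by
  by_cases hb : b = 0
  · have ha : a = 0 := by simpa [hb] using hab
    rw [ha, hb]
  · have hc : ‖a / b‖ = 1 := by
      rw [norm_div, hab, div_self (norm_ne_zero_iff.2 hb)]
    obtain ⟨c, hc'⟩ : ∃ c : Circle, (c : ℂ) = a / b := ⟨⟨a / b, mem_sphere_zero_iff_norm.2 hc⟩, rfl⟩
    rw [← (measurePreserving_circle_mul c).lintegral_comp_emb
      (measurableEmbedding_circle_mul c) (fun t : Circle => h (t * b))]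
    congr 1
    ext t
    congr 1
    rw [Circle.coe_mul, hc']
    field_simp

/-! ### The Möbius shifts -/

/-- The disc counterpart of `weyl_density`. The exponent is real, so the modulus of the power
depends only on the modulus of its base and not on the branch. -/
lemma mobiusShift_weight {α : ℝ} {z ζ : ℂ} (hz : ‖z‖ < 1) (hζ : ‖ζ‖ < 1) (g : ℂ → ℂ) :
    ENNReal.ofReal ((1 - ‖ζ‖ ^ 2) ^ (α + 2)) * ‖mobiusShift α z g ζ‖ₑ ^ 2 =
      ENNReal.ofReal ((1 - ‖discInvolution z ζ‖ ^ 2) ^ (α + 2)) *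
        ‖g (-discInvolution z ζ)‖ₑ ^ 2 := by
  have h1 := one_sub_norm_sq_pos hz
  have h2 := one_sub_norm_sq_pos hζ
  have h0 : 0 < ‖1 - conj z * ζ‖ := norm_pos_iff.2 (one_sub_conj_mul_ne_zero hz hζ)
  have h3 : ‖((1 - (‖z‖ : ℂ) ^ 2) / (1 - conj z * ζ) ^ 2) ^ ((2 + α : ℂ) / 2)‖ ^ 2 =
      ((1 - ‖z‖ ^ 2) / ‖1 - conj z * ζ‖ ^ 2) ^ (α + 2) := by
    have h4 : (2 + α : ℂ) / 2 = (((2 + α) / 2 : ℝ) : ℂ) := by push_cast; rfl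
    have h5 : 1 - (‖z‖ : ℂ) ^ 2 = ((1 - ‖z‖ ^ 2 : ℝ) : ℂ) := by push_cast; rfl
    rw [h4, h5, Complex.norm_cpow_real, norm_div, Complex.norm_real, norm_pow,
      Real.norm_of_nonneg h1.le, ← Real.rpow_mul_natCast (by positivity)]
    congr 1
    push_cast
    ring
  have h6 : (ζ - z) / (1 - conj z * ζ) = -discInvolution z ζ := by
    rw [discInvolution, ← neg_div, neg_sub]
  rw [mobiusShift, h6, enorm_mul, mul_pow,
    enorm_sq_eq_ofReal (((1 - (‖z‖ : ℂ) ^ 2) / (1 - conj z * ζ) ^ 2) ^ ((2 + α : ℂ) / 2)), h3,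
    one_sub_norm_sq_discInvolution hz hζ, mul_left_comm,
    ← ENNReal.ofReal_mul (by positivity), ← Real.mul_rpow h2.le (by positivity),
    mul_comm (1 - ‖ζ‖ ^ 2), div_mul_eq_mul_div, mul_comm]

lemma sq_mem_slitPlane {u : ℂ} (hu : 0 < u.re) : u ^ 2 ∈ Complex.slitPlane := by
  rw [Complex.mem_slitPlane_iff]
  by_cases h : u.im = 0
  · left
    rw [sq, Complex.mul_re, h]
    nlinarith
  · right
    rw [sq, Complex.mul_im]
    intro h'
    have : u.re * u.im = 0 := by linarith
    rcases mul_eq_zero.1 this with h'' | h''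
    · exact hu.ne' h''
    · exact h h''

/-- Since `1 - conj z * ζ` has positive real part, so does its inverse, and the square of such a
number avoids the branch cut. -/
lemma mobiusShift_base_mem {z ζ : ℂ} (hz : ‖z‖ < 1) (hζ : ‖ζ‖ < 1) :
    (1 - (‖z‖ : ℂ) ^ 2) / (1 - conj z * ζ) ^ 2 ∈ Complex.slitPlane := by
  have h1 := one_sub_norm_sq_pos hz
  have h2 := re_one_sub_conj_mul_pos hz hζ
  have h3 : 0 < ((1 - conj z * ζ)⁻¹).re := by
    rw [Complex.inv_re]
    exact div_pos h2 (Complex.normSq_pos.2 (one_sub_conj_mul_ne_zero hz hζ))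
  have h4 := sq_mem_slitPlane h3
  have h5 : (1 - (‖z‖ : ℂ) ^ 2) / (1 - conj z * ζ) ^ 2 =
      ((1 - ‖z‖ ^ 2 : ℝ) : ℂ) * ((1 - conj z * ζ)⁻¹) ^ 2 := by
    push_cast
    rw [div_eq_mul_inv, inv_pow]
  rw [h5, Complex.mem_slitPlane_iff, Complex.re_ofReal_mul, Complex.im_ofReal_mul]
  rcases Complex.mem_slitPlane_iff.1 h4 with h | h
  · exact Or.inl (mul_pos h1 h)
  · exact Or.inr (mul_ne_zero h1.ne' h)

lemma differentiableOn_mobiusShift (α : ℝ) (t : Circle) {z : ℂ} (hz : ‖z‖ < 1) {φ : ℂ → ℂ}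
    (hφ : DifferentiableOn ℂ φ (ball 0 1)) :
    DifferentiableOn ℂ (mobiusShift α z (rotate t φ)) (ball 0 1) := by
  have h0 : ∀ ζ ∈ ball (0 : ℂ) 1, 1 - conj z * ζ ≠ 0 := fun ζ hζ =>
    one_sub_conj_mul_ne_zero hz (mem_ball_zero_iff.1 hζ)
  have h1 : DifferentiableOn ℂ (fun ζ => (t : ℂ) * ((ζ - z) / (1 - conj z * ζ))) (ball 0 1) :=
    (DifferentiableOn.div (by fun_prop) (by fun_prop) h0).const_mul _
  have h2 : MapsTo (fun ζ => (t : ℂ) * ((ζ - z) / (1 - conj z * ζ))) (ball 0 1) (ball 0 1) := by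
    intro ζ hζ
    have h3 := norm_discInvolution_lt_one hz (mem_ball_zero_iff.1 hζ)
    rw [discInvolution, norm_div, norm_sub_rev, ← norm_div] at h3
    rw [mem_ball_zero_iff, norm_mul, Circle.norm_coe, one_mul]
    exact h3
  refine (hφ.comp h1 h2).mul (DifferentiableOn.cpow ?_ (by fun_prop) fun ζ hζ =>
    mobiusShift_base_mem hz (mem_ball_zero_iff.1 hζ))
  exact DifferentiableOn.div (by fun_prop) (by fun_prop) fun ζ hζ => pow_ne_zero 2 (h0 ζ hζ)

/-- The functions `U_z φ_t` for `z` in the open unit disc, extended by `0`. -/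
def mobiusFamily (α : ℝ) (φ : ℂ → ℂ) (p : Circle × ℂ) (ζ : ℂ) : ℂ :=
  if ‖p.2‖ < 1 ∧ ‖ζ‖ < 1 then mobiusShift α p.2 (rotate p.1 φ) ζ else 0

lemma measurable_mobiusFamily (α : ℝ) {φ : ℂ → ℂ} (hφ : Measurable φ) :
    Measurable (Function.uncurry (mobiusFamily α φ)) := by
  have hc : Measurable fun q : (Circle × ℂ) × ℂ => conj q.1.2 :=
    Complex.continuous_conj.measurable.comp (by fun_prop)
  refine Measurable.ite ?_ ?_ measurable_const
  · exact (measurableSet_norm_lt_one.preimage (f := fun q : (Circle × ℂ) × ℂ => q.1.2)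
      (by fun_prop)).inter (measurableSet_norm_lt_one.preimage
        (f := fun q : (Circle × ℂ) × ℂ => q.2) (by fun_prop))
  · exact (hφ.comp (by fun_prop : Measurable fun q : (Circle × ℂ) × ℂ =>
      (q.1.1 : ℂ) * ((q.2 - q.1.2) / (1 - conj q.1.2 * q.2)))).mul
      (Measurable.pow (by fun_prop) (by fun_prop))

lemma mobiusFamily_rotate (α : ℝ) (φ : ℂ → ℂ) (s : Circle) (p : Circle × ℂ) (ζ : ℂ) :
    mobiusFamily α φ (s⁻¹ * p.1, (s : ℂ) * p.2) (s * ζ) = mobiusFamily α φ p ζ := by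
  have hs : (s : ℂ) ≠ 0 := Circle.coe_ne_zero s
  have hs1 : conj (s : ℂ) * s = 1 := by
    rw [← Complex.normSq_eq_conj_mul_self, Circle.normSq_coe]
    simp
  have h1 : conj ((s : ℂ) * p.2) * (s * ζ) = conj p.2 * ζ := by
    rw [map_mul]
    linear_combination (conj p.2 * ζ) * hs1
  have h2 : ((s⁻¹ * p.1 : Circle) : ℂ) * ((s * ζ - s * p.2) / (1 - conj p.2 * ζ)) =
      p.1 * ((ζ - p.2) / (1 - conj p.2 * ζ)) := by
    rw [Circle.coe_mul, Circle.coe_inv, ← mul_sub]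
    field_simp
  simp only [mobiusFamily, mobiusShift, rotate, norm_mul, Circle.norm_coe, one_mul, h1, h2]

lemma lintegral_mobiusFamily {α : ℝ} (hα : -1 < α) (t : Circle) {z : ℂ} (hz : ‖z‖ < 1)
    {φ : ℂ → ℂ} (hφ : Measurable φ) :
    ∫⁻ ζ, ‖mobiusFamily α φ (t, z) ζ‖ₑ ^ 2 ∂bergmanMeasure α =
      ∫⁻ ζ, ‖φ ζ‖ₑ ^ 2 ∂bergmanMeasure α := by
  have hm : Measurable (mobiusFamily α φ (t, z)) :=
    (measurable_mobiusFamily α hφ).comp (measurable_prodMk_left (x := (t, z)))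
  have hr : Measurable fun ζ => φ (t * -ζ) := hφ.comp (by fun_prop)
  -- The shift uses minus the involution; the sign and `t` combine into the single rotation by `-t`.
  have h1 : ∫⁻ ζ, ‖φ ζ‖ₑ ^ 2 ∂bergmanMeasure α = ∫⁻ ζ, ‖φ (t * -ζ)‖ₑ ^ 2 ∂bergmanMeasure α := by
    obtain ⟨c, hc⟩ : ∃ c : Circle, (c : ℂ) = -t := 
      ⟨⟨-t, mem_sphere_zero_iff_norm.2 (by rw [norm_neg, Circle.norm_coe])⟩, rfl⟩
    rw [← (measurePreserving_rot_bergman α c).lintegral_comp (hφ.enorm.pow_const 2)]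
    simp [hc]
  rw [h1, lintegral_bergman hα (hm.enorm.pow_const 2), lintegral_bergman hα (hr.enorm.pow_const 2)]
  congr 1
  rw [← lintegral_discInvolution hz (h := fun ζ => ENNReal.ofReal ((1 - ‖ζ‖ ^ 2) ^ (α + 2)) *
    ‖φ (t * -ζ)‖ₑ ^ 2) (by fun_prop)]
  refine lintegral_congr_ae ?_
  filter_upwards [ae_mem_mobius] with ζ hζ
  have hζ1 : ‖ζ‖ < 1 := mem_ball_zero_iff.1 hζ
  rw [mobiusFamily, if_pos ⟨hz, hζ1⟩, mobiusShift_weight hz hζ1]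
  rfl

lemma mobiusFamily_mem {α : ℝ} (hα : -1 < α) (p : Circle × ℂ) {φ : ℂ → ℂ}
    (hφ : φ ∈ holL2 (ball 0 1) (bergmanMeasure α)) :
    mobiusFamily α φ p ∈ holL2 (ball 0 1) (bergmanMeasure α) := by
  obtain ⟨t, z⟩ := p
  by_cases hz : ‖z‖ < 1
  · have hφm : Measurable φ := (isRadial_bergman hα).measurable_of_mem hφ.1 hφ.2.1
    refine ⟨(differentiableOn_mobiusShift α t hz hφ.1).congr fun ζ hζ => ?_, fun ζ hζ => ?_,
      memLp_two_iff_lintegral.2 ⟨?_, ?_⟩⟩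
    · rw [mobiusFamily, if_pos ⟨hz, mem_ball_zero_iff.1 hζ⟩]
    · rw [mobiusFamily, if_neg fun h => hζ (mem_ball_zero_iff.2 h.2)]
    · exact ((measurable_mobiusFamily α hφm).comp
        (measurable_prodMk_left (x := (t, z)))).aestronglyMeasurable
    · rw [lintegral_mobiusFamily hα t hz hφm]
      exact (memLp_two_iff_lintegral.1 hφ.2.2).2
  · have : mobiusFamily α φ (t, z) = 0 := by
      ext ζ
      rw [mobiusFamily, if_neg fun h => hz h.1, Pi.zero_apply]
    rw [this]
    exact Submodule.zero_mem _

/-- The integration variable `z` is the parameter of the involution. Exchanging it with `w`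
preserves the modulus of the image and changes only its argument, which the average over the circle
absorbs; then Möbius invariance of `mobiusMeasure` applies. -/
lemma lintegral_mobiusFamily_apply {α : ℝ} (hα : -1 < α) {φ : ℂ → ℂ} (hφ : Measurable φ) {w : ℂ}
    (hw : w ∈ ball (0 : ℂ) 1) :
    ∫⁻ p : Circle × ℂ, ‖mobiusFamily α φ p w‖ₑ ^ 2 ∂circleMeasure.prod mobiusMeasure =
      ENNReal.ofReal (α + 1)⁻¹ * (∫⁻ ζ, ‖φ ζ‖ₑ ^ 2 ∂bergmanMeasure α) *
        ∑' k : ℕ, ENNReal.ofReal (‖w ^ k‖ ^ 2 / bergmanMoment α k) := by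
  have hα' : 0 < α + 1 := by linarith
  have hw1 : ‖w‖ < 1 := mem_ball_zero_iff.1 hw
  have hW : 0 < (1 - ‖w‖ ^ 2) ^ (α + 2) := Real.rpow_pos_of_pos (one_sub_norm_sq_pos hw1) _
  have hm : Measurable fun p : Circle × ℂ => ‖mobiusFamily α φ p w‖ₑ ^ 2 :=
    ((measurable_mobiusFamily α hφ).comp (measurable_prodMk_right (y := w))).enorm.pow_const 2
  have hH : Measurable fun q : Circle × ℂ =>
      ENNReal.ofReal ((1 - ‖q.2‖ ^ 2) ^ (α + 2)) * ‖φ (q.1 * q.2)‖ₑ ^ 2 :=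
    Measurable.mul (by fun_prop) ((hφ.comp (by fun_prop)).enorm.pow_const 2)
  have hD : Measurable fun q : Circle × ℂ => (q.1, discInvolution w q.2) := by
    unfold discInvolution
    fun_prop
  have h1 : ENNReal.ofReal ((1 - ‖w‖ ^ 2) ^ (α + 2)) *
      ∫⁻ p : Circle × ℂ, ‖mobiusFamily α φ p w‖ₑ ^ 2 ∂circleMeasure.prod mobiusMeasure =
      ENNReal.ofReal (α + 1)⁻¹ * ∫⁻ ζ, ‖φ ζ‖ₑ ^ 2 ∂bergmanMeasure α := by
    rw [← lintegral_const_mul _ hm, lintegral_prod_symm _ (hm.const_mul _).aemeasurable]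
    calc _ = ∫⁻ z, ∫⁻ t : Circle,
          ENNReal.ofReal ((1 - ‖discInvolution w z‖ ^ 2) ^ (α + 2)) *
            ‖φ (t * discInvolution w z)‖ₑ ^ 2 ∂circleMeasure ∂mobiusMeasure := by
          refine lintegral_congr_ae ?_
          filter_upwards [ae_mem_mobius] with z hz
          have hz1 : ‖z‖ < 1 := mem_ball_zero_iff.1 hz
          simp only [mobiusFamily, hz1, hw1, and_self, if_true, mobiusShift_weight hz1 hw1]
          rw [norm_discInvolution_comm z w]
          have h2 := lintegral_circle_mul_congr (fun x => ENNReal.ofReal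
            ((1 - ‖discInvolution w z‖ ^ 2) ^ (α + 2)) * ‖φ x‖ₑ ^ 2)
            (a := -discInvolution z w) (b := discInvolution w z)
            (by rw [norm_neg, norm_discInvolution_comm])
          exact h2
      _ = ∫⁻ t : Circle, ∫⁻ z,
          ENNReal.ofReal ((1 - ‖discInvolution w z‖ ^ 2) ^ (α + 2)) *
            ‖φ (t * discInvolution w z)‖ₑ ^ 2 ∂mobiusMeasure ∂circleMeasure :=
          (lintegral_lintegral_swap (f := fun (t : Circle) z =>
            ENNReal.ofReal ((1 - ‖discInvolution w z‖ ^ 2) ^ (α + 2)) *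
              ‖φ (t * discInvolution w z)‖ₑ ^ 2) (hH.comp hD).aemeasurable).symm
      _ = ∫⁻ t : Circle, ENNReal.ofReal (α + 1)⁻¹ * ∫⁻ ζ, ‖φ ζ‖ₑ ^ 2 ∂bergmanMeasure α
          ∂circleMeasure := by
          refine lintegral_congr fun t => ?_
          have hr : Measurable fun ζ => φ (t * ζ) := hφ.comp (by fun_prop)
          rw [lintegral_discInvolution hw1 (h := fun ζ =>
            ENNReal.ofReal ((1 - ‖ζ‖ ^ 2) ^ (α + 2)) * ‖φ (t * ζ)‖ₑ ^ 2) (by fun_prop),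
            ← lintegral_rotate (isRadial_bergman hα) t hφ]
          simp only [rotate]
          rw [lintegral_bergman hα (hr.enorm.pow_const 2), ← mul_assoc,
            ← ENNReal.ofReal_mul (by positivity), inv_mul_cancel₀ hα'.ne', ENNReal.ofReal_one,
            one_mul]
      _ = _ := by simp
  rw [← ENNReal.ofReal_tsum_of_nonneg
    (fun k => div_nonneg (by positivity) (bergmanMoment_pos hα k).le) (bergman_kernel hα hw).summable,
    (bergman_kernel hα hw).tsum_eq, ← h1]
  have h3 : ENNReal.ofReal ((1 - ‖w‖ ^ 2) ^ (α + 2)) *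
      ENNReal.ofReal ((1 - ‖w‖ ^ 2) ^ (α + 2))⁻¹ = 1 := by
    rw [← ENNReal.ofReal_mul hW.le, mul_inv_cancel₀ hW.ne', ENNReal.ofReal_one]
  rw [mul_right_comm, h3, one_mul]

/-- The orthogonality relations for the Möbius shifts. -/
theorem lintegral_pairing_mobiusFamily {α : ℝ} (hα : -1 < α) {φ g : ℂ → ℂ}
    (hφ : φ ∈ holL2 (ball 0 1) (bergmanMeasure α)) (hg : g ∈ holL2 (ball 0 1) (bergmanMeasure α)) :
    ∫⁻ p : Circle × ℂ, ‖pairing (bergmanMeasure α) g (mobiusFamily α φ p)‖ₑ ^ 2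
        ∂circleMeasure.prod mobiusMeasure =
      ENNReal.ofReal (α + 1)⁻¹ * (∫⁻ ζ, ‖φ ζ‖ₑ ^ 2 ∂bergmanMeasure α) *
        ∫⁻ ζ, ‖g ζ‖ₑ ^ 2 ∂bergmanMeasure α := by
  have hφm : Measurable φ := (isRadial_bergman hα).measurable_of_mem hφ.1 hφ.2.1
  have hC : ENNReal.ofReal (α + 1)⁻¹ * (∫⁻ ζ, ‖φ ζ‖ₑ ^ 2 ∂bergmanMeasure α) ≠ ∞ :=
    ENNReal.mul_ne_top ENNReal.ofReal_ne_top (memLp_two_iff_lintegral.1 hφ.2.2).2.ne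
  have hrot : ∀ s : Circle, ∃ τ : Circle × ℂ → Circle × ℂ,
      MeasurePreserving τ (circleMeasure.prod mobiusMeasure) (circleMeasure.prod mobiusMeasure) ∧
      ∀ p, ∀ ζ ∈ ball (0 : ℂ) 1, mobiusFamily α φ (τ p) (s * ζ) = mobiusFamily α φ p ζ := fun s =>
    ⟨fun p => (s⁻¹ * p.1, (s : ℂ) * p.2),
      measurePreserving_rot_prod measurePreserving_rot_mobius s,
      fun p ζ _ => mobiusFamily_rotate α φ s p ζ⟩
  refine (isRadial_bergman hα).lintegral_pairing_normSq (ν := circleMeasure.prod mobiusMeasure)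
    (u := mobiusFamily α φ) (measurable_mobiusFamily α hφm)
    (fun p => (mobiusFamily_mem hα p hφ).1) (fun p => (mobiusFamily_mem hα p hφ).2.2) hC
    (fun w hw => ?_) hrot hg
  have := lintegral_mobiusFamily_apply hα hφm hw
  exact this

/-! ### Localization operators on the Bergman space -/

section

variable {α : ℝ} {hα : -1 < α}

lemma bergman_norm_sq (g : BergmanSpace α hα) :
    ‖g‖ ^ 2 = ∫ ζ, ‖g ζ‖ ^ 2 ∂bergmanMeasure α := by
  have h := inner_self_eq_norm_sq (𝕜 := ℂ) g
  rw [← h]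
  exact (congrArg Complex.re norm_sq_holL2).trans (Complex.ofReal_re _)

lemma bergman_enorm_sq (g : BergmanSpace α hα) :
    ‖g‖ₑ ^ 2 = ∫⁻ ζ, ‖g ζ‖ₑ ^ 2 ∂bergmanMeasure α := by
  have h : ‖g‖ₑ ^ 2 = ENNReal.ofReal (‖g‖ ^ 2) := by
    rw [ENNReal.ofReal_pow (norm_nonneg _), ofReal_norm]
  rw [h, bergman_norm_sq, integral_norm_sq_eq_toReal g.2.2.2.1,
    ENNReal.ofReal_toReal (memLp_two_iff_lintegral.1 g.2.2.2).2.ne]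

lemma bergman_measurable (g : BergmanSpace α hα) : Measurable (g : ℂ → ℂ) :=
  (isRadial_bergman hα).measurable_of_mem g.2.1 g.2.2.1

/-- The inclusion of the Bergman space into the functions on the plane. -/
def bergmanCoe : BergmanSpace α hα →ₗ[ℂ] (ℂ → ℂ) where
  toFun g := g.1
  map_add' _ _ := rfl
  map_smul' _ _ := rfl

instance : CompleteSpace (BergmanSpace α hα) :=
  (isRadial_bergman hα).completeSpace bergmanCoe
    (fun _ => ⟨fun h => ⟨⟨_, h⟩, rfl⟩, fun ⟨e, he⟩ => he ▸ e.2⟩)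
    (fun _ _ h => Subtype.ext h) bergman_norm_sq

/-- The transform `g ↦ ⟨g, U_z φ_t⟩` of the Bergman space. -/
def bergmanTransform (φ : BergmanSpace α hα) : BergmanSpace α hα →ₗ[ℂ] (Circle × ℂ → ℂ) where
  toFun g p := pairing (bergmanMeasure α) g (mobiusFamily α φ p)
  map_add' g h := funext fun p =>
    pairing_add_left (g := g.1) (g' := h.1) g.2.2.2 h.2.2.2 (mobiusFamily_mem hα p φ.2).2.2
  map_smul' c _ := funext fun _ => pairing_smul_left c _ _

lemma measurable_bergmanTransform (φ g : BergmanSpace α hα) :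
    Measurable (bergmanTransform φ g) := by
  have := (isRadial_bergman hα).isFiniteMeasure
  exact measurable_pairing (g := fun _ : Circle × ℂ => (g : ℂ → ℂ))
    ((bergman_measurable g).comp measurable_snd)
    (measurable_mobiusFamily α (bergman_measurable φ))

lemma lintegral_bergmanTransform (φ g : BergmanSpace α hα) :
    ∫⁻ p, ‖bergmanTransform φ g p‖ₑ ^ 2 ∂circleMeasure.prod mobiusMeasure =
      ENNReal.ofReal (α + 1)⁻¹ * ‖φ‖ₑ ^ 2 * ‖g‖ₑ ^ 2 := by
  rw [bergman_enorm_sq, bergman_enorm_sq]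
  exact lintegral_pairing_mobiusFamily hα φ.2 g.2

lemma bergmanTransform_eq (φ g : BergmanSpace α hα) (t : Circle) {z : ℂ} (hz : ‖z‖ < 1) :
    bergmanTransform φ g (t, z) =
      pairing (bergmanMeasure α) g (mobiusShift α z (rotate t φ)) := by
  refine integral_congr_ae ?_
  filter_upwards [ae_mem_bergman α] with ζ hζ
  rw [mobiusFamily, if_pos ⟨hz, mem_ball_zero_iff.1 hζ⟩]

lemma bergmanIntegrand_eq (φ ψ : BergmanSpace α hα) (f : Circle × ℂ → ℂ) (g h : BergmanSpace α hα)
    (t : Circle) {z : ℂ} (hz : ‖z‖ < 1) : bergmanIntegrand φ ψ f g h t z =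
      f (t, z) * bergmanTransform φ g (t, z) * conj (bergmanTransform ψ h (t, z)) := by
  rw [bergmanIntegrand, pairing_conj_symm _ (mobiusShift α z (rotate t ψ)),
    bergmanTransform_eq φ g t hz, bergmanTransform_eq ψ h t hz]

lemma ae_prod_mobius : ∀ᵐ p ∂circleMeasure.prod mobiusMeasure, ‖p.2‖ < 1 := by
  have h := Measure.quasiMeasurePreserving_snd (μ := circleMeasure) (ν := mobiusMeasure)
  filter_upwards [h.ae ae_mem_mobius] with p hp
  exact mem_ball_zero_iff.1 hp

theorem existsUnique_bergmanLocalization (φ ψ : BergmanSpace α hα) {f : Circle × ℂ → ℂ}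
    (hf : MemLp f ∞ (circleMeasure.prod mobiusMeasure)) :
    ∃! T : BergmanSpace α hα →L[ℂ] BergmanSpace α hα, IsBergmanLocalization φ ψ f T := by
  have hα' : 0 < α + 1 := by linarith
  have hb : ∀ φ g : BergmanSpace α hα,
      ∫⁻ p, ‖bergmanTransform φ g p‖ₑ ^ 2 ∂circleMeasure.prod mobiusMeasure ≤
      (ENNReal.ofReal (Real.sqrt (α + 1)⁻¹ * ‖φ‖) * ‖g‖ₑ) ^ 2 := fun φ g => by
    rw [lintegral_bergmanTransform, mul_pow, ENNReal.ofReal_mul (Real.sqrt_nonneg _), mul_pow,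
      ofReal_norm, ← ENNReal.ofReal_pow (Real.sqrt_nonneg _), Real.sq_sqrt (by positivity)]
  obtain ⟨T, hT, hu⟩ := existsUnique_operator (bergmanTransform φ) (bergmanTransform ψ)
    (fun g => (measurable_bergmanTransform φ g).aestronglyMeasurable)
    (fun g => (measurable_bergmanTransform ψ g).aestronglyMeasurable) (hb φ) (hb ψ) hf
    (fun g h p => bergmanIntegrand φ ψ f g h p.1 p.2)
    (fun g h => by
      filter_upwards [ae_prod_mobius] with p hp
      exact bergmanIntegrand_eq φ ψ f g h p.1 hp) (α + 1 : ℂ)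
  refine ⟨T, fun g h => ⟨(hT g h).1, ?_⟩, fun S hS => hu S fun g h => ⟨(hS g h).1, ?_⟩⟩
  · exact (hT g h).2.trans (congrArg _ (integral_prod _ (hT g h).1))
  · exact (hS g h).2.trans (congrArg _ (integral_prod _ (hS g h).1).symm)

end

/-! ### Rescaled symbols -/

lemma quasiMeasurePreserving_smul {r : ℝ} (hr : r ≠ 0) :
    Measure.QuasiMeasurePreserving (fun z : ℂ => (r : ℂ) * z) volume volume := by
  have h := Measure.map_addHaar_smul (volume : Measure ℂ) hr
  simp only [Complex.real_smul] at h
  refine ⟨by fun_prop, ?_⟩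
  rw [h]
  exact Measure.smul_absolutelyContinuous

/-- The symbol is controlled only up to null sets, so dilating it requires that null sets pull back
to null sets. -/
lemma quasiMeasurePreserving_prod_smul {r : ℝ} (hr : r ≠ 0) {ν : Measure ℂ} [SFinite ν]
    (hν : ν ≪ volume) :
    Measure.QuasiMeasurePreserving (fun p : Circle × ℂ => (p.1, (r : ℂ) * p.2))
      (circleMeasure.prod ν) (circleMeasure.prod volume) := by
  have h : Measure.QuasiMeasurePreserving (fun z : ℂ => (r : ℂ) * z) ν volume :=
    ⟨by fun_prop, (hν.map (by fun_prop)).trans (quasiMeasurePreserving_smul hr).absolutelyContinuous⟩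
  refine ⟨by fun_prop, ?_⟩
  have : SFinite (Measure.map (fun z : ℂ => (r : ℂ) * z) ν) := inferInstance
  rw [show (fun p : Circle × ℂ => (p.1, (r : ℂ) * p.2)) = Prod.map id fun z => (r : ℂ) * z from rfl,
    ← Measure.map_prod_map _ _ measurable_id (by fun_prop), Measure.map_id]
  exact Measure.AbsolutelyContinuous.rfl.prod h.absolutelyContinuous

lemma mobiusMeasure_absolutelyContinuous : mobiusMeasure ≪ volume := by
  rw [mobiusMeasure_eq]
  exact withDensity_absolutelyContinuous _ _

lemma memLp_dilateSymbol {r σ : ℝ} (hr : 0 < r) (hσ : 0 ≤ σ) {f : Circle × ℂ → ℂ}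
    (hf : MemLp f ∞ (circleMeasure.prod (volume : Measure ℂ))) :
    MemLp (dilateSymbol r σ f) ∞ (circleMeasure.prod mobiusMeasure) := by
  have hq := quasiMeasurePreserving_prod_smul hr.ne' mobiusMeasure_absolutelyContinuous
  have hm : AEStronglyMeasurable (dilateSymbol r σ f) (circleMeasure.prod mobiusMeasure) := by
    unfold dilateSymbol
    exact (Measurable.aestronglyMeasurable (by fun_prop)).mul
      (hf.1.comp_quasiMeasurePreserving hq)
  refine memLp_top_of_bound hm (eLpNorm f ∞ (circleMeasure.prod volume)).toReal ?_
  have hb := ae_le_eLpNormEssSup (f := f) (μ := circleMeasure.prod volume)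
  filter_upwards [hq.ae hb, ae_prod_mobius] with p hp hp1
  have h1 := one_sub_norm_sq_pos hp1
  have h2 : (1 - ‖p.2‖ ^ 2) ^ σ ≤ 1 := Real.rpow_le_one h1.le (by nlinarith [norm_nonneg p.2]) hσ
  rw [dilateSymbol, norm_mul, Complex.norm_real, Real.norm_of_nonneg (by positivity)]
  have h3 : ‖f (p.1, r * p.2)‖ ≤ (eLpNorm f ∞ (circleMeasure.prod volume)).toReal := by
    have h4 : ‖f (p.1, r * p.2)‖ₑ ≤ eLpNorm f ∞ (circleMeasure.prod volume) := by
      rw [eLpNorm_exponent_top]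
      exact hp
    have h5 := ENNReal.toReal_mono hf.2.ne h4
    rwa [toReal_enorm] at h5
  calc _ ≤ 1 * ‖f (p.1, r * p.2)‖ := mul_le_mul_of_nonneg_right h2 (norm_nonneg _)
    _ ≤ _ := by rw [one_mul]; exact h3

/-! ### Change of scale -/

/-- The density with respect to `ξ = r z` of the measure with density `ρ` with respect to `z`. -/
def scaleDensity (ρ : ℂ → ℝ) (r : ℝ) (ξ : ℂ) : ℝ := (r ^ 2)⁻¹ * ρ ((r : ℂ)⁻¹ * ξ)

lemma measurable_scaleDensity {ρ : ℂ → ℝ} (hρ : Measurable ρ) (r : ℝ) :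
    Measurable (scaleDensity ρ r) :=
  (hρ.comp (by fun_prop)).const_mul _

lemma scaleDensity_nonneg {ρ : ℂ → ℝ} (h0 : ∀ z, 0 ≤ ρ z) (r : ℝ) (ξ : ℂ) :
    0 ≤ scaleDensity ρ r ξ :=
  mul_nonneg (by positivity) (h0 _)

/-- Writes every measure on the disc as a density in `ξ = r z` against the fixed area measure, so
that limits in `r` can be taken under one integral. -/
lemma map_scaleDensity {ρ : ℂ → ℝ} (hρ : Measurable ρ) {r : ℝ} (hr : 0 < r) :
    (volume.withDensity fun ξ => ENNReal.ofReal (scaleDensity ρ r ξ)).map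
      (fun ξ => (r : ℂ)⁻¹ * ξ) = volume.withDensity fun z => ENNReal.ofReal (ρ z) := by
  have hm : Measurable fun ξ : ℂ => (r : ℂ)⁻¹ * ξ := by fun_prop
  have hmap : Measure.map (fun ξ : ℂ => (r : ℂ)⁻¹ * ξ) volume =
      ENNReal.ofReal (r ^ 2) • (volume : Measure ℂ) := by
    have h := Measure.map_addHaar_smul (volume : Measure ℂ) (inv_ne_zero hr.ne')
    simp only [Complex.real_smul, Complex.finrank_real_complex, Complex.ofReal_inv] at h
    rw [h, inv_pow, inv_inv, abs_of_nonneg (by positivity)]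
  ext A hA
  rw [Measure.map_apply hm hA, withDensity_apply _ (hm hA), withDensity_apply _ hA]
  have h1 : ∀ ξ, ENNReal.ofReal (scaleDensity ρ r ξ) =
      ENNReal.ofReal (r ^ 2)⁻¹ * ENNReal.ofReal (ρ ((r : ℂ)⁻¹ * ξ)) := fun ξ => by
    rw [scaleDensity, ENNReal.ofReal_mul (by positivity)]
  simp only [h1]
  rw [lintegral_const_mul' _ _ ENNReal.ofReal_ne_top,
    ← setLIntegral_map hA (f := fun z => ENNReal.ofReal (ρ z)) (by fun_prop) hm, hmap,
    Measure.restrict_smul, lintegral_smul_measure, smul_eq_mul, ← mul_assoc,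
    ← ENNReal.ofReal_mul (by positivity), inv_mul_cancel₀ (by positivity), ENNReal.ofReal_one,
    one_mul]

lemma measurableEmbedding_inv_mul {r : ℝ} (hr : 0 < r) :
    MeasurableEmbedding fun ξ : ℂ => (r : ℂ)⁻¹ * ξ :=
  (Homeomorph.mulLeft₀ (r : ℂ)⁻¹
    (inv_ne_zero (Complex.ofReal_ne_zero.2 hr.ne'))).measurableEmbedding

lemma lintegral_scale {ρ : ℂ → ℝ} (hρ : Measurable ρ) {r : ℝ} (hr : 0 < r) {h : ℂ → ℝ≥0∞}
    (hh : Measurable h) :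
    ∫⁻ z, h z ∂(volume.withDensity fun z => ENNReal.ofReal (ρ z)) =
      ∫⁻ ξ, ENNReal.ofReal (scaleDensity ρ r ξ) * h ((r : ℂ)⁻¹ * ξ) := by
  rw [← map_scaleDensity hρ hr, lintegral_map hh (by fun_prop),
    lintegral_withDensity_ofReal (h := fun ξ => h ((r : ℂ)⁻¹ * ξ))
      (measurable_scaleDensity hρ r) (hh.comp (by fun_prop))]

lemma integral_scale {ρ : ℂ → ℝ} (hρ : Measurable ρ) (h0 : ∀ z, 0 ≤ ρ z) {r : ℝ} (hr : 0 < r)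
    (h : ℂ → ℂ) :
    ∫ z, h z ∂(volume.withDensity fun z => ENNReal.ofReal (ρ z)) =
      ∫ ξ, (scaleDensity ρ r ξ : ℂ) * h ((r : ℂ)⁻¹ * ξ) := by
  rw [← map_scaleDensity hρ hr, (measurableEmbedding_inv_mul hr).integral_map,
    integral_withDensity_ofReal (measurable_scaleDensity hρ r) (scaleDensity_nonneg h0 r)]

lemma prod_scaleDensity {ρ : ℂ → ℝ} (hρ : Measurable ρ) {r : ℝ} (hr : 0 < r) :
    ((circleMeasure.prod volume).withDensity
      fun p => ENNReal.ofReal (scaleDensity ρ r p.2)).map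
        (Prod.map id fun ξ => (r : ℂ)⁻¹ * ξ) =
      circleMeasure.prod (volume.withDensity fun z => ENNReal.ofReal (ρ z)) := by
  have hm : Measurable fun ξ => ENNReal.ofReal (scaleDensity ρ r ξ) :=
    (measurable_scaleDensity hρ r).ennreal_ofReal
  rw [← prod_withDensity_right hm, ← Measure.map_prod_map _ _ measurable_id (by fun_prop),
    Measure.map_id, map_scaleDensity hρ hr]

lemma lintegral_prod_scale {ρ : ℂ → ℝ} (hρ : Measurable ρ) {r : ℝ} (hr : 0 < r)
    {h : Circle × ℂ → ℝ≥0∞} (hh : Measurable h) :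
    ∫⁻ p, h p ∂circleMeasure.prod (volume.withDensity fun z => ENNReal.ofReal (ρ z)) =
      ∫⁻ p, ENNReal.ofReal (scaleDensity ρ r p.2) * h (p.1, (r : ℂ)⁻¹ * p.2)
        ∂circleMeasure.prod volume := by
  rw [← prod_scaleDensity hρ hr, lintegral_map hh (by fun_prop),
    lintegral_withDensity_ofReal (ρ := fun p : Circle × ℂ => scaleDensity ρ r p.2)
      (h := fun p => h (Prod.map id (fun ξ => (r : ℂ)⁻¹ * ξ) p))
      ((measurable_scaleDensity hρ r).comp measurable_snd) (hh.comp (by fun_prop))]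
  rfl

lemma integral_prod_scale {ρ : ℂ → ℝ} (hρ : Measurable ρ) (h0 : ∀ z, 0 ≤ ρ z) {r : ℝ}
    (hr : 0 < r) (h : Circle × ℂ → ℂ) :
    ∫ p, h p ∂circleMeasure.prod (volume.withDensity fun z => ENNReal.ofReal (ρ z)) =
      ∫ p, (scaleDensity ρ r p.2 : ℂ) * h (p.1, (r : ℂ)⁻¹ * p.2)
        ∂circleMeasure.prod volume := by
  have he : MeasurableEmbedding (Prod.map id fun ξ => (r : ℂ)⁻¹ * ξ : Circle × ℂ → Circle × ℂ) :=
    MeasurableEmbedding.id.prodMap (measurableEmbedding_inv_mul hr)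
  rw [← prod_scaleDensity hρ hr, he.integral_map,
    integral_withDensity_ofReal (ρ := fun p : Circle × ℂ => scaleDensity ρ r p.2)
      ((measurable_scaleDensity hρ r).comp measurable_snd)
      (fun p => scaleDensity_nonneg h0 r p.2)]
  rfl

/-! ### Pointwise limits -/

lemma norm_inv_mul {r : ℝ} (hr : 0 < r) (ξ : ℂ) : ‖(r : ℂ)⁻¹ * ξ‖ = ‖ξ‖ / r := by
  rw [norm_mul, norm_inv, Complex.norm_real, Real.norm_of_nonneg hr.le, inv_mul_eq_div]

lemma norm_inv_mul_lt_one {r : ℝ} (hr : 0 < r) {ξ : ℂ} (h : ‖ξ‖ < r) : ‖(r : ℂ)⁻¹ * ξ‖ < 1 := by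
  rwa [norm_inv_mul hr, div_lt_one hr]

lemma scaleDensity_bergman {β r : ℝ} (hr : 0 < r) {ξ : ℂ} (h : ‖ξ‖ < r) :
    scaleDensity (bergmanDensity (β * r ^ 2)) r ξ =
      (β + (r ^ 2)⁻¹) / Real.pi * (1 - ‖ξ‖ ^ 2 / r ^ 2) ^ (β * r ^ 2) := by
  rw [scaleDensity, bergmanDensity, if_pos (norm_inv_mul_lt_one hr h), norm_inv_mul hr, div_pow]
  have := Real.pi_pos
  field_simp

lemma tendsto_inv_sq_atTop : Tendsto (fun r : ℝ => (r ^ 2)⁻¹) atTop (nhds 0) :=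
  tendsto_inv_atTop_zero.comp (tendsto_pow_atTop two_ne_zero)

lemma tendsto_scaleDensity_bergman (β : ℝ) (ξ : ℂ) :
    Tendsto (fun r : ℝ => scaleDensity (bergmanDensity (β * r ^ 2)) r ξ) atTop
      (nhds (fockDensity β ξ)) := by
  have h1 : Tendsto (fun r : ℝ => (β + (r ^ 2)⁻¹) / Real.pi) atTop (nhds (β / Real.pi)) := by
    simpa using (tendsto_inv_sq_atTop.const_add β).div_const Real.pi
  have h2 : Tendsto (fun r : ℝ => ((1 + -‖ξ‖ ^ 2 / r ^ 2) ^ (r ^ 2)) ^ β) atTop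
      (nhds (Real.exp (-‖ξ‖ ^ 2) ^ β)) :=
    ((Real.tendsto_one_add_div_rpow_exp (-‖ξ‖ ^ 2)).comp (tendsto_pow_atTop two_ne_zero)).rpow_const
      (Or.inl (Real.exp_pos _).ne')
  have h3 : Real.exp (-‖ξ‖ ^ 2) ^ β = Real.exp (-β * ‖ξ‖ ^ 2) := by
    rw [← Real.exp_mul]
    congr 1
    ring
  rw [h3] at h2
  refine (h1.mul h2).congr' ?_
  filter_upwards [eventually_gt_atTop ‖ξ‖] with r hr
  have hr0 : 0 < r := (norm_nonneg ξ).trans_lt hr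
  rw [scaleDensity_bergman hr0 hr, mul_comm β, Real.rpow_mul]
  · congr 3
    ring
  · rw [sub_nonneg, div_le_one (by positivity)]
    gcongr

/-- From `1 - x ≤ exp (-x)` and `β + r⁻² ≤ β + 1`; the factor `(β + 1) / β` replaces the `β` in the
Gaussian density. -/
lemma scaleDensity_bergman_le {β : ℝ} (hβ : 0 < β) {r : ℝ} (hr : 1 ≤ r) (ξ : ℂ) :
    scaleDensity (bergmanDensity (β * r ^ 2)) r ξ ≤ (β + 1) / β * fockDensity β ξ := by
  have hr0 : 0 < r := by linarith
  have hpos : 0 ≤ (β + 1) / β * fockDensity β ξ :=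
    mul_nonneg (by positivity) (fockDensity_pos hβ ξ).le
  by_cases h : ‖ξ‖ < r
  · rw [scaleDensity_bergman hr0 h]
    have h1 : 0 < 1 - ‖ξ‖ ^ 2 / r ^ 2 := by
      rw [sub_pos, div_lt_one (by positivity)]
      gcongr
    have h2 : (1 - ‖ξ‖ ^ 2 / r ^ 2) ^ (β * r ^ 2) ≤ Real.exp (-β * ‖ξ‖ ^ 2) := by
      calc (1 - ‖ξ‖ ^ 2 / r ^ 2) ^ (β * r ^ 2) ≤
          Real.exp (-(‖ξ‖ ^ 2 / r ^ 2)) ^ (β * r ^ 2) := by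
            refine Real.rpow_le_rpow h1.le ?_ (by positivity)
            have := Real.add_one_le_exp (-(‖ξ‖ ^ 2 / r ^ 2))
            linarith
        _ = _ := by
          rw [← Real.exp_mul]
          congr 1
          field_simp
    have h3 : (r ^ 2)⁻¹ ≤ 1 := inv_le_one_of_one_le₀ (by nlinarith)
    have h4 : (β + 1) / β * fockDensity β ξ =
        (β + 1) / Real.pi * Real.exp (-β * ‖ξ‖ ^ 2) := by
      rw [fockDensity]
      have := Real.pi_pos
      field_simp
    rw [h4]
    have := Real.pi_pos
    gcongr
  · have : ¬ ‖(r : ℂ)⁻¹ * ξ‖ < 1 := by rwa [norm_inv_mul hr0, div_lt_one hr0]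
    rw [scaleDensity, bergmanDensity, if_neg this, mul_zero]
    exact hpos

lemma tendsto_scaleDensity_mobius (β : ℝ) (w : ℂ) :
    Tendsto (fun r : ℝ => (β * r ^ 2 + 1) * scaleDensity mobiusDensity r w) atTop
      (nhds (β / Real.pi)) := by
  have h1 : Tendsto (fun r : ℝ => (β + (r ^ 2)⁻¹) *
      (Real.pi * (1 - ‖w‖ ^ 2 * (r ^ 2)⁻¹) ^ 2)⁻¹) atTop
      (nhds ((β + 0) * (Real.pi * (1 - ‖w‖ ^ 2 * 0) ^ 2)⁻¹)) := by
    refine (tendsto_inv_sq_atTop.const_add β).mul (Tendsto.inv₀ ?_ ?_)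
    · exact (((tendsto_inv_sq_atTop.const_mul _).const_sub 1).pow 2).const_mul _
    · have := Real.pi_pos
      simp [this.ne']
  have h2 : (β + 0) * (Real.pi * (1 - ‖w‖ ^ 2 * 0) ^ 2)⁻¹ = β / Real.pi := by
    simp [div_eq_mul_inv]
  rw [h2] at h1
  refine h1.congr' ?_
  filter_upwards [eventually_gt_atTop ‖w‖] with r hr
  have hr0 : 0 < r := (norm_nonneg w).trans_lt hr
  rw [scaleDensity, mobiusDensity, if_pos (norm_inv_mul_lt_one hr0 hr), norm_inv_mul hr0, div_pow,
    div_eq_mul_inv (‖w‖ ^ 2), ← mul_assoc (β * r ^ 2 + 1)]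
  congr 1
  field_simp

section

variable {β : ℝ} {hβ : 0 < β}

lemma dilate_apply (g : FockSpace β hβ) {r : ℝ} (hr : 0 < r) {ξ : ℂ} (h : ‖ξ‖ < r) :
    (dilate r g : ℂ → ℂ) ((r : ℂ)⁻¹ * ξ) = g ξ := by
  have hr' : (r : ℂ) ≠ 0 := Complex.ofReal_ne_zero.2 hr.ne'
  have h1 : (dilate r g : ℂ → ℂ) ((r : ℂ)⁻¹ * ξ) =
      (ball 0 1).indicator (fun z : ℂ => g (r * z)) ((r : ℂ)⁻¹ * ξ) := rfl
  rw [h1, indicator_of_mem (mem_ball_zero_iff.2 (norm_inv_mul_lt_one hr h)), ← mul_assoc,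
    mul_inv_cancel₀ hr', one_mul]

/-- With `ε = r⁻²` the base is `X ε`, where `X 0 = 1`, and the exponent is `1 + (β/2) / ε`. The
limit is therefore the exponential of `β/2` times the derivative of `log X` at `0`. -/
lemma tendsto_mobiusFactor (β : ℝ) (w ξ : ℂ) :
    Tendsto (fun r : ℝ => ((1 - (‖(r : ℂ)⁻¹ * w‖ : ℂ) ^ 2) /
      (1 - conj ((r : ℂ)⁻¹ * w) * ((r : ℂ)⁻¹ * ξ)) ^ 2) ^ ((2 + ((β * r ^ 2 : ℝ) : ℂ)) / 2)) atTop
      (nhds (Complex.exp (β * conj w * ξ - β * (‖w‖ : ℂ) ^ 2 / 2))) := by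
  set X : ℝ → ℂ := fun ε => (1 - ε * (‖w‖ : ℂ) ^ 2) / (1 - ε * (conj w * ξ)) ^ 2 with hX
  have hX0 : X 0 = 1 := by simp [hX]
  have hXd : HasDerivAt X (2 * (conj w * ξ) - (‖w‖ : ℂ) ^ 2) 0 := by
    have hid : HasDerivAt (fun ε : ℝ => (ε : ℂ)) 1 0 := Complex.ofRealCLM.hasDerivAt
    have h1 : HasDerivAt (fun ε : ℝ => 1 - ε * (‖w‖ : ℂ) ^ 2) (-(1 * (‖w‖ : ℂ) ^ 2)) 0 :=
      (hid.mul_const _).const_sub 1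
    have h2 : HasDerivAt (fun ε : ℝ => 1 - ε * (conj w * ξ)) (-(1 * (conj w * ξ))) 0 :=
      (hid.mul_const _).const_sub 1
    have h3 := h1.div (h2.pow 2) (by simp)
    convert! h3 using 1
    simp
    ring
  have hlog : HasDerivAt (fun ε => Complex.log (X ε))
      (2 * (conj w * ξ) - (‖w‖ : ℂ) ^ 2) 0 := by
    have := hXd.clog_real (by rw [hX0]; exact Complex.one_mem_slitPlane)
    rwa [hX0, div_one] at this
  have hε : Tendsto (fun r : ℝ => (r ^ 2)⁻¹) atTop (nhdsWithin 0 (Ioi 0)) := by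
    refine tendsto_nhdsWithin_iff.2 ⟨tendsto_inv_sq_atTop, ?_⟩
    filter_upwards [eventually_gt_atTop 0] with r hr
    have : 0 < (r ^ 2)⁻¹ := by positivity
    exact this
  have hslope := hlog.tendsto_slope_zero_right.comp hε
  have hcont := (hlog.continuousAt.tendsto.mono_left nhdsWithin_le_nhds).comp hε
  have hlim := hcont.add (hslope.const_mul ((β : ℂ) / 2))
  have hlim2 := (Complex.continuous_exp.tendsto _).comp hlim
  have hval : Complex.log (X 0) + (β : ℂ) / 2 * (2 * (conj w * ξ) - (‖w‖ : ℂ) ^ 2) =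
      β * conj w * ξ - β * (‖w‖ : ℂ) ^ 2 / 2 := by
    rw [hX0, Complex.log_one]
    ring
  rw [hval] at hlim2
  refine hlim2.congr' ?_
  have hXne : ∀ᶠ r : ℝ in atTop, X (r ^ 2)⁻¹ ≠ 0 :=
    (((hXd.continuousAt.tendsto.mono_left nhdsWithin_le_nhds).comp hε).eventually_ne
      (by rw [hX0]; exact one_ne_zero))
  filter_upwards [hXne, eventually_gt_atTop 0] with r hr hr0
  have hr' : (r : ℂ) ≠ 0 := Complex.ofReal_ne_zero.2 hr0.ne'
  have hbase : (1 - (‖(r : ℂ)⁻¹ * w‖ : ℂ) ^ 2) /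
      (1 - conj ((r : ℂ)⁻¹ * w) * ((r : ℂ)⁻¹ * ξ)) ^ 2 = X (r ^ 2)⁻¹ := by
    rw [norm_inv_mul hr0, hX]
    simp only [map_mul, map_inv₀, Complex.conj_ofReal]
    push_cast
    congr 2
    · ring
    · ring
  rw [hbase, Complex.cpow_def_of_ne_zero hr]
  simp only [Function.comp_apply, zero_add, hX0, Complex.log_one, sub_zero, inv_inv,
    Complex.real_smul]
  congr 1
  push_cast
  ring

/-- After rescaling, the argument of the window is `t (ξ - w) / (1 - r⁻² conj w ξ)`, which tends to
the translate `t (ξ - w)`. -/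
lemma tendsto_mobiusFamily_dilate (φ : FockSpace β hβ) (t : Circle) (w ξ : ℂ) :
    Tendsto (fun r : ℝ => mobiusFamily (β * r ^ 2) (dilate r φ) (t, (r : ℂ)⁻¹ * w)
      ((r : ℂ)⁻¹ * ξ)) atTop (nhds (weyl β w (rotate t φ) ξ)) := by
  have hφ : Continuous (φ : ℂ → ℂ) := (differentiableOn_univ.1 φ.2.1).continuous
  have hε : Tendsto (fun r : ℝ => (((r ^ 2)⁻¹ : ℝ) : ℂ)) atTop (nhds 0) := by
    have h := (Complex.continuous_ofReal.tendsto 0).comp tendsto_inv_sq_atTop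
    rwa [Complex.ofReal_zero] at h
  have h1 : Tendsto (fun r : ℝ => (t : ℂ) * ((ξ - w) / (1 - (((r ^ 2)⁻¹ : ℝ) : ℂ) * (conj w * ξ))))
      atTop (nhds (t * (ξ - w))) := by
    have h2 : Tendsto (fun r : ℝ => (t : ℂ) * ((ξ - w) /
        (1 - (((r ^ 2)⁻¹ : ℝ) : ℂ) * (conj w * ξ))))
        atTop (nhds (t * ((ξ - w) / (1 - 0 * (conj w * ξ))))) :=
      (Tendsto.div tendsto_const_nhds ((hε.mul_const _).const_sub 1) (by simp)).const_mul _
    simpa using h2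
  have h3 := ((hφ.tendsto _).comp h1).mul (tendsto_mobiusFactor β w ξ)
  refine h3.congr' ?_
  filter_upwards [eventually_gt_atTop ‖w‖, eventually_gt_atTop ‖ξ‖] with r hw hξ
  have hr0 : 0 < r := (norm_nonneg w).trans_lt hw
  have hr' : (r : ℂ) ≠ 0 := Complex.ofReal_ne_zero.2 hr0.ne'
  have hw1 := norm_inv_mul_lt_one hr0 hw
  have hξ1 := norm_inv_mul_lt_one hr0 hξ
  have hm : ‖(t : ℂ) * (((r : ℂ)⁻¹ * ξ - (r : ℂ)⁻¹ * w) /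
      (1 - conj ((r : ℂ)⁻¹ * w) * ((r : ℂ)⁻¹ * ξ)))‖ < 1 := by
    have h4 := norm_discInvolution_lt_one hw1 hξ1
    rw [discInvolution, norm_div, norm_sub_rev, ← norm_div] at h4
    rw [norm_mul, Circle.norm_coe, one_mul]
    exact h4
  have hpt : (r : ℂ) * ((t : ℂ) * (((r : ℂ)⁻¹ * ξ - (r : ℂ)⁻¹ * w) /
      (1 - conj ((r : ℂ)⁻¹ * w) * ((r : ℂ)⁻¹ * ξ)))) =
      (t : ℂ) * ((ξ - w) / (1 - (((r ^ 2)⁻¹ : ℝ) : ℂ) * (conj w * ξ))) := by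
    have h5 : conj ((r : ℂ)⁻¹ * w) * ((r : ℂ)⁻¹ * ξ) =
        (((r ^ 2)⁻¹ : ℝ) : ℂ) * (conj w * ξ) := by
      rw [map_mul, map_inv₀, Complex.conj_ofReal]
      push_cast
      ring
    rw [h5, ← mul_sub, mul_div_assoc, mul_left_comm, ← mul_assoc (r : ℂ), mul_inv_cancel₀ hr',
      one_mul]
  have hd : rotate t (dilate r φ) (((r : ℂ)⁻¹ * ξ - (r : ℂ)⁻¹ * w) /
      (1 - conj ((r : ℂ)⁻¹ * w) * ((r : ℂ)⁻¹ * ξ))) =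
      φ ((t : ℂ) * ((ξ - w) / (1 - (((r ^ 2)⁻¹ : ℝ) : ℂ) * (conj w * ξ)))) := by
    rw [← hpt]
    exact indicator_of_mem (mem_ball_zero_iff.2 hm) fun z : ℂ => φ (r * z)
  rw [mobiusFamily, if_pos ⟨hw1, hξ1⟩, mobiusShift, hd]
  rfl

end

/-! ### Limits of norms and transforms -/

lemma mul_le_sq_add_sq_ennreal (a b : ℝ≥0∞) : a * b ≤ a ^ 2 + b ^ 2 := by
  rcases le_total a b with h | h
  · calc a * b ≤ b * b := by gcongr
      _ = b ^ 2 := (sq b).symm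
      _ ≤ a ^ 2 + b ^ 2 := le_add_self
  · calc a * b ≤ a * a := by gcongr
      _ = a ^ 2 := (sq a).symm
      _ ≤ a ^ 2 + b ^ 2 := le_self_add

lemma enorm_ofReal_of_nonneg {x : ℝ} (hx : 0 ≤ x) : ‖(x : ℂ)‖ₑ = ENNReal.ofReal x := by
  rw [← ofReal_norm, Complex.norm_real, Real.norm_of_nonneg hx]

lemma enorm_weight_mul_le {x : ℝ} (hx : 0 ≤ x) (a b : ℂ) :
    ‖(x : ℂ) * (a * conj b)‖ₑ ≤ ENNReal.ofReal x * (‖a‖ₑ ^ 2 + ‖b‖ₑ ^ 2) := by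
  rw [enorm_mul, enorm_mul, enorm_ofReal_of_nonneg hx, RCLike.enorm_conj]
  gcongr
  exact mul_le_sq_add_sq_ennreal _ _

section

variable {β : ℝ} {hβ : 0 < β}

lemma fock_measurable (g : FockSpace β hβ) : Measurable (g : ℂ → ℂ) :=
  (isRadial_fock hβ).measurable_of_mem g.2.1 g.2.2.1

lemma enorm_dilate_le (g : FockSpace β hβ) {r : ℝ} (hr : 0 < r) (ξ : ℂ) :
    ‖(dilate r g : ℂ → ℂ) ((r : ℂ)⁻¹ * ξ)‖ₑ ≤ ‖g ξ‖ₑ := by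
  by_cases h : ‖ξ‖ < r
  · rw [dilate_apply g hr h]
  · have h1 : ¬ ‖(r : ℂ)⁻¹ * ξ‖ < 1 := by rwa [norm_inv_mul hr, div_lt_one hr]
    have h2 : (dilate r g : ℂ → ℂ) ((r : ℂ)⁻¹ * ξ) = 0 :=
      (dilate r g).2.2.1 _ fun h3 => h1 (mem_ball_zero_iff.1 h3)
    rw [h2, enorm_zero]
    exact zero_le

lemma measurable_bergman_scale {α : ℝ} {hα : -1 < α} (g : BergmanSpace α hα) (r : ℝ) :
    Measurable fun ξ : ℂ => g ((r : ℂ)⁻¹ * ξ) :=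
  (bergman_measurable g).comp (by fun_prop)

lemma lintegral_bergman_scale (α : ℝ) {r : ℝ} (hr : 0 < r) {h : ℂ → ℝ≥0∞} (hh : Measurable h) :
    ∫⁻ z, h z ∂bergmanMeasure α =
      ∫⁻ ξ, ENNReal.ofReal (scaleDensity (bergmanDensity α) r ξ) * h ((r : ℂ)⁻¹ * ξ) := by
  rw [bergmanMeasure_eq, lintegral_scale (measurable_bergmanDensity _) hr hh]

lemma integral_bergman_scale {α : ℝ} (hα : -1 < α) {r : ℝ} (hr : 0 < r) (h : ℂ → ℂ) :
    ∫ z, h z ∂bergmanMeasure α =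
      ∫ ξ, (scaleDensity (bergmanDensity α) r ξ : ℂ) * h ((r : ℂ)⁻¹ * ξ) := by
  rw [bergmanMeasure_eq,
    integral_scale (measurable_bergmanDensity _) (bergmanDensity_nonneg hα) hr]

lemma bergman_enorm_sq_scale {α : ℝ} {hα : -1 < α} (g : BergmanSpace α hα) {r : ℝ} (hr : 0 < r) :
    ‖g‖ₑ ^ 2 = ∫⁻ ξ, ENNReal.ofReal (scaleDensity (bergmanDensity α) r ξ) *
      ‖g ((r : ℂ)⁻¹ * ξ)‖ₑ ^ 2 := by
  rw [bergman_enorm_sq, lintegral_bergman_scale α hr ((bergman_measurable g).enorm.pow_const 2)]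

lemma tendsto_dilate (g : FockSpace β hβ) (ξ : ℂ) :
    Tendsto (fun r : ℝ => (dilate r g : ℂ → ℂ) ((r : ℂ)⁻¹ * ξ)) atTop (nhds (g ξ)) := by
  refine tendsto_const_nhds.congr' ?_
  filter_upwards [eventually_gt_atTop ‖ξ‖] with r hr
  exact (dilate_apply g ((norm_nonneg ξ).trans_lt hr) hr).symm

/-- Ordinary dominated convergence: the Gaussian bound on the densities gives a fixed majorant here.
-/
lemma tendsto_enorm_sq_dilate (g : FockSpace β hβ) :
    Tendsto (fun r : ℝ => ‖dilate r g‖ₑ ^ 2) atTop (nhds (‖g‖ₑ ^ 2)) := by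
  have hgm := (fock_measurable g).enorm.pow_const 2
  have hc : 0 < (β + 1) / β := by positivity
  rw [fock_enorm_sq, lintegral_fock hgm]
  have hfin : ∫⁻ ξ, ENNReal.ofReal ((β + 1) / β) *
      (ENNReal.ofReal (fockDensity β ξ) * ‖g ξ‖ₑ ^ 2) ≠ ∞ := by
    rw [lintegral_const_mul' _ _ ENNReal.ofReal_ne_top, ← lintegral_fock hgm, ← fock_enorm_sq]
    exact ENNReal.mul_ne_top ENNReal.ofReal_ne_top (ENNReal.pow_ne_top enorm_ne_top)
  have key := tendsto_lintegral_filter_of_dominated_convergence (μ := volume) (l := atTop)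
    (F := fun (r : ℝ) ξ => ENNReal.ofReal (scaleDensity (bergmanDensity (β * r ^ 2)) r ξ) *
      ‖(dilate r g : ℂ → ℂ) ((r : ℂ)⁻¹ * ξ)‖ₑ ^ 2)
    (f := fun ξ => ENNReal.ofReal (fockDensity β ξ) * ‖g ξ‖ₑ ^ 2) _
    (Eventually.of_forall fun r => (measurable_scaleDensity
      (measurable_bergmanDensity _) r).ennreal_ofReal.mul
      ((measurable_bergman_scale (dilate r g) r).enorm.pow_const 2)) ?_ hfin
    (Eventually.of_forall fun ξ => ENNReal.Tendsto.mul
      (ENNReal.tendsto_ofReal (tendsto_scaleDensity_bergman β ξ)) (Or.inr (by finiteness))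
      (ENNReal.Tendsto.pow (tendsto_dilate g ξ).enorm) (Or.inr ENNReal.ofReal_ne_top))
  · refine key.congr' ?_
    filter_upwards [eventually_gt_atTop 0] with r hr
    exact (bergman_enorm_sq_scale (dilate r g) hr).symm
  · filter_upwards [eventually_ge_atTop 1] with r hr
    refine Eventually.of_forall fun ξ => ?_
    rw [← mul_assoc, ← ENNReal.ofReal_mul hc.le]
    gcongr
    · exact scaleDensity_bergman_le hβ hr ξ
    · exact enorm_dilate_le g (by linarith) ξ

lemma tendsto_norm_dilate (g : FockSpace β hβ) :
    Tendsto (fun r : ℝ => ‖dilate r g‖) atTop (nhds ‖g‖) := by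
  have h1 := (ENNReal.tendsto_toReal (by finiteness)).comp (tendsto_enorm_sq_dilate g)
  have h2 := h1.sqrt
  simpa [Function.comp_def, ENNReal.toReal_pow, Real.sqrt_sq] using h2

/-- The rescaled Bergman transforms converge pointwise to the Fock transform. -/
lemma tendsto_bergmanTransform_dilate (φ g : FockSpace β hβ) (t : Circle) (w : ℂ) {u : ℕ → ℝ}
    (hu0 : ∀ n, 0 < u n) (hu : Tendsto u atTop atTop) :
    Tendsto (fun n => bergmanTransform (dilate (u n) φ) (dilate (u n) g)
      (t, (u n : ℂ)⁻¹ * w)) atTop (nhds (fockTransform φ g (t, w))) := by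
  have hα : ∀ r : ℝ, -1 < β * r ^ 2 := neg_one_lt_mul_sq hβ
  set G : ℝ → ℂ → ℂ := fun r ξ => (dilate r g : ℂ → ℂ) ((r : ℂ)⁻¹ * ξ)
  set V : ℝ → ℂ → ℂ := fun r ξ =>
    mobiusFamily (β * r ^ 2) (dilate r φ) (t, (r : ℂ)⁻¹ * w) ((r : ℂ)⁻¹ * ξ)
  set ρ : ℝ → ℂ → ℝ := fun r => scaleDensity (bergmanDensity (β * r ^ 2)) r
  have hρ0 : ∀ r ξ, 0 ≤ ρ r ξ := fun r ξ => scaleDensity_nonneg (bergmanDensity_nonneg (hα r)) r ξ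
  have hρm : ∀ r, Measurable (ρ r) := fun r =>
    measurable_scaleDensity (measurable_bergmanDensity _) r
  have hGm : ∀ r, Measurable (G r) := fun r => measurable_bergman_scale _ _
  have hM : ∀ r : ℝ, Measurable (mobiusFamily (β * r ^ 2) (dilate r φ) (t, (r : ℂ)⁻¹ * w)) :=
    fun r => (measurable_mobiusFamily _ (bergman_measurable (dilate r φ))).comp
      (measurable_prodMk_left (x := (t, (r : ℂ)⁻¹ * w)))
  have hVm : ∀ r, Measurable (V r) := fun r => (hM r).comp (by fun_prop)
  have hgm := fock_measurable g
  have hwm : Measurable (weyl β w (rotate t φ)) :=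
    (measurable_weyl (β := β) (fock_measurable φ)).comp (measurable_prodMk_left (x := (t, w)))
  have hD : ∫⁻ ξ, ENNReal.ofReal (fockDensity β ξ) *
      (‖g ξ‖ₑ ^ 2 + ‖weyl β w (rotate t φ) ξ‖ₑ ^ 2) = ‖g‖ₑ ^ 2 + ‖φ‖ₑ ^ 2 := by
    rw [← lintegral_fock (by fun_prop), lintegral_add_left (by fun_prop),
      lintegral_weyl hβ t w (fock_measurable φ), fock_enorm_sq, fock_enorm_sq]
  -- The majorants vary with `r` through the shifted window, but the shift is isometric, so their
  -- integrals are sums of squared norms of dilates and converge as Pratt's lemma requires.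
  have hB : ∀ r : ℝ, ‖w‖ < r → ∫⁻ ξ, ENNReal.ofReal (ρ r ξ) *
      (‖G r ξ‖ₑ ^ 2 + ‖V r ξ‖ₑ ^ 2) = ‖dilate r g‖ₑ ^ 2 + ‖dilate r φ‖ₑ ^ 2 := fun r hr => by
    have hr0 : 0 < r := (norm_nonneg w).trans_lt hr
    rw [bergman_enorm_sq (dilate r φ), ← lintegral_mobiusFamily (hα r) t
      (norm_inv_mul_lt_one hr0 hr) (bergman_measurable (dilate r φ)), bergman_enorm_sq_scale _ hr0,
      lintegral_bergman_scale _ hr0 ((hM r).enorm.pow_const 2), ← lintegral_add_left]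
    · simp only [mul_add]
      rfl
    · exact (hρm r).ennreal_ofReal.mul ((hGm r).enorm.pow_const 2)
  have h1 : ∀ n, bergmanTransform (dilate (u n) φ) (dilate (u n) g) (t, (u n : ℂ)⁻¹ * w) =
      ∫ ξ, (ρ (u n) ξ : ℂ) * (G (u n) ξ * conj (V (u n) ξ)) := fun n => by
    have h2 : bergmanTransform (dilate (u n) φ) (dilate (u n) g) (t, (u n : ℂ)⁻¹ * w) =
        ∫ ζ, (dilate (u n) g : ℂ → ℂ) ζ * conj (mobiusFamily (β * u n ^ 2) (dilate (u n) φ)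
          (t, (u n : ℂ)⁻¹ * w) ζ) ∂bergmanMeasure (β * u n ^ 2) := rfl
    rw [h2, integral_bergman_scale (hα _) (hu0 n)]
  have h3 : fockTransform φ g (t, w) =
      ∫ ξ, (fockDensity β ξ : ℂ) * (g ξ * conj (weyl β w (rotate t φ) ξ)) :=
    integral_fock hβ _
  simp only [h1]
  rw [h3]
  have hV : ∀ ξ, Tendsto (fun n => V (u n) ξ) atTop (nhds (weyl β w (rotate t φ) ξ)) := fun ξ =>
    (tendsto_mobiusFamily_dilate φ t w ξ).comp hu
  have hG : ∀ ξ, Tendsto (fun n => G (u n) ξ) atTop (nhds (g ξ)) := fun ξ =>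
    (tendsto_dilate g ξ).comp hu
  have hρ : ∀ ξ, Tendsto (fun n => ρ (u n) ξ) atTop (nhds (fockDensity β ξ)) := fun ξ =>
    (tendsto_scaleDensity_bergman β ξ).comp hu
  refine tendsto_integral_of_dominated_tendsto
    (B := fun n ξ => ENNReal.ofReal (ρ (u n) ξ) * (‖G (u n) ξ‖ₑ ^ 2 + ‖V (u n) ξ‖ₑ ^ 2))
    (D := fun ξ => ENNReal.ofReal (fockDensity β ξ) *
      (‖g ξ‖ₑ ^ 2 + ‖weyl β w (rotate t φ) ξ‖ₑ ^ 2))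
    (fun n => ?_) (fun n => ?_) (fun n => ?_) ?_ ?_ ?_ ?_
  · exact ((Complex.measurable_ofReal.comp (hρm _)).mul ((hGm _).mul
      (Complex.continuous_conj.measurable.comp (hVm _)))).aestronglyMeasurable
  · exact ((hρm _).ennreal_ofReal.mul (((hGm _).enorm.pow_const 2).add
      ((hVm _).enorm.pow_const 2))).aemeasurable
  · exact Eventually.of_forall fun ξ => enorm_weight_mul_le (hρ0 _ ξ) _ _
  · exact Eventually.of_forall fun ξ => ((Complex.continuous_ofReal.tendsto _).comp (hρ ξ)).mul
      ((hG ξ).mul ((Complex.continuous_conj.tendsto _).comp (hV ξ)))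
  · exact Eventually.of_forall fun ξ => ENNReal.Tendsto.mul (ENNReal.tendsto_ofReal (hρ ξ))
      (Or.inr (by finiteness)) ((ENNReal.Tendsto.pow (hG ξ).enorm).add (ENNReal.Tendsto.pow (hV ξ).enorm))
      (Or.inr ENNReal.ofReal_ne_top)
  · rw [hD]
    refine (((tendsto_enorm_sq_dilate g).add (tendsto_enorm_sq_dilate φ)).comp hu).congr' ?_
    filter_upwards [hu.eventually_gt_atTop ‖w‖] with n hn
    exact (hB _ hn).symm
  · rw [hD]
    finiteness

end

/-! ### Limits of localization operators -/

section

variable {β : ℝ} {hβ : 0 < β}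

lemma dilateSymbol_inv_mul {r : ℝ} (hr : 0 < r) (σ : ℝ) (f : Circle × ℂ → ℂ) (p : Circle × ℂ) :
    dilateSymbol r σ f (p.1, (r : ℂ)⁻¹ * p.2) =
      (((1 - ‖(r : ℂ)⁻¹ * p.2‖ ^ 2) ^ σ : ℝ) : ℂ) * f p := by
  rw [dilateSymbol, ← mul_assoc (r : ℂ), mul_inv_cancel₀ (Complex.ofReal_ne_zero.2 hr.ne'),
    one_mul]

lemma tendsto_dilateSymbol (σ : ℝ) (w : ℂ) :
    Tendsto (fun r : ℝ => (1 - ‖(r : ℂ)⁻¹ * w‖ ^ 2) ^ σ) atTop (nhds 1) := by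
  have h1 : Tendsto (fun r : ℝ => 1 - ‖w‖ ^ 2 * (r ^ 2)⁻¹) atTop (nhds 1) := by
    simpa using (tendsto_inv_sq_atTop.const_mul (‖w‖ ^ 2)).const_sub 1
  have h2 := h1.rpow_const (p := σ) (Or.inl one_ne_zero)
  rw [Real.one_rpow] at h2
  refine h2.congr' ?_
  filter_upwards [eventually_gt_atTop 0] with r hr
  rw [norm_inv_mul hr, div_pow, div_eq_mul_inv]

/-- The density that the rescaled Möbius measure, times `β r² + 1`, has with respect to the area
measure. -/
def mobiusWeight (β r : ℝ) (w : ℂ) : ℝ := (β * r ^ 2 + 1) * scaleDensity mobiusDensity r w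

lemma mobiusWeight_nonneg (hβ : 0 < β) (r : ℝ) (w : ℂ) : 0 ≤ mobiusWeight β r w :=
  mul_nonneg (by positivity) (scaleDensity_nonneg mobiusDensity_nonneg r w)

lemma measurable_mobiusWeight (β r : ℝ) : Measurable (mobiusWeight β r) :=
  (measurable_scaleDensity measurable_mobiusDensity r).const_mul _

lemma mobiusWeight_eq_zero (β : ℝ) {r : ℝ} (hr : 0 < r) {w : ℂ} (h : ¬ ‖w‖ < r) :
    mobiusWeight β r w = 0 := by
  have h1 : ¬ ‖(r : ℂ)⁻¹ * w‖ < 1 := by rwa [norm_inv_mul hr, div_lt_one hr]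
  rw [mobiusWeight, scaleDensity, mobiusDensity, if_neg h1, mul_zero, mul_zero]

lemma measurable_bergmanTransform_scale {α : ℝ} {hα : -1 < α} (φ g : BergmanSpace α hα) (r : ℝ) :
    Measurable fun p : Circle × ℂ => bergmanTransform φ g (p.1, (r : ℂ)⁻¹ * p.2) :=
  (measurable_bergmanTransform φ g).comp (by fun_prop)

/-- The orthogonality relation in the variable `ξ`; the factor `α + 1 = β r² + 1` in the weight
cancels its constant. -/
lemma lintegral_mobiusWeight (φ g : FockSpace β hβ) {r : ℝ} (hr : 0 < r) :
    ∫⁻ p : Circle × ℂ, ENNReal.ofReal (mobiusWeight β r p.2) *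
        ‖bergmanTransform (dilate r φ) (dilate r g) (p.1, (r : ℂ)⁻¹ * p.2)‖ₑ ^ 2
        ∂circleMeasure.prod volume = ‖dilate r φ‖ₑ ^ 2 * ‖dilate r g‖ₑ ^ 2 := by
  have hc : 0 < β * r ^ 2 + 1 := by positivity
  have h := lintegral_bergmanTransform (dilate r φ) (dilate r g)
  rw [mobiusMeasure_eq, lintegral_prod_scale measurable_mobiusDensity hr
    ((measurable_bergmanTransform _ _).enorm.pow_const 2)] at h
  simp only [mobiusWeight, ENNReal.ofReal_mul hc.le, mul_assoc]
  rw [lintegral_const_mul' _ _ ENNReal.ofReal_ne_top, h, mul_assoc, ← mul_assoc,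
    ← ENNReal.ofReal_mul hc.le, mul_inv_cancel₀ hc.ne', ENNReal.ofReal_one, one_mul]

lemma inner_eq_of_isBergmanLocalization (φ ψ g h : FockSpace β hβ) {r : ℝ} (hr : 0 < r) (σ : ℝ)
    (f : Circle × ℂ → ℂ)
    {T : BergmanSpace (β * r ^ 2) (neg_one_lt_mul_sq hβ r) →L[ℂ]
      BergmanSpace (β * r ^ 2) (neg_one_lt_mul_sq hβ r)}
    (hT : IsBergmanLocalization (dilate r φ) (dilate r ψ) (dilateSymbol r σ f) T) :
    inner ℂ (dilate r h) (T (dilate r g)) = ∫ p : Circle × ℂ,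
      (((1 - ‖(r : ℂ)⁻¹ * p.2‖ ^ 2) ^ σ : ℝ) : ℂ) * f p * ((mobiusWeight β r p.2 : ℂ) *
        (bergmanTransform (dilate r φ) (dilate r g) (p.1, (r : ℂ)⁻¹ * p.2) *
        conj (bergmanTransform (dilate r ψ) (dilate r h) (p.1, (r : ℂ)⁻¹ * p.2))))
      ∂circleMeasure.prod volume := by
  obtain ⟨hi, he⟩ := hT (dilate r g) (dilate r h)
  refine he.trans ?_
  rw [← integral_prod _ hi]
  have h1 : ∫ p, bergmanIntegrand (dilate r φ) (dilate r ψ) (dilateSymbol r σ f) (dilate r g)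
      (dilate r h) p.1 p.2 ∂circleMeasure.prod mobiusMeasure =
      ∫ p, dilateSymbol r σ f p * bergmanTransform (dilate r φ) (dilate r g) p *
        conj (bergmanTransform (dilate r ψ) (dilate r h) p)
        ∂circleMeasure.prod mobiusMeasure := by
    refine integral_congr_ae ?_
    filter_upwards [ae_prod_mobius] with p hp
    exact bergmanIntegrand_eq _ _ _ _ _ p.1 hp
  rw [h1, mobiusMeasure_eq, integral_prod_scale measurable_mobiusDensity mobiusDensity_nonneg hr,
    ← integral_const_mul]
  congr 1
  ext p
  rw [dilateSymbol_inv_mul hr, mobiusWeight]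
  push_cast
  ring

lemma inner_eq_of_isFockLocalization (φ ψ g h : FockSpace β hβ) (f : Circle × ℂ → ℂ)
    {T : FockSpace β hβ →L[ℂ] FockSpace β hβ} (hT : IsFockLocalization φ ψ f T) :
    inner ℂ h (T g) = ∫ p : Circle × ℂ, f p * (((β / Real.pi : ℝ) : ℂ) *
        (fockTransform φ g p * conj (fockTransform ψ h p))) ∂circleMeasure.prod volume := by
  obtain ⟨hi, he⟩ := hT g h
  refine he.trans ?_
  rw [← integral_prod _ hi, ← integral_const_mul]
  congr 1
  ext p
  rw [fockIntegrand_eq]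
  push_cast
  ring

/-- The sesquilinear forms of the rescaled Bergman localization operators converge to that of the
Fock localization operator. -/
theorem tendsto_inner_localization (φ ψ g h : FockSpace β hβ) {f : Circle × ℂ → ℂ}
    (hf : MemLp f ∞ (circleMeasure.prod (volume : Measure ℂ))) {σ : ℝ} (hσ : 0 ≤ σ) {u : ℕ → ℝ}
    (hu0 : ∀ n, 0 < u n) (hu : Tendsto u atTop atTop)
    {T : FockSpace β hβ →L[ℂ] FockSpace β hβ} (hT : IsFockLocalization φ ψ f T)
    {S : ∀ r : ℝ, BergmanSpace (β * r ^ 2) (neg_one_lt_mul_sq hβ r) →L[ℂ]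
      BergmanSpace (β * r ^ 2) (neg_one_lt_mul_sq hβ r)}
    (hS : ∀ r : ℝ, 0 < r →
      IsBergmanLocalization (dilate r φ) (dilate r ψ) (dilateSymbol r σ f) (S r)) :
    Tendsto (fun n => inner ℂ (dilate (u n) h) (S (u n) (dilate (u n) g))) atTop
      (nhds (inner ℂ h (T g))) := by
  set M := eLpNorm f ∞ (circleMeasure.prod (volume : Measure ℂ))
  have hM : M ≠ ∞ := hf.2.ne
  set X : ℝ → Circle × ℂ → ℂ := fun r p =>
    bergmanTransform (dilate r φ) (dilate r g) (p.1, (r : ℂ)⁻¹ * p.2)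
  set Y : ℝ → Circle × ℂ → ℂ := fun r p =>
    bergmanTransform (dilate r ψ) (dilate r h) (p.1, (r : ℂ)⁻¹ * p.2)
  have hXm : ∀ r, Measurable (X r) := fun r => measurable_bergmanTransform_scale _ _ r
  have hYm : ∀ r, Measurable (Y r) := fun r => measurable_bergmanTransform_scale _ _ r
  have hwm : ∀ r, Measurable fun p : Circle × ℂ => mobiusWeight β r p.2 := fun r =>
    (measurable_mobiusWeight β r).comp measurable_snd
  have hX : ∀ p, Tendsto (fun n => X (u n) p) atTop (nhds (fockTransform φ g p)) := fun p =>
    tendsto_bergmanTransform_dilate φ g p.1 p.2 hu0 hu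
  have hY : ∀ p, Tendsto (fun n => Y (u n) p) atTop (nhds (fockTransform ψ h p)) := fun p =>
    tendsto_bergmanTransform_dilate ψ h p.1 p.2 hu0 hu
  have hw : ∀ p : Circle × ℂ, Tendsto (fun n => mobiusWeight β (u n) p.2) atTop
      (nhds (β / Real.pi)) := fun p => (tendsto_scaleDensity_mobius β p.2).comp hu
  have hβπ : 0 < β / Real.pi := div_pos hβ Real.pi_pos
  have hF : ∀ φ g : FockSpace β hβ, ∫⁻ p, ENNReal.ofReal (β / Real.pi) *
      ‖fockTransform φ g p‖ₑ ^ 2 ∂circleMeasure.prod volume = ‖φ‖ₑ ^ 2 * ‖g‖ₑ ^ 2 := fun φ g => by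
    rw [lintegral_const_mul' _ _ ENNReal.ofReal_ne_top, lintegral_fockTransform, mul_assoc,
      ← mul_assoc, ← ENNReal.ofReal_mul hβπ.le, div_mul_div_cancel₀ Real.pi_pos.ne',
      div_self hβ.ne', ENNReal.ofReal_one, one_mul]
  have hD : ∫⁻ p, M * (ENNReal.ofReal (β / Real.pi) * (‖fockTransform φ g p‖ₑ ^ 2 +
      ‖fockTransform ψ h p‖ₑ ^ 2)) ∂circleMeasure.prod volume =
      M * (‖φ‖ₑ ^ 2 * ‖g‖ₑ ^ 2 + ‖ψ‖ₑ ^ 2 * ‖h‖ₑ ^ 2) := by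
    rw [lintegral_const_mul' _ _ hM]
    simp only [mul_add]
    rw [lintegral_add_left (((measurable_fockTransform φ g).enorm.pow_const 2).const_mul _),
      hF, hF, mul_add]
  have hB : ∀ r : ℝ, 0 < r → ∫⁻ p : Circle × ℂ, M * (ENNReal.ofReal (mobiusWeight β r p.2) *
      (‖X r p‖ₑ ^ 2 + ‖Y r p‖ₑ ^ 2)) ∂circleMeasure.prod volume =
      M * (‖dilate r φ‖ₑ ^ 2 * ‖dilate r g‖ₑ ^ 2 + ‖dilate r ψ‖ₑ ^ 2 * ‖dilate r h‖ₑ ^ 2) :=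
    fun r hr => by
      have hm : Measurable fun p : Circle × ℂ =>
          ENNReal.ofReal (mobiusWeight β r p.2) * ‖X r p‖ₑ ^ 2 :=
        (hwm r).ennreal_ofReal.mul ((hXm r).enorm.pow_const 2)
      rw [lintegral_const_mul' _ _ hM, ← lintegral_mobiusWeight φ g hr,
        ← lintegral_mobiusWeight ψ h hr]
      simp only [mul_add]
      rw [lintegral_add_left hm, mul_add]
  simp only [fun n => inner_eq_of_isBergmanLocalization φ ψ g h (hu0 n) σ f (hS _ (hu0 n))]
  rw [inner_eq_of_isFockLocalization φ ψ g h f hT]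
  refine tendsto_integral_of_dominated_tendsto
    (B := fun n p => M * (ENNReal.ofReal (mobiusWeight β (u n) p.2) *
      (‖X (u n) p‖ₑ ^ 2 + ‖Y (u n) p‖ₑ ^ 2)))
    (D := fun p => M * (ENNReal.ofReal (β / Real.pi) * (‖fockTransform φ g p‖ₑ ^ 2 +
      ‖fockTransform ψ h p‖ₑ ^ 2)))
    (fun n => ?_) (fun n => ?_) (fun n => ?_) ?_ ?_ ?_ ?_
  · have h1 : Measurable fun p : Circle × ℂ =>
        (((1 - ‖(u n : ℂ)⁻¹ * p.2‖ ^ 2) ^ σ : ℝ) : ℂ) := by fun_prop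
    exact (h1.aestronglyMeasurable.mul hf.1).mul
      ((Complex.measurable_ofReal.comp (hwm _)).mul ((hXm _).mul
        (Complex.continuous_conj.measurable.comp (hYm _)))).aestronglyMeasurable
  · exact (((hwm _).ennreal_ofReal.mul (((hXm _).enorm.pow_const 2).add
      ((hYm _).enorm.pow_const 2))).const_mul M).aemeasurable
  · have hb := ae_le_eLpNormEssSup (f := f) (μ := circleMeasure.prod volume)
    filter_upwards [hb] with p hp
    rw [← eLpNorm_exponent_top] at hp
    -- The bound `(1 - ‖z‖²) ^ σ ≤ 1` is available only inside the disc; outside, the weight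
    -- vanishes.
    by_cases hpr : ‖p.2‖ < u n
    · have h1 := one_sub_norm_sq_pos (norm_inv_mul_lt_one (hu0 n) hpr)
      have h2 : (1 - ‖(u n : ℂ)⁻¹ * p.2‖ ^ 2) ^ σ ≤ 1 :=
        Real.rpow_le_one h1.le (by nlinarith [norm_nonneg ((u n : ℂ)⁻¹ * p.2)]) hσ
      rw [enorm_mul, enorm_mul, enorm_ofReal_of_nonneg (by positivity)]
      gcongr
      · calc _ ≤ ENNReal.ofReal 1 * M := by gcongr
          _ = M := by rw [ENNReal.ofReal_one, one_mul]
      · exact enorm_weight_mul_le (mobiusWeight_nonneg hβ _ _) _ _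
    · rw [mobiusWeight_eq_zero β (hu0 n) hpr]
      simp
  · refine Eventually.of_forall fun p => ?_
    have h1 := ((Complex.continuous_ofReal.tendsto _).comp
      ((tendsto_dilateSymbol σ p.2).comp hu)).mul_const (f p)
    rw [Complex.ofReal_one, one_mul] at h1
    exact h1.mul (((Complex.continuous_ofReal.tendsto _).comp (hw p)).mul
      ((hX p).mul ((Complex.continuous_conj.tendsto _).comp (hY p))))
  · exact Eventually.of_forall fun p => ENNReal.Tendsto.const_mul
      (ENNReal.Tendsto.mul (ENNReal.tendsto_ofReal (hw p))
      (Or.inr (by finiteness)) ((ENNReal.Tendsto.pow (hX p).enorm).add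
        (ENNReal.Tendsto.pow (hY p).enorm))
      (Or.inr ENNReal.ofReal_ne_top)) (Or.inr hM)
  · rw [hD]
    have h1 : ∀ φ g : FockSpace β hβ, Tendsto (fun n => ‖dilate (u n) φ‖ₑ ^ 2 *
        ‖dilate (u n) g‖ₑ ^ 2) atTop (nhds (‖φ‖ₑ ^ 2 * ‖g‖ₑ ^ 2)) := fun φ g =>
      ENNReal.Tendsto.mul ((tendsto_enorm_sq_dilate φ).comp hu) (Or.inr (by finiteness))
        ((tendsto_enorm_sq_dilate g).comp hu) (Or.inr (by finiteness))
    refine Tendsto.congr (fun n => (hB (u n) (hu0 n)).symm) ?_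
    exact ENNReal.Tendsto.const_mul ((h1 φ g).add (h1 ψ h)) (Or.inr hM)
  · rw [hD]
    finiteness

/-! ### The norm inequality -/

lemma isFockLocalization_fockLocalization (φ ψ : FockSpace β hβ) {f : Circle × ℂ → ℂ}
    (hf : MemLp f ∞ (circleMeasure.prod (volume : Measure ℂ))) :
    IsFockLocalization φ ψ f (fockLocalization φ ψ f) := by
  have h := (existsUnique_fockLocalization φ ψ hf).exists
  rw [fockLocalization, dif_pos h]
  exact h.choose_spec

lemma isBergmanLocalization_bergmanLocalization {α : ℝ} {hα : -1 < α} (φ ψ : BergmanSpace α hα)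
    {f : Circle × ℂ → ℂ} (hf : MemLp f ∞ (circleMeasure.prod mobiusMeasure)) :
    IsBergmanLocalization φ ψ f (bergmanLocalization φ ψ f) := by
  have h := (existsUnique_bergmanLocalization φ ψ hf).exists
  rw [bergmanLocalization, dif_pos h]
  exact h.choose_spec

theorem enorm_fockLocalization_le (φ ψ : FockSpace β hβ) {f : Circle × ℂ → ℂ}
    (hf : MemLp f ∞ (circleMeasure.prod (volume : Measure ℂ))) {σ : ℝ} (hσ : 0 ≤ σ) :
    ‖fockLocalization φ ψ f‖ₑ ≤ limsup (fun r : ℝ =>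
      ‖bergmanLocalization (dilate r φ) (dilate r ψ) (dilateSymbol r σ f)‖ₑ) atTop := by
  set T := fockLocalization φ ψ f
  set S : ∀ r : ℝ, BergmanSpace (β * r ^ 2) (neg_one_lt_mul_sq hβ r) →L[ℂ]
      BergmanSpace (β * r ^ 2) (neg_one_lt_mul_sq hβ r) := fun r =>
    bergmanLocalization (dilate r φ) (dilate r ψ) (dilateSymbol r σ f)
  have hS : ∀ r : ℝ, 0 < r →
      IsBergmanLocalization (dilate r φ) (dilate r ψ) (dilateSymbol r σ f) (S r) := fun r hr =>
    isBergmanLocalization_bergmanLocalization _ _ (memLp_dilateSymbol hr hσ hf)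
  have hT : IsFockLocalization φ ψ f T := isFockLocalization_fockLocalization φ ψ hf
  -- It suffices to bound the norm by every `a` above the upper limit; below such an `a` the Bergman
  -- norms lie eventually.
  refine le_of_forall_gt_imp_ge_of_dense fun a ha => ?_
  rcases eq_or_ne a ∞ with rfl | hatop
  · exact le_top
  lift a to NNReal using hatop
  have hev : ∀ᶠ r : ℝ in atTop, ‖S r‖ ≤ a := by
    filter_upwards [eventually_lt_of_limsup_lt ha] with r hr
    rw [enorm_eq_nnnorm] at hr
    exact_mod_cast hr.le
  -- Pratt's lemma is for sequences, and any sequence tending to infinity will do; the shift keeps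
  -- every `u n` positive.
  set u : ℕ → ℝ := fun n => n + 1
  have hu0 : ∀ n, 0 < u n := fun n => by positivity
  have hu : Tendsto u atTop atTop :=
    tendsto_atTop_add_const_right _ _ tendsto_natCast_atTop_atTop
  have hform : ∀ g h : FockSpace β hβ, ‖inner ℂ h (T g)‖ ≤ ‖h‖ * (a * ‖g‖) := fun g h => by
    refine le_of_tendsto_of_tendsto
      (tendsto_inner_localization φ ψ g h hf hσ hu0 hu hT hS).norm
      (((tendsto_norm_dilate h).comp hu).mul (((tendsto_norm_dilate g).comp hu).const_mul (a : ℝ)))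
      ?_
    filter_upwards [hu.eventually hev] with n hn
    refine (norm_inner_le_norm _ _).trans ?_
    exact mul_le_mul_of_nonneg_left ((S (u n)).le_of_opNorm_le hn _) (norm_nonneg _)
  have hnorm : ‖T‖ ≤ a := by
    refine T.opNorm_le_bound a.2 fun g => ?_
    rcases (norm_nonneg (T g)).eq_or_lt' with h0 | h0
    · rw [h0]
      positivity
    -- Testing the form bound at `h = T g` gives `‖T g‖² ≤ ‖T g‖ (a ‖g‖)`.
    · have h1 := hform g (T g)
      rw [inner_self_eq_norm_sq_to_K, norm_pow, RCLike.norm_ofReal, abs_norm, sq] at h1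
      exact le_of_mul_le_mul_left h1 h0
  rw [enorm_eq_nnnorm]
  exact_mod_cast hnorm

end

end FockBergman

end

open FockBergman in
theorem corollary4p4 (β : ℝ) (hβ : 0 < β) (φ ψ : FockSpace β hβ)
    (f : Circle × ℂ → ℂ) (hf : MemLp f ∞ (circleMeasure.prod (volume : Measure ℂ)))
    (σ : ℝ) (hσ : 0 ≤ σ) :
    (∃! T : FockSpace β hβ →L[ℂ] FockSpace β hβ, IsFockLocalization φ ψ f T) ∧
    (∀ r : ℝ, 0 < r →
      ∃! T : BergmanSpace (β * r ^ 2) (neg_one_lt_mul_sq hβ r) →L[ℂ]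
          BergmanSpace (β * r ^ 2) (neg_one_lt_mul_sq hβ r),
        IsBergmanLocalization (dilate r φ) (dilate r ψ) (dilateSymbol r σ f) T) ∧
    ‖fockLocalization φ ψ f‖ₑ ≤
      limsup (fun r : ℝ =>
        ‖bergmanLocalization (dilate r φ) (dilate r ψ) (dilateSymbol r σ f)‖ₑ) atTop := by
  exact ⟨existsUnique_fockLocalization φ ψ hf,
    fun r hr => existsUnique_bergmanLocalization _ _ (memLp_dilateSymbol hr hσ hf),
    enorm_fockLocalization_le φ ψ hf hσ⟩
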